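/- Let $N\ge 3$, $\kappa>0$ and $\epsilon\in\{1,-1\}$. A seed is a vacuum metric $\hat g=\epsilon e^{2V(x)}dy^2+e^{-2V(x)}\hat h_{ij}(x)\,dx^i dx^j$ in dimension $N$ with $R_{\mu\nu}[\hat g]=\frac{2}{N-2}\Lambda\,\hat g_{\mu\nu}$, where $x$ ranges over a non-empty open $U\subseteq\mathbb R^{N-1}$. A solution of class $\mathcal T_N^\Lambda$ is a pair $$g=e^{2\mu(y)}\big(\epsilon e^{2\alpha V}dy^2+e^{-2\alpha V}e^{-2\delta V}\hat h_{ij}dx^idx^j\big),\qquad \phi=\sigma V(x)+\rho\,\mu(y),$$ on $I\times U$, with $I$ an open interval, $\mu$ smooth and not constant, $\alpha,\delta,\sigma,\rho$ real constants, and a seed with $\Lambda\ne0$, which together with a potential $W$ solves $$R_{\mu\nu}[g]=\kappa\Big(\nabla_\mu\phi\nabla_\nu\phi+\tfrac{2}{N-2}g_{\mu\nu}W(\phi)\Big),\qquad \Box\phi=W'(\phi).$$ For real $\eta,\chi$ and $\varepsilon\in\{1,-1\}$, put $\alpha=\frac1{N-2}$, $\delta=\frac{N-4}{N-2}$, $\gamma=\alpha+\delta=\frac{N-3}{N-2}$,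 $\lambda=\frac{\varepsilon}{\sqrt{N-1}}$, and $$g_{\eta,\chi}=\epsilon e^{2\alpha V}\frac{(N-1)^2}{\eta-\chi\tau^{-2(N-2)}}d\tau^2+\tau^{2(N-1)}e^{-2\gamma V}\hat h_{ij}dx^idx^j,\qquad \phi=\varepsilon\sqrt{\tfrac{N-1}{\kappa(N-2)}}\,\big(V+(N-2)\ln\tau\big),$$ $$W(\phi)=W_0e^{-2k\phi},\qquad k=\varepsilon\sqrt{\tfrac{\kappa}{(N-1)(N-2)}},\qquad W_0=-\epsilon\tfrac{N-2}{2\kappa}(N-1-\lambda^2)\,\eta,$$ on $D\times U$, where $D=\{\tau>0:\ \eta-\chi\tau^{-2(N-2)}>0\}$. (1) If $\chi\neq0$, and $\eta>0$ or $\chi<0$, then $D\ne\emptyset$, and for every seed with $\Lambda=-\frac{\epsilon}{2}\frac{(N-2)^3}{N-1}\chi$ the triple $(g_{\eta,\chi},\phi,W)$ solves the equations above on $D\times U$. There is a smooth increasing bijective change of coordinate $\tau=\tau(y)$ from an open interval $I$ onto $D$ that turns it into a solution of class $\mathcal T_N^\Lambda$, with $\mu=(N-1)\ln\tau$, the above $\alpha,\delta$,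 and $\sigma=\varepsilon\sqrt{\frac{N-1}{\kappa(N-2)}}$, $\rho=\varepsilon\sqrt{\frac{N-2}{\kappa(N-1)}}$. Its potential is non-vanishing exactly when $\eta\neq0$. (2) Conversely, consider a solution of class $\mathcal T_N^\Lambda$ whose potential does not vanish identically along $\phi$. Suppose that $(N-3)\delta=(N-4)(1-\alpha)$ or that the seed is not degenerate, i.e. there are no constant $b$ and function $c$ with $\nabla_i\nabla_jV=b\,\partial_iV\partial_jV+c\,\hat h_{ij}$ on $U$ (covariant derivatives of $\hat h$). Then there is exactly one pair $(\eta,\chi)$ with $\eta\ne0$, $\chi\neq0$, and $\eta>0$ or $\chi<0$, such that $\Lambda=-\frac{\epsilon}{2}\frac{(N-2)^3}{N-1}\chi$ and, for some $\varepsilon=\pm1$, the constants $\alpha,\delta,\sigma,\rho$ are those above, $W(\phi)=W_0e^{-2k\phi}$ along the solution, $\dot\mu$ vanishes for at most one $y\in I$, and with $\tau=e^{\mu(y)/(N-1)}$ the field $\phi$ is the one displayed above and, wherever $\dot\mu\ne0$, $\tau\in D$ and $g$ is $g_{\eta,\chi}$ written in the coordinate $\tau$. -/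

import Mathlib

open scoped ContDiff

noncomputable section

namespace EinsteinScalar

/-! Pseudo-Riemannian geometry in a coordinate chart `ι → ℝ`. -/

section Chart

variable {ι : Type} [Fintype ι] [DecidableEq ι]

/-- The coordinate derivative `∂ᵢ f`. -/
def pd (i : ι) (f : (ι → ℝ) → ℝ) (p : ι → ℝ) : ℝ :=
  fderiv ℝ f p (Pi.single i 1)

/-- `g` is a smooth pseudo-Riemannian metric (of any signature) on `s`. -/
structure IsMetricOn (g : (ι → ℝ) → Matrix ι ι ℝ) (s : Set (ι → ℝ)) : Prop where
  smooth : ∀ i j, ContDiffOn ℝ ∞ (fun p => g p i j) s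
  symm : ∀ p ∈ s, (g p).IsSymm
  nondegenerate : ∀ p ∈ s, (g p).det ≠ 0

/-- The Christoffel symbol `Γᵏᵢⱼ` of the Levi-Civita connection. -/
def christoffel (g : (ι → ℝ) → Matrix ι ι ℝ) (k i j : ι) (p : ι → ℝ) : ℝ :=
  (1 / 2) * ∑ l, (g p)⁻¹ k l *
    (pd i (fun q => g q j l) p + pd j (fun q => g q i l) p - pd l (fun q => g q i j) p)

/-- The Ricci tensor `Rᵢⱼ` (positive on round spheres). -/
def ricci (g : (ι → ℝ) → Matrix ι ι ℝ) (p : ι → ℝ) (i j : ι) : ℝ :=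
  ∑ k, (pd k (christoffel g k i j) p - pd j (christoffel g k i k) p)
    + ∑ k, ∑ l, (christoffel g k k l p * christoffel g l i j p
        - christoffel g k j l p * christoffel g l i k p)

/-- The second covariant derivative `∇ᵢ∇ⱼ f`. -/
def hessian (g : (ι → ℝ) → Matrix ι ι ℝ) (f : (ι → ℝ) → ℝ) (p : ι → ℝ) (i j : ι) : ℝ :=
  pd i (pd j f) p - ∑ k, christoffel g k i j p * pd k f p

/-- The Laplace operator `□ f = gⁱʲ ∇ᵢ∇ⱼ f`. -/
def box (g : (ι → ℝ) → Matrix ι ι ℝ) (f : (ι → ℝ) → ℝ) (p : ι → ℝ) : ℝ :=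
  ∑ i, ∑ j, (g p)⁻¹ i j * hessian g f p i j

/-- The pullback `Φ^* g` of a metric along a map of coordinate charts. -/
def pullbackMetric (Φ : (ι → ℝ) → (ι → ℝ)) (g : (ι → ℝ) → Matrix ι ι ℝ) (p : ι → ℝ) :
    Matrix ι ι ℝ :=
  Matrix.of fun i j => ∑ k, ∑ l,
    pd i (fun q => Φ q k) p * pd j (fun q => Φ q l) p * g (Φ p) k l

/-- `(g, φ)` solves the minimally coupled Einstein-scalar field equations with gravitational
coupling `κ` and (effective) scalar potential `W` on `s`:
`R_μν = κ (∇_μ φ ∇_ν φ + 2 / (N - 2) g_μν W(φ))` and `□ φ = W'(φ)`, `N` being the dimension. -/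
structure SolvesEinsteinScalar (κ : ℝ) (W : ℝ → ℝ) (g : (ι → ℝ) → Matrix ι ι ℝ)
    (φ : (ι → ℝ) → ℝ) (s : Set (ι → ℝ)) : Prop where
  metric : IsMetricOn g s
  smooth : ContDiffOn ℝ ∞ φ s
  einstein : ∀ p ∈ s, ∀ i j, ricci g p i j =
    κ * (pd i φ p * pd j φ p + 2 / ((Fintype.card ι : ℝ) - 2) * g p i j * W (φ p))
  scalar : ∀ p ∈ s, HasDerivAt W (box g φ p) (φ p)

end Chart

/-! Space-time charts of dimension `N`: one distinguished coordinate (`y` or `τ`) and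
`N - 1` coordinates `x` on the orthogonal hypersurfaces. -/

/-- The index set of the space-time coordinates. -/
abbrev Idx (N : ℕ) : Type := Unit ⊕ Fin (N - 1)

/-- The distinguished coordinate of a space-time point. -/
def yc {N : ℕ} (p : Idx N → ℝ) : ℝ := p (Sum.inl ())

/-- The hypersurface coordinates of a space-time point. -/
def xc {N : ℕ} (p : Idx N → ℝ) : Fin (N - 1) → ℝ := fun i => p (Sum.inr i)

/-- The product domain `I × U`. -/
def slab {N : ℕ} (I : Set ℝ) (U : Set (Fin (N - 1) → ℝ)) : Set (Idx N → ℝ) :=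
  {p | yc p ∈ I ∧ xc p ∈ U}

/-- The metric `a dy² + bᵢⱼ dxⁱ dxʲ`. -/
def splitMetric {N : ℕ} (a : (Idx N → ℝ) → ℝ)
    (b : (Idx N → ℝ) → Matrix (Fin (N - 1)) (Fin (N - 1)) ℝ) (p : Idx N → ℝ) :
    Matrix (Idx N) (Idx N) ℝ :=
  Matrix.fromBlocks (Matrix.of fun _ _ => a p) 0 0 (b p)

/-- The change of the distinguished coordinate `(y, x) ↦ (T y, x)`. -/
def changeTime {N : ℕ} (T : ℝ → ℝ) (p : Idx N → ℝ) : Idx N → ℝ :=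
  Sum.elim (fun _ => T (yc p)) (xc p)

/-- The orthogonal-symmetric metric `g[V, h] = ε e^{2V(x)} dy² + e^{-2V(x)} hᵢⱼ(x) dxⁱ dxʲ`. -/
def orthMetric {N : ℕ} (ε : ℝ) (V : (Fin (N - 1) → ℝ) → ℝ)
    (h : (Fin (N - 1) → ℝ) → Matrix (Fin (N - 1)) (Fin (N - 1)) ℝ) :
    (Idx N → ℝ) → Matrix (Idx N) (Idx N) ℝ :=
  splitMetric (fun p => ε * Real.exp (2 * V (xc p)))
    (fun p => Real.exp (-2 * V (xc p)) • h (xc p))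

/-- A seed: an orthogonal-symmetric solution `g[V, h]` of the vacuum Einstein equations
`R_μν = 2 Λ / (N - 2) g_μν`, over a coordinate domain `U` of the hypersurfaces. -/
structure IsVacuumSeed (N : ℕ) (ε Λ : ℝ) (U : Set (Fin (N - 1) → ℝ))
    (V : (Fin (N - 1) → ℝ) → ℝ)
    (h : (Fin (N - 1) → ℝ) → Matrix (Fin (N - 1)) (Fin (N - 1)) ℝ) : Prop where
  isOpen : IsOpen U
  nonempty : U.Nonempty
  smooth : ContDiffOn ℝ ∞ V U
  metric : IsMetricOn h U
  vacuum : ∀ p ∈ slab (N := N) Set.univ U, ∀ i j : Idx N,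
    ricci (orthMetric ε V h) p i j = 2 / ((N : ℝ) - 2) * orthMetric ε V h p i j * Λ

/-- The conformally y-inflated metric
`e^{2μ(y)} (ε e^{2αV} dy² + e^{-2αV} e^{-2δV} hᵢⱼ dxⁱ dxʲ)`. -/
def inflatedMetric {N : ℕ} (ε α δ : ℝ) (μ : ℝ → ℝ) (V : (Fin (N - 1) → ℝ) → ℝ)
    (h : (Fin (N - 1) → ℝ) → Matrix (Fin (N - 1)) (Fin (N - 1)) ℝ) :
    (Idx N → ℝ) → Matrix (Idx N) (Idx N) ℝ :=
  splitMetric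
    (fun p => Real.exp (2 * μ (yc p)) * (ε * Real.exp (2 * α * V (xc p))))
    (fun p => (Real.exp (2 * μ (yc p)) *
      (Real.exp (-2 * α * V (xc p)) * Real.exp (-2 * δ * V (xc p)))) • h (xc p))

/-- The scalar field `φ = σ V(x) + ρ μ(y)`. -/
def inflatedField {N : ℕ} (σ ρ : ℝ) (μ : ℝ → ℝ) (V : (Fin (N - 1) → ℝ) → ℝ)
    (p : Idx N → ℝ) : ℝ :=
  σ * V (xc p) + ρ * μ (yc p)

/-- A solution of class `T_N^Λ`: a conformally y-inflated Einstein-scalar field solution with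
non-constant `μ`, on a slab `I × U` with `I` an open interval, obtained from a vacuum seed with
cosmological constant `Λ ≠ 0`. The potential `W` and all parameters are arbitrary. -/
structure IsClassT (N : ℕ) (κ ε Λ : ℝ) (U : Set (Fin (N - 1) → ℝ))
    (V : (Fin (N - 1) → ℝ) → ℝ)
    (h : (Fin (N - 1) → ℝ) → Matrix (Fin (N - 1)) (Fin (N - 1)) ℝ)
    (I : Set ℝ) (μ : ℝ → ℝ) (α δ σ ρ : ℝ) (W : ℝ → ℝ) : Prop where
  seed : IsVacuumSeed N ε Λ U V h
  cosmological : Λ ≠ 0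
  isOpen : IsOpen I
  interval : I.OrdConnected
  smooth : ContDiffOn ℝ ∞ μ I
  inflated : ∃ y₁ ∈ I, ∃ y₂ ∈ I, μ y₁ ≠ μ y₂
  solves : SolvesEinsteinScalar κ W (inflatedMetric ε α δ μ V h) (inflatedField σ ρ μ V)
    (slab I U)

/-- The Hessian of `V` is degenerate: `∇ᵢ∇ⱼV = b ∂ᵢV ∂ⱼV + c(x) hᵢⱼ` on `U` with a constant `b`
and a function `c`. -/
def HasDegenerateHessian {N : ℕ} (U : Set (Fin (N - 1) → ℝ)) (V : (Fin (N - 1) → ℝ) → ℝ)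
    (h : (Fin (N - 1) → ℝ) → Matrix (Fin (N - 1)) (Fin (N - 1)) ℝ) : Prop :=
  ∃ (b : ℝ) (c : (Fin (N - 1) → ℝ) → ℝ), ∀ x ∈ U, ∀ i j,
    hessian h V x i j = b * pd i V x * pd j V x + c x * h x i j

/-! The two-parameter family. `s = ±1` is the sign of the scalar field. -/

/-- `η - χ τ^{-2(N-2)}`. -/
def lapseFactor (N : ℕ) (η χ τ : ℝ) : ℝ := η - χ * (τ ^ (2 * (N - 2)))⁻¹

/-- The range of the coordinate `τ`. -/
def tauDomain (N : ℕ) (η χ : ℝ) : Set ℝ := {τ | 0 < τ ∧ 0 < lapseFactor N η χ τ}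

/-- `ε e^{2αV} (N-1)² / (η - χ τ^{-2(N-2)}) dτ² + τ^{2(N-1)} e^{-2γV} hᵢⱼ dxⁱ dxʲ` with
`α = 1 / (N-2)` and `γ = (N-3) / (N-2)`. -/
def familyMetric {N : ℕ} (ε η χ : ℝ) (V : (Fin (N - 1) → ℝ) → ℝ)
    (h : (Fin (N - 1) → ℝ) → Matrix (Fin (N - 1)) (Fin (N - 1)) ℝ) :
    (Idx N → ℝ) → Matrix (Idx N) (Idx N) ℝ :=
  splitMetric
    (fun p => ε * Real.exp (2 * (1 / ((N : ℝ) - 2)) * V (xc p)) *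
      (((N : ℝ) - 1) ^ 2 / lapseFactor N η χ (yc p)))
    (fun p => (yc p ^ (2 * (N - 1)) *
      Real.exp (-2 * (((N : ℝ) - 3) / ((N : ℝ) - 2)) * V (xc p))) • h (xc p))

/-- `φ = s √((N-1) / (κ(N-2))) (V + (N-2) ln τ)`. -/
def familyField {N : ℕ} (κ s : ℝ) (V : (Fin (N - 1) → ℝ) → ℝ) (p : Idx N → ℝ) : ℝ :=
  s * Real.sqrt (((N : ℝ) - 1) / (κ * ((N : ℝ) - 2))) *
    (V (xc p) + ((N : ℝ) - 2) * Real.log (yc p))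

/-- `λ = s / √(N-1)`. -/
def familyLambda (N : ℕ) (s : ℝ) : ℝ := s / Real.sqrt ((N : ℝ) - 1)

/-- `W₀ = -ε (N-2) / (2κ) (N - 1 - λ²) η`. -/
def familyW₀ (N : ℕ) (κ ε s η : ℝ) : ℝ :=
  -ε * (((N : ℝ) - 2) / (2 * κ)) * ((N : ℝ) - 1 - familyLambda N s ^ 2) * η

/-- `W(φ) = W₀ e^{-2kφ}` with `k = s √(κ / ((N-1)(N-2)))`. -/
def familyPotential (N : ℕ) (κ ε s η : ℝ) (φ : ℝ) : ℝ :=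
  familyW₀ N κ ε s η *
    Real.exp (-2 * (s * Real.sqrt (κ / (((N : ℝ) - 1) * ((N : ℝ) - 2)))) * φ)

/-- The coefficient `σ = s √((N-1) / (κ(N-2)))`. -/
def familySigma (N : ℕ) (κ s : ℝ) : ℝ := s * Real.sqrt (((N : ℝ) - 1) / (κ * ((N : ℝ) - 2)))

/-- The coefficient `ρ = s √((N-2) / (κ(N-1)))`. -/
def familyRho (N : ℕ) (κ s : ℝ) : ℝ := s * Real.sqrt (((N : ℝ) - 2) / (κ * ((N : ℝ) - 1)))

end EinsteinScalar

end

open EinsteinScalar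

set_option linter.unusedSectionVars false
set_option linter.unusedDecidableInType false
set_option linter.unusedSimpArgs false

/-! All metrics in play have the form ε P(y) e^{2aV} dy² + Q(y) e^{2βV} h (`expWarped`): the seed is
P = Q = 1, a = 1, β = -1; the inflated metrics have P = Q = e^{2μ}, a = α, β = -(α+δ); and g_{η,χ}
has this form in every parametrization of τ. Their Ricci tensor and Laplacian follow from the
formulas for warped metrics and for conformal changes of h. The seed equations express □V and Ric(h)
through dV, the Hessian of V and Λ e^{-2V}. After this substitution one number c = N-4 + a + (N-3)β
multiplies every remaining Hessian and |∇V|² term (`ricci_inl_inl`, `ricci_inr_inr`,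
`box_expWarped`).

Existence: for a = 1/(N-2) and β = -(N-3)/(N-2) one has c = 0, the ∂V∂V term equals κσ² ∂V∂V, and
all powers of e^V match. Only identities in y remain (`solvesEinsteinScalar`), and these are
rational identities in τ and its derivatives (`solves_family`). The inflated form comes from the
coordinate with dy = (N-1) dτ / (√ℓ τ^{N-1}), where ℓ = η - χτ^{-2(N-2)}
(`exists_reparametrization`).

Converse: if c ≠ 0, the spatial Einstein equations can be solved for the Hessian of V, so the seed
is degenerate; for c = (N-4)(1-α) - (N-3)δ, the other alternative of the hypothesis says c = 0
outright. Since h has dimension at least two, the ∂V∂V part and the h part then vanish separately.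
Eliminating W gives a function of y times e^{(2-2(2α+δ))V} equal to a constant. As Λ ≠ 0 forces V to
be non-constant, 2α+δ = 1, which fixes α, δ, κσ² and κσρ, and leaves μ'' = (N-2)/(N-1) (μ'² + χ)
(`reduced`). Its first integral μ'² + χ = η τ^{2(N-2)}, with τ = e^{μ/(N-1)}, is the source of η; it
turns e^{2μ}dy² into (N-1)² dτ²/ℓ and gives the exponential potential. Uniqueness: Λ determines χ,
and a value of W determines η. -/

namespace EinsteinScalar

open Filter Topology

/-! ### Rules for coordinate derivatives. -/

section Calculus

variable {ι : Type} [Fintype ι] [DecidableEq ι] {f g : (ι → ℝ) → ℝ} {p : ι → ℝ} {i j : ι}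
  {s : Set (ι → ℝ)}

theorem pd_congr (hfg : f =ᶠ[𝓝 p] g) : pd i f p = pd i g p := by
  unfold pd; rw [hfg.fderiv_eq]

theorem pd_congr_on (hs : IsOpen s) (hp : p ∈ s) (hfg : ∀ q ∈ s, f q = g q) :
    pd i f p = pd i g p :=
  pd_congr (by filter_upwards [hs.mem_nhds hp] with q hq using hfg q hq)

theorem pd_const (c : ℝ) : pd i (fun _ => c) p = 0 := by
  simp [pd]

theorem pd_add (hf : DifferentiableAt ℝ f p) (hg : DifferentiableAt ℝ g p) :
    pd i (fun q => f q + g q) p = pd i f p + pd i g p := by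
  unfold pd; rw [fderiv_fun_add hf hg]; rfl

theorem pd_sub (hf : DifferentiableAt ℝ f p) (hg : DifferentiableAt ℝ g p) :
    pd i (fun q => f q - g q) p = pd i f p - pd i g p := by
  unfold pd; rw [fderiv_fun_sub hf hg]; rfl

theorem pd_mul (hf : DifferentiableAt ℝ f p) (hg : DifferentiableAt ℝ g p) :
    pd i (fun q => f q * g q) p = pd i f p * g p + f p * pd i g p := by
  unfold pd; rw [fderiv_fun_mul hf hg]; simp; ring

theorem pd_const_mul (c : ℝ) (hf : DifferentiableAt ℝ f p) :
    pd i (fun q => c * f q) p = c * pd i f p := by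
  rw [pd_mul (differentiableAt_const c) hf, pd_const]; ring

theorem pd_sum {κ : Type} (t : Finset κ) {F : κ → (ι → ℝ) → ℝ}
    (hF : ∀ k ∈ t, DifferentiableAt ℝ (F k) p) :
    pd i (fun q => ∑ k ∈ t, F k q) p = ∑ k ∈ t, pd i (F k) p := by
  unfold pd; rw [fderiv_fun_sum hF]; simp

theorem pd_comp {F : ℝ → ℝ} {F' : ℝ} (hF : HasDerivAt F F' (f p))
    (hf : DifferentiableAt ℝ f p) : pd i (fun q => F (f q)) p = F' * pd i f p := by
  have h : HasFDerivAt (fun q => F (f q)) (F' • fderiv ℝ f p) p :=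
    hF.comp_hasFDerivAt p hf.hasFDerivAt
  unfold pd
  rw [h.fderiv]
  simp

theorem contDiffOn_pd (hs : IsOpen s) (hf : ContDiffOn ℝ ∞ f s) (i : ι) :
    ContDiffOn ℝ ∞ (pd i f) s :=
  ((contDiffOn_infty_iff_fderiv_of_isOpen hs).1 hf).2.clm_apply contDiffOn_const

theorem differentiableAt_of_contDiffOn {E : Type*} [NormedAddCommGroup E] [NormedSpace ℝ E]
    {f : E → ℝ} {s : Set E} {p : E} (hs : IsOpen s) (hf : ContDiffOn ℝ ∞ f s) (hp : p ∈ s) :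
    DifferentiableAt ℝ f p :=
  (hf.contDiffAt (hs.mem_nhds hp)).differentiableAt (by simp)

/-- Both sides are values of the symmetric second Fréchet derivative on a pair of basis vectors. -/
theorem pd_comm (hs : IsOpen s) (hf : ContDiffOn ℝ ∞ f s) (hp : p ∈ s) (i j : ι) :
    pd i (pd j f) p = pd j (pd i f) p := by
  have h2 : DifferentiableAt ℝ (fderiv ℝ f) p :=
    (((contDiffOn_infty_iff_fderiv_of_isOpen hs).1 hf).2.contDiffAt (hs.mem_nhds hp)).differentiableAt
      (by simp)
  have key : ∀ i j : ι, pd i (pd j f) p =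
      fderiv ℝ (fderiv ℝ f) p (Pi.single i 1) (Pi.single j 1) := by
    intro i j
    have : pd j f = fun q => fderiv ℝ f q (Pi.single j 1) := rfl
    rw [this, pd, fderiv_clm_apply h2 (differentiableAt_const _)]
    simp
  rw [key, key]
  exact (hf.contDiffAt (hs.mem_nhds hp)).isSymmSndFDerivAt
    (by simpa using WithTop.coe_le_coe.2 (le_top : (2 : ℕ∞) ≤ ⊤)) _ _

end Calculus

/-! ### Levi-Civita connection, gradient and divergence. -/

section Metric

variable {ι : Type} [Fintype ι] [DecidableEq ι] {g : (ι → ℝ) → Matrix ι ι ℝ}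
  {f : (ι → ℝ) → ℝ} {p : ι → ℝ} {s : Set (ι → ℝ)}

theorem contDiffOn_det {E : Type*} [NormedAddCommGroup E] [NormedSpace ℝ E] {s : Set E}
    {g : E → Matrix ι ι ℝ} (hg : ∀ i j, ContDiffOn ℝ ∞ (fun p => g p i j) s) :
    ContDiffOn ℝ ∞ (fun p => (g p).det) s := by
  simp only [Matrix.det_apply']
  exact ContDiffOn.sum fun σ _ => contDiffOn_const.mul (contDiffOn_prod fun i _ => hg _ _)

/-- By Cramer's rule an entry of the inverse is a cofactor over the determinant, and a cofactor is
the determinant of a matrix with smooth entries. -/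
theorem IsMetricOn.smooth_inv (hg : IsMetricOn g s) (i j : ι) :
    ContDiffOn ℝ ∞ (fun p => (g p)⁻¹ i j) s := by
  have : ContDiffOn ℝ ∞ (fun p => ((g p).det)⁻¹ * (g p).adjugate i j) s := by
    refine ((contDiffOn_det hg.smooth).inv hg.nondegenerate).mul ?_
    simp only [Matrix.adjugate_apply]
    refine contDiffOn_det fun a b => ?_
    by_cases hab : a = j
    · subst hab; simp only [Matrix.updateRow_self]; exact contDiffOn_const
    · simp only [Matrix.updateRow_ne hab]; exact hg.smooth a b
  refine this.congr fun p _ => ?_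
  simp [Matrix.inv_def, Ring.inverse_eq_inv']

theorem IsMetricOn.isUnit_det (hg : IsMetricOn g s) (hp : p ∈ s) : IsUnit (g p).det :=
  isUnit_iff_ne_zero.2 (hg.nondegenerate p hp)

theorem IsMetricOn.apply_comm (hg : IsMetricOn g s) (hp : p ∈ s) (i j : ι) :
    g p i j = g p j i := (hg.symm p hp).apply j i

theorem IsMetricOn.inv_apply_comm (hg : IsMetricOn g s) (hp : p ∈ s) (i j : ι) :
    (g p)⁻¹ i j = (g p)⁻¹ j i := by
  have : ((g p)⁻¹).IsSymm := by
    unfold Matrix.IsSymm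
    rw [Matrix.transpose_nonsing_inv, (hg.symm p hp)]
  exact this.apply j i

theorem IsMetricOn.pd_apply_comm (hs : IsOpen s) (hg : IsMetricOn g s) (hp : p ∈ s) (k i j : ι) :
    pd k (fun q => g q i j) p = pd k (fun q => g q j i) p :=
  pd_congr_on hs hp fun _ hq => hg.apply_comm hq i j

theorem IsMetricOn.sum_inv_mul (hg : IsMetricOn g s) (hp : p ∈ s) (i j : ι) :
    ∑ l, (g p)⁻¹ i l * g p l j = if i = j then 1 else 0 := by
  rw [← Matrix.mul_apply, Matrix.nonsing_inv_mul _ (hg.isUnit_det hp), Matrix.one_apply]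

theorem IsMetricOn.sum_mul_sum_inv (hg : IsMetricOn g s) (hp : p ∈ s) (i : ι) (X : ι → ℝ) :
    ∑ l, g p i l * ∑ a, (g p)⁻¹ l a * X a = X i := by
  have : (g p).mulVec ((g p)⁻¹.mulVec X) i = X i := by
    rw [Matrix.mulVec_mulVec, Matrix.mul_nonsing_inv _ (hg.isUnit_det hp), Matrix.one_mulVec]
  exact this

theorem IsMetricOn.sum_inv_sum_mul (hg : IsMetricOn g s) (hp : p ∈ s) (i : ι) (X : ι → ℝ) :
    ∑ l, (g p)⁻¹ i l * ∑ a, g p l a * X a = X i := by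
  have : (g p)⁻¹.mulVec ((g p).mulVec X) i = X i := by
    rw [Matrix.mulVec_mulVec, Matrix.nonsing_inv_mul _ (hg.isUnit_det hp), Matrix.one_mulVec]
  exact this

theorem IsMetricOn.contDiffOn_christoffel (hs : IsOpen s) (hg : IsMetricOn g s) (k i j : ι) :
    ContDiffOn ℝ ∞ (christoffel g k i j) s := by
  unfold christoffel
  refine contDiffOn_const.mul (ContDiffOn.sum fun l _ => (hg.smooth_inv k l).mul ?_)
  exact ((contDiffOn_pd hs (hg.smooth _ _) _).add (contDiffOn_pd hs (hg.smooth _ _) _)).sub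
    (contDiffOn_pd hs (hg.smooth _ _) _)

theorem IsMetricOn.christoffel_comm (hs : IsOpen s) (hg : IsMetricOn g s) (hp : p ∈ s)
    (k i j : ι) : christoffel g k i j p = christoffel g k j i p := by
  unfold christoffel
  congr 1
  refine Finset.sum_congr rfl fun l _ => ?_
  rw [hg.pd_apply_comm hs hp l i j]; ring

/-- Lowering the upper index removes the inverse metric and leaves only first derivatives of g, from
which compatibility with the metric can be read off. -/
theorem IsMetricOn.sum_mul_christoffel (hg : IsMetricOn g s) (hp : p ∈ s)
    (a i j : ι) : ∑ k, g p a k * christoffel g k i j p =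
      (1 / 2) * (pd i (fun q => g q j a) p + pd j (fun q => g q i a) p
        - pd a (fun q => g q i j) p) := by
  rw [← hg.sum_mul_sum_inv hp a fun a => (1 / 2) * (pd i (fun q => g q j a) p +
    pd j (fun q => g q i a) p - pd a (fun q => g q i j) p)]
  refine Finset.sum_congr rfl fun l _ => ?_
  unfold christoffel
  rw [Finset.mul_sum]
  congr 1
  exact Finset.sum_congr rfl fun _ _ => by ring

/-- The metric is covariantly constant. -/
theorem IsMetricOn.pd_metric (hs : IsOpen s) (hg : IsMetricOn g s) (hp : p ∈ s) (k i j : ι) :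
    pd k (fun q => g q i j) p =
      ∑ l, g p j l * christoffel g l k i p + ∑ l, g p i l * christoffel g l k j p := by
  rw [hg.sum_mul_christoffel hp, hg.sum_mul_christoffel hp,
    hg.pd_apply_comm hs hp k j i, hg.pd_apply_comm hs hp i k j]
  ring

/-- The components of the gradient of `f`. -/
noncomputable def grad (g : (ι → ℝ) → Matrix ι ι ℝ) (f : (ι → ℝ) → ℝ) (l : ι) (p : ι → ℝ) : ℝ :=
  ∑ a, (g p)⁻¹ l a * pd a f p

/-- The squared norm of the gradient of `f`. -/
noncomputable def gradSq (g : (ι → ℝ) → Matrix ι ι ℝ) (f : (ι → ℝ) → ℝ) (p : ι → ℝ) : ℝ :=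
  ∑ l, grad g f l p * pd l f p

theorem IsMetricOn.contDiffOn_grad (hs : IsOpen s) (hg : IsMetricOn g s)
    (hf : ContDiffOn ℝ ∞ f s) (l : ι) : ContDiffOn ℝ ∞ (grad g f l) s :=
  ContDiffOn.sum fun a _ => (hg.smooth_inv l a).mul (contDiffOn_pd hs hf a)

theorem IsMetricOn.sum_mul_grad (hg : IsMetricOn g s) (hp : p ∈ s) (i : ι) :
    ∑ l, g p i l * grad g f l p = pd i f p :=
  hg.sum_mul_sum_inv hp i fun a => pd a f p

/-- Product rule for `g (grad f) = df`. It yields the covariant derivative of the gradient, and it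
evaluates a trace in `ricci_conformal`. -/
theorem IsMetricOn.sum_pd_mul_grad (hs : IsOpen s) (hg : IsMetricOn g s)
    (hf : ContDiffOn ℝ ∞ f s) (hp : p ∈ s) (k i : ι) :
    ∑ l, (pd k (fun q => g q i l) p * grad g f l p + g p i l * pd k (grad g f l) p) =
      pd k (pd i f) p := by
  rw [← pd_congr_on hs hp fun q hq => hg.sum_mul_grad (f := f) hq i, pd_sum]
  · refine Finset.sum_congr rfl fun l _ => ?_
    rw [pd_mul (differentiableAt_of_contDiffOn hs (hg.smooth _ _) hp)
      (differentiableAt_of_contDiffOn hs (hg.contDiffOn_grad hs hf l) hp)]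
  · intro l _
    exact (differentiableAt_of_contDiffOn hs (hg.smooth _ _) hp).mul
      (differentiableAt_of_contDiffOn hs (hg.contDiffOn_grad hs hf l) hp)

theorem IsMetricOn.sum_christoffel_mul_pd (hg : IsMetricOn g s) (hp : p ∈ s) (k a : ι) :
    ∑ l, christoffel g l k a p * pd l f p =
      ∑ b, (∑ l, g p b l * christoffel g l k a p) * grad g f b p := by
  simp only [← hg.sum_mul_grad (f := f) hp, Finset.mul_sum, Finset.sum_mul]
  rw [Finset.sum_comm]
  refine Finset.sum_congr rfl fun b _ => Finset.sum_congr rfl fun l _ => ?_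
  rw [hg.apply_comm hp b l]; ring

/-- The covariant derivative of the gradient is the Hessian with an index raised. -/
theorem IsMetricOn.pd_grad (hs : IsOpen s) (hg : IsMetricOn g s)
    (hf : ContDiffOn ℝ ∞ f s) (hp : p ∈ s) (k l : ι) :
    pd k (grad g f l) p = - ∑ a, christoffel g l k a p * grad g f a p +
      ∑ a, (g p)⁻¹ l a * hessian g f p k a := by
  -- It suffices to compare both sides with the index l lowered, so every term is written as the
  -- inverse metric applied to its lowered form.
  rw [← hg.sum_inv_sum_mul hp l fun l => pd k (grad g f l) p,
    ← hg.sum_inv_sum_mul hp l fun l => ∑ a, christoffel g l k a p * grad g f a p,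
    ← Finset.sum_neg_distrib, ← Finset.sum_add_distrib]
  refine Finset.sum_congr rfl fun a _ => ?_
  rw [← mul_neg, ← mul_add]
  congr 1
  have h1 := hg.sum_pd_mul_grad hs hf hp k a
  rw [Finset.sum_add_distrib] at h1
  have h2 : ∑ l, g p a l * ∑ b, christoffel g l k b p * grad g f b p =
      ∑ b, (∑ l, g p a l * christoffel g l k b p) * grad g f b p := by
    simp only [Finset.mul_sum, Finset.sum_mul]
    rw [Finset.sum_comm]
    exact Finset.sum_congr rfl fun _ _ => Finset.sum_congr rfl fun _ _ => by ring
  unfold hessian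
  rw [h2, hg.sum_christoffel_mul_pd hp, ← h1, eq_comm, ← sub_eq_zero]
  -- Compatibility with the metric turns the derivative of g into two lowered Christoffel sums: one
  -- cancels the connection term of the Hessian, the other that of the gradient.
  have h3 : ∀ b, pd k (fun q => g q a b) p * grad g f b p =
      (∑ l, g p b l * christoffel g l k a p) * grad g f b p +
      (∑ l, g p a l * christoffel g l k b p) * grad g f b p := fun b => by
    rw [hg.pd_metric hs hp]; ring
  simp only [h3, Finset.sum_add_distrib]
  ring

/-- Trace of `pd_grad`. The coordinate divergence is the one needed, because the Ricci tensor
contains plain derivatives of the connection coefficients. -/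
theorem IsMetricOn.divergence_grad (hs : IsOpen s) (hg : IsMetricOn g s)
    (hf : ContDiffOn ℝ ∞ f s) (hp : p ∈ s) :
    ∑ k, pd k (grad g f k) p =
      box g f p - ∑ k, ∑ l, christoffel g k k l p * grad g f l p := by
  simp only [hg.pd_grad hs hf hp, Finset.sum_add_distrib, Finset.sum_neg_distrib, box]
  ring

theorem gradSq_eq (g : (ι → ℝ) → Matrix ι ι ℝ) (f : (ι → ℝ) → ℝ) (p : ι → ℝ) :
    gradSq g f p = ∑ i, ∑ j, (g p)⁻¹ i j * (pd i f p * pd j f p) := by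
  unfold gradSq grad
  refine Finset.sum_congr rfl fun i _ => ?_
  rw [Finset.sum_mul]
  exact Finset.sum_congr rfl fun _ _ => by ring

theorem IsMetricOn.sum_inv_mul_self (hg : IsMetricOn g s) (hp : p ∈ s) :
    ∑ i, ∑ j, (g p)⁻¹ i j * g p i j = Fintype.card ι := by
  have : ∀ i, ∑ j, (g p)⁻¹ i j * g p i j = 1 := fun i => by
    rw [← (hg.sum_inv_mul hp i i).trans (if_pos rfl)]
    exact Finset.sum_congr rfl fun j _ => by rw [hg.apply_comm hp i j]
  simp [this]

end Metric

/-! ### Conformal change of Christoffel symbols, Hessian, Laplacian and Ricci tensor. -/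

section Conformal

variable {ι : Type} [Fintype ι] [DecidableEq ι] {g : (ι → ℝ) → Matrix ι ι ℝ}
  {f φ : (ι → ℝ) → ℝ} {p : ι → ℝ} {s : Set (ι → ℝ)}

/-- The metric `e^{2f} g`. -/
noncomputable def conformal (f : (ι → ℝ) → ℝ) (g : (ι → ℝ) → Matrix ι ι ℝ) (p : ι → ℝ) :
    Matrix ι ι ℝ :=
  Real.exp (2 * f p) • g p

theorem inv_smul_of_ne_zero {c : ℝ} (hc : c ≠ 0) {A : Matrix ι ι ℝ} (hA : IsUnit A.det) :
    (c • A)⁻¹ = c⁻¹ • A⁻¹ :=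
  Matrix.inv_smul' A (Units.mk0 c hc) hA

theorem IsMetricOn.conformal (hg : IsMetricOn g s) (hf : ContDiffOn ℝ ∞ f s) :
    IsMetricOn (conformal f g) s where
  smooth i j := (contDiffOn_const.mul hf).exp.mul (hg.smooth i j)
  symm p hp := by
    unfold EinsteinScalar.conformal Matrix.IsSymm
    rw [Matrix.transpose_smul, (hg.symm p hp)]
  nondegenerate p hp := by
    unfold EinsteinScalar.conformal
    rw [Matrix.det_smul]
    exact mul_ne_zero (pow_ne_zero _ (Real.exp_pos _).ne') (hg.nondegenerate p hp)

theorem IsMetricOn.conformal_inv_apply (hg : IsMetricOn g s) (hp : p ∈ s) (i j : ι) :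
    (EinsteinScalar.conformal f g p)⁻¹ i j = Real.exp (-2 * f p) * (g p)⁻¹ i j := by
  unfold EinsteinScalar.conformal
  rw [inv_smul_of_ne_zero (Real.exp_pos _).ne' (hg.isUnit_det hp), ← Real.exp_neg]
  simp

/-- The difference of the Levi-Civita connections of `e^{2f} g` and `g`. -/
noncomputable def conformalShift (f : (ι → ℝ) → ℝ) (g : (ι → ℝ) → Matrix ι ι ℝ) (k i j : ι)
    (p : ι → ℝ) : ℝ :=
  (if k = i then 1 else 0) * pd j f p + (if k = j then 1 else 0) * pd i f p -
    g p i j * grad g f k p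

/-- Differentiating e^{2f} g adds 2 ∂f g to ∂g, up to the factor e^{2f}, which cancels against the
e^{-2f} of the inverse metric. -/
theorem IsMetricOn.christoffel_conformal (hs : IsOpen s) (hg : IsMetricOn g s)
    (hf : ContDiffOn ℝ ∞ f s) (hp : p ∈ s) (k i j : ι) :
    christoffel (EinsteinScalar.conformal f g) k i j p =
      christoffel g k i j p + conformalShift f g k i j p := by
  have hfd := differentiableAt_of_contDiffOn hs hf hp
  have hpd : ∀ l a b, pd l (fun q => EinsteinScalar.conformal f g q a b) p =
      Real.exp (2 * f p) * (pd l (fun q => g q a b) p + 2 * pd l f p * g p a b) := by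
    intro l a b
    have : (fun q => EinsteinScalar.conformal f g q a b) =
        fun q => Real.exp (2 * f q) * g q a b := rfl
    have hd2 : DifferentiableAt ℝ (fun q => 2 * f q) p := hfd.const_mul 2
    rw [this, pd_mul hd2.exp (differentiableAt_of_contDiffOn hs (hg.smooth a b) hp),
      pd_comp (F := Real.exp) (Real.hasDerivAt_exp _) hd2, pd_const_mul _ hfd]
    ring
  have hexp : Real.exp (-2 * f p) * Real.exp (2 * f p) = 1 := by
    rw [← Real.exp_add]; simp
  have h1 : ∀ a b, ∑ l, (g p)⁻¹ k l * (pd a f p * g p b l) =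
      (if k = b then 1 else 0) * pd a f p := by
    intro a b
    rw [← hg.sum_inv_mul hp k b, Finset.sum_mul]
    exact Finset.sum_congr rfl fun l _ => by rw [hg.apply_comm hp b l]; ring
  have h2 : ∑ l, (g p)⁻¹ k l * (pd l f p * g p i j) = g p i j * grad g f k p := by
    unfold grad
    rw [Finset.mul_sum]
    exact Finset.sum_congr rfl fun l _ => by ring
  unfold conformalShift
  rw [← h1 j i, ← h1 i j, ← h2]
  unfold christoffel
  simp only [hpd, hg.conformal_inv_apply hp, Finset.mul_sum]
  rw [← Finset.sum_add_distrib, ← Finset.sum_sub_distrib, ← Finset.sum_add_distrib]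
  refine Finset.sum_congr rfl fun l _ => ?_
  linear_combination ((g p)⁻¹ k l * ((1/2) * (pd i (fun q => g q j l) p + pd j (fun q => g q i l) p
    - pd l (fun q => g q i j) p) + pd i f p * g p j l + pd j f p * g p i l - pd l f p * g p i j))
      * hexp

theorem IsMetricOn.hessian_conformal (hs : IsOpen s) (hg : IsMetricOn g s)
    (hf : ContDiffOn ℝ ∞ f s) (hp : p ∈ s) (i j : ι) :
    hessian (EinsteinScalar.conformal f g) φ p i j = hessian g φ p i j -
      (pd i f p * pd j φ p + pd j f p * pd i φ p - g p i j * ∑ k, grad g f k p * pd k φ p) := by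
  unfold hessian
  simp only [hg.christoffel_conformal hs hf hp, conformalShift, add_mul, sub_mul,
    Finset.sum_add_distrib, Finset.sum_sub_distrib, ite_mul, one_mul, zero_mul, Finset.sum_ite_eq',
    Finset.mem_univ, if_true, Finset.mul_sum, mul_assoc]
  ring

theorem IsMetricOn.sum_inv_pd_pd (hg : IsMetricOn g s) (hp : p ∈ s) :
    ∑ i, ∑ j, (g p)⁻¹ i j * (pd i f p * pd j φ p) = ∑ k, grad g f k p * pd k φ p := by
  unfold grad
  simp only [Finset.sum_mul]
  rw [Finset.sum_comm]
  refine Finset.sum_congr rfl fun i _ => Finset.sum_congr rfl fun j _ => ?_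
  rw [hg.inv_apply_comm hp]; ring

theorem IsMetricOn.box_conformal (hs : IsOpen s) (hg : IsMetricOn g s)
    (hf : ContDiffOn ℝ ∞ f s) (hp : p ∈ s) :
    box (EinsteinScalar.conformal f g) φ p = Real.exp (-2 * f p) *
      (box g φ p + ((Fintype.card ι : ℝ) - 2) * ∑ k, grad g f k p * pd k φ p) := by
  have h1 := hg.sum_inv_pd_pd (f := f) (φ := φ) hp
  have h2 : ∑ i, ∑ j, (g p)⁻¹ i j * (pd j f p * pd i φ p) = ∑ k, grad g f k p * pd k φ p := by
    rw [← h1, Finset.sum_comm]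
    refine Finset.sum_congr rfl fun i _ => Finset.sum_congr rfl fun j _ => ?_
    rw [hg.inv_apply_comm hp]
  have h3 := hg.sum_inv_mul_self hp
  have key : ∀ i j, (EinsteinScalar.conformal f g p)⁻¹ i j *
      hessian (EinsteinScalar.conformal f g) φ p i j =
      Real.exp (-2 * f p) * ((g p)⁻¹ i j * hessian g φ p i j) -
      Real.exp (-2 * f p) * ((g p)⁻¹ i j * (pd i f p * pd j φ p)) -
      Real.exp (-2 * f p) * ((g p)⁻¹ i j * (pd j f p * pd i φ p)) +
      (Real.exp (-2 * f p) * ∑ k, grad g f k p * pd k φ p) * ((g p)⁻¹ i j * g p i j) := by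
    intro i j
    rw [hg.conformal_inv_apply hp, hg.hessian_conformal hs hf hp]
    ring
  unfold box
  simp only [key, Finset.sum_add_distrib, Finset.sum_sub_distrib, ← Finset.mul_sum]
  rw [h1, h2, h3]
  ring

theorem IsMetricOn.contDiffOn_conformalShift (hs : IsOpen s) (hg : IsMetricOn g s)
    (hf : ContDiffOn ℝ ∞ f s) (k i j : ι) : ContDiffOn ℝ ∞ (conformalShift f g k i j) s :=
  ((contDiffOn_const.mul (contDiffOn_pd hs hf j)).add
    (contDiffOn_const.mul (contDiffOn_pd hs hf i))).sub
    ((hg.smooth i j).mul (hg.contDiffOn_grad hs hf k))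

theorem IsMetricOn.pd_conformalShift (hs : IsOpen s) (hg : IsMetricOn g s)
    (hf : ContDiffOn ℝ ∞ f s) (hp : p ∈ s) (l k i j : ι) :
    pd l (conformalShift f g k i j) p =
      (if k = i then 1 else 0) * pd l (pd j f) p + (if k = j then 1 else 0) * pd l (pd i f) p -
        (pd l (fun q => g q i j) p * grad g f k p + g p i j * pd l (grad g f k) p) := by
  have hF := fun a => differentiableAt_of_contDiffOn hs (contDiffOn_pd hs hf a) hp
  have hG := fun a b => differentiableAt_of_contDiffOn hs (hg.smooth a b) hp
  have hX := fun a => differentiableAt_of_contDiffOn hs (hg.contDiffOn_grad hs hf a) hp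
  have h1 := (hF j).const_mul (if k = i then (1 : ℝ) else 0)
  have h2 := (hF i).const_mul (if k = j then (1 : ℝ) else 0)
  rw [← pd_mul (hG i j) (hX k), ← pd_const_mul _ (hF j), ← pd_const_mul _ (hF i), ← pd_add h1 h2]
  exact pd_sub (h1.add h2) ((hG i j).mul (hX k))

/-- Contraction over the upper index with an arbitrary Y. The quadratic terms in the conformal Ricci
formula are mostly instances of it, with Y a Christoffel symbol, a partial derivative or the shift
itself. -/
theorem sum_conformalShift_mul (f : (ι → ℝ) → ℝ) (g : (ι → ℝ) → Matrix ι ι ℝ) (i j : ι)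
    (p : ι → ℝ) (Y : ι → ℝ) : ∑ l, conformalShift f g l i j p * Y l =
      Y i * pd j f p + Y j * pd i f p - g p i j * ∑ l, grad g f l p * Y l := by
  unfold conformalShift
  simp only [add_mul, sub_mul, Finset.sum_add_distrib, Finset.sum_sub_distrib, ite_mul, one_mul,
    zero_mul, Finset.sum_ite_eq', Finset.mem_univ, if_true, Finset.mul_sum, mul_assoc]
  ring

theorem sum_mul_conformalShift (f : (ι → ℝ) → ℝ) (g : (ι → ℝ) → Matrix ι ι ℝ) (k j : ι)
    (p : ι → ℝ) (Y : ι → ℝ) : ∑ l, conformalShift f g k j l p * Y l =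
      (if k = j then 1 else 0) * ∑ l, pd l f p * Y l + pd j f p * Y k -
        (∑ l, g p j l * Y l) * grad g f k p := by
  unfold conformalShift
  simp only [add_mul, sub_mul, Finset.sum_add_distrib, Finset.sum_sub_distrib, ite_mul, one_mul,
    zero_mul, Finset.sum_ite_eq, Finset.mem_univ, if_true, Finset.mul_sum, Finset.sum_mul]
  congr 1
  exact Finset.sum_congr rfl fun _ _ => by ring

theorem IsMetricOn.sum_conformalShift (hg : IsMetricOn g s) (hp : p ∈ s) (l : ι) :
    ∑ k, conformalShift f g k k l p = Fintype.card ι * pd l f p := by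
  have h := hg.sum_mul_grad (f := f) hp l
  have h' : ∑ k, g p k l * grad g f k p = pd l f p := by
    rw [← h]; exact Finset.sum_congr rfl fun _ _ => by rw [hg.apply_comm hp]
  unfold conformalShift
  simp [Finset.sum_add_distrib, h', mul_comm]

/-- For fixed k the sum over l is done first. The contraction of the shift with the gradient reduces
to a Kronecker delta times |∇f|², as its other two terms cancel by `g (grad f) = df`. -/
theorem IsMetricOn.sum_sum_conformalShift_mul_conformalShift (hg : IsMetricOn g s) (hp : p ∈ s)
    (i j : ι) :
    ∑ k, ∑ l, conformalShift f g k j l p * conformalShift f g l i k p =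
      ((Fintype.card ι : ℝ) + 2) * (pd i f p * pd j f p) - 2 * (g p i j * gradSq g f p) := by
  have h1 : ∀ k, ∑ l, conformalShift f g k j l p * conformalShift f g l i k p =
      conformalShift f g k j i p * pd k f p + conformalShift f g k k j p * pd i f p -
        g p i k * ((if k = j then 1 else 0) * gradSq g f p) := by
    intro k
    have h2 : ∑ l, grad g f l p * conformalShift f g k j l p =
        (if k = j then 1 else 0) * gradSq g f p := by
      have := sum_mul_conformalShift f g k j p fun l => grad g f l p
      rw [hg.sum_mul_grad hp j] at this
      rw [← add_sub_cancel_right ((if k = j then 1 else 0) * gradSq g f p)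
        (pd j f p * grad g f k p), gradSq]
      simp only [mul_comm (grad g f _ p)]
      exact this
    have h3 : conformalShift f g k j k p = conformalShift f g k k j p := by
      unfold conformalShift; rw [hg.apply_comm hp k j]; ring
    have := sum_conformalShift_mul f g i k p fun l => conformalShift f g k j l p
    rw [h2, h3] at this
    rw [← this]
    exact Finset.sum_congr rfl fun _ _ => mul_comm _ _
  simp only [h1, Finset.sum_add_distrib, Finset.sum_sub_distrib, ← Finset.sum_mul,
    sum_conformalShift_mul, hg.sum_conformalShift hp]
  simp only [ite_mul, one_mul, zero_mul, mul_ite, mul_zero, Finset.sum_ite_eq', Finset.mem_univ,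
    if_true]
  unfold gradSq
  rw [hg.apply_comm hp j i]
  ring

/-- The Ricci tensor of `e^{2f} g`. -/
theorem IsMetricOn.ricci_conformal (hs : IsOpen s) (hg : IsMetricOn g s)
    (hf : ContDiffOn ℝ ∞ f s) (hp : p ∈ s) (i j : ι) :
    ricci (EinsteinScalar.conformal f g) p i j = ricci g p i j -
      ((Fintype.card ι : ℝ) - 2) * (hessian g f p i j - pd i f p * pd j f p) -
      (box g f p + ((Fintype.card ι : ℝ) - 2) * gradSq g f p) * g p i j := by
  have hΓ := fun a b c => differentiableAt_of_contDiffOn hs (hg.contDiffOn_christoffel hs a b c) hp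
  have hC := fun a b c =>
    differentiableAt_of_contDiffOn hs (hg.contDiffOn_conformalShift hs hf a b c) hp
  have hpd : ∀ l a b c, pd l (christoffel (EinsteinScalar.conformal f g) a b c) p =
      pd l (christoffel g a b c) p + pd l (conformalShift f g a b c) p := fun l a b c => by
    rw [← pd_add (hΓ a b c) (hC a b c)]
    exact pd_congr_on hs hp fun q hq => hg.christoffel_conformal hs hf hq a b c
  have hD1 : ∑ k, pd k (conformalShift f g k i j) p = pd i (pd j f) p + pd j (pd i f) p -
      ∑ k, pd k (fun q => g q i j) p * grad g f k p - g p i j *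
        (box g f p - ∑ k, ∑ l, christoffel g k k l p * grad g f l p) := by
    rw [← hg.divergence_grad hs hf hp, Finset.mul_sum]
    simp only [hg.pd_conformalShift hs hf hp, Finset.sum_sub_distrib, Finset.sum_add_distrib,
      ite_mul, one_mul, zero_mul, Finset.sum_ite_eq', Finset.mem_univ, if_true]
    ring
  have hD2 : ∑ k, pd j (conformalShift f g k i k) p =
      (Fintype.card ι : ℝ) * pd j (pd i f) p := by
    simp only [hg.pd_conformalShift hs hf hp]
    rw [Finset.sum_sub_distrib, hg.sum_pd_mul_grad hs hf hp, Finset.sum_add_distrib]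
    simp
  -- With Γ + C in place of Γ, each quadratic Ricci term splits into ΓΓ, ΓC, CΓ and CC. `hQ1` to
  -- `hQ3` are the new pieces of Γᵏₖₗ Γˡᵢⱼ, and `hQ4` to `hQ6` those of Γᵏⱼₗ Γˡᵢₖ.
  have hQ1 : ∑ k, ∑ l, conformalShift f g k k l p * christoffel g l i j p =
      (Fintype.card ι : ℝ) * ∑ l, christoffel g l i j p * pd l f p := by
    rw [Finset.sum_comm]
    simp only [← Finset.sum_mul, hg.sum_conformalShift hp, Finset.mul_sum]
    exact Finset.sum_congr rfl fun _ _ => by ring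
  have hQ2 : ∑ k, ∑ l, christoffel g k k l p * conformalShift f g l i j p =
      (∑ k, christoffel g k k i p) * pd j f p + (∑ k, christoffel g k k j p) * pd i f p -
        g p i j * ∑ k, ∑ l, christoffel g k k l p * grad g f l p := by
    have h1 : ∀ k, ∑ l, christoffel g k k l p * conformalShift f g l i j p =
        christoffel g k k i p * pd j f p + christoffel g k k j p * pd i f p -
          g p i j * ∑ l, christoffel g k k l p * grad g f l p := by
      intro k
      have := sum_conformalShift_mul f g i j p fun l => christoffel g k k l p
      simpa only [mul_comm] using this
    simp only [h1, Finset.sum_add_distrib, Finset.sum_sub_distrib, ← Finset.sum_mul,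
      ← Finset.mul_sum]
  have hQ3 : ∑ k, ∑ l, conformalShift f g k k l p * conformalShift f g l i j p =
      (Fintype.card ι : ℝ) * (2 * (pd i f p * pd j f p) - g p i j * gradSq g f p) := by
    rw [Finset.sum_comm]
    simp only [← Finset.sum_mul, hg.sum_conformalShift hp]
    have := sum_conformalShift_mul f g i j p fun l => pd l f p
    have e : 2 * (pd i f p * pd j f p) - g p i j * gradSq g f p =
      pd i f p * pd j f p + pd j f p * pd i f p - g p i j * ∑ l, grad g f l p * pd l f p := by
      unfold gradSq; ring
    rw [e, ← this, Finset.mul_sum]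
    exact Finset.sum_congr rfl fun _ _ => by ring
  have hQ4 : ∑ k, ∑ l, christoffel g k j l p * conformalShift f g l i k p =
      ∑ k, christoffel g k i j p * pd k f p + (∑ k, christoffel g k k j p) * pd i f p -
        ∑ k, (∑ l, g p i l * christoffel g l k j p) * grad g f k p := by
    have h1 : ∀ k, ∑ l, christoffel g k j l p * conformalShift f g l i k p =
        christoffel g k i j p * pd k f p + christoffel g k k j p * pd i f p -
          ∑ l, g p i k * christoffel g k l j p * grad g f l p := by
      intro k
      have := sum_conformalShift_mul f g i k p fun l => christoffel g k j l p
      rw [Finset.mul_sum] at this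
      rw [hg.christoffel_comm hs hp k i j, hg.christoffel_comm hs hp k k j]
      simp only [hg.christoffel_comm hs hp k _ j]
      rw [← Finset.sum_congr rfl fun l _ => mul_comm _ _, this]
      congr 1
      exact Finset.sum_congr rfl fun _ _ => by ring
    simp only [h1, Finset.sum_add_distrib, Finset.sum_sub_distrib, ← Finset.sum_mul]
    rw [Finset.sum_comm]
    simp only [Finset.sum_mul]
  have hQ5 : ∑ k, ∑ l, conformalShift f g k j l p * christoffel g l i k p =
      ∑ k, christoffel g k i j p * pd k f p + (∑ k, christoffel g k k i p) * pd j f p -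
        ∑ k, (∑ l, g p j l * christoffel g l k i p) * grad g f k p := by
    have h1 : ∀ l, ∑ k, conformalShift f g k j l p * christoffel g l i k p =
        christoffel g l i j p * pd l f p + christoffel g l l i p * pd j f p -
          ∑ k, g p j l * christoffel g l k i p * grad g f k p := by
      intro l
      have := sum_conformalShift_mul f g j l p fun k => christoffel g l i k p
      rw [Finset.mul_sum] at this
      rw [hg.christoffel_comm hs hp l l i]
      simp only [hg.christoffel_comm hs hp l _ i]
      rw [this]
      congr 1
      exact Finset.sum_congr rfl fun _ _ => by ring
    rw [Finset.sum_comm]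
    simp only [h1, Finset.sum_add_distrib, Finset.sum_sub_distrib, ← Finset.sum_mul]
    rw [Finset.sum_comm]
    simp only [Finset.sum_mul]
  have hQ6 := hg.sum_sum_conformalShift_mul_conformalShift (f := f) hp i j
  -- The derivative of g from `hD1` cancels exactly the lowered Christoffel sums left by `hQ4` and
  -- `hQ5`.
  have hM : ∑ k, pd k (fun q => g q i j) p * grad g f k p =
      ∑ k, (∑ l, g p j l * christoffel g l k i p) * grad g f k p +
      ∑ k, (∑ l, g p i l * christoffel g l k j p) * grad g f k p := by
    rw [← Finset.sum_add_distrib]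
    exact Finset.sum_congr rfl fun k _ => by rw [hg.pd_metric hs hp]; ring
  have hsym := pd_comm hs hf hp i j
  unfold ricci
  simp only [hpd, hg.christoffel_conformal hs hf hp, add_mul, mul_add, Finset.sum_add_distrib,
    Finset.sum_sub_distrib, hQ1, hQ2, hQ3, hQ4, hQ5, hQ6, hD1, hD2]
  unfold hessian
  rw [hM, hsym]
  ring

end Conformal

/-! ### Derivatives of functions of y and of x on a slab. -/

section Slab

variable {N : ℕ} {p : Idx N → ℝ} {F : ℝ → ℝ} {F' : ℝ} {H : (Fin (N - 1) → ℝ) → ℝ}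

theorem hasFDerivAt_yc : HasFDerivAt (yc (N := N))
    (ContinuousLinearMap.proj (Sum.inl ()) : (Idx N → ℝ) →L[ℝ] ℝ) p :=
  (ContinuousLinearMap.proj (Sum.inl ()) : (Idx N → ℝ) →L[ℝ] ℝ).hasFDerivAt

/-- The projection to the hypersurface coordinates as a continuous linear map. -/
noncomputable def xcL (N : ℕ) : (Idx N → ℝ) →L[ℝ] (Fin (N - 1) → ℝ) :=
  ContinuousLinearMap.pi fun i => ContinuousLinearMap.proj (Sum.inr i)

theorem hasFDerivAt_xc : HasFDerivAt (xc (N := N)) (xcL N) p :=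
  (xcL N).hasFDerivAt

theorem contDiff_yc : ContDiff ℝ ∞ (yc (N := N)) :=
  (ContinuousLinearMap.proj (Sum.inl ()) : (Idx N → ℝ) →L[ℝ] ℝ).contDiff

theorem contDiff_xc : ContDiff ℝ ∞ (xc (N := N)) :=
  (xcL N).contDiff

theorem isOpen_slab {I : Set ℝ} {U : Set (Fin (N - 1) → ℝ)} (hI : IsOpen I) (hU : IsOpen U) :
    IsOpen (slab (N := N) I U) :=
  (hI.preimage contDiff_yc.continuous).inter (hU.preimage contDiff_xc.continuous)

theorem contDiffOn_comp_yc {I : Set ℝ} {U : Set (Fin (N - 1) → ℝ)} (hF : ContDiffOn ℝ ∞ F I) :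
    ContDiffOn ℝ ∞ (fun p : Idx N → ℝ => F (yc p)) (slab I U) :=
  hF.comp contDiff_yc.contDiffOn fun _ hp => hp.1

theorem contDiffOn_comp_xc {I : Set ℝ} {U : Set (Fin (N - 1) → ℝ)} (hH : ContDiffOn ℝ ∞ H U) :
    ContDiffOn ℝ ∞ (fun p : Idx N → ℝ => H (xc p)) (slab I U) :=
  hH.comp contDiff_xc.contDiffOn fun _ hp => hp.2

theorem hasFDerivAt_mul_yc_xc (hF : HasDerivAt F F' (yc p))
    (hH : DifferentiableAt ℝ H (xc p)) :
    HasFDerivAt (fun q : Idx N → ℝ => F (yc q) * H (xc q))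
      (F (yc p) • (fderiv ℝ H (xc p)).comp (xcL N) +
        H (xc p) • F' • (ContinuousLinearMap.proj (Sum.inl ()) : (Idx N → ℝ) →L[ℝ] ℝ)) p := by
  have h1 : HasFDerivAt (fun q : Idx N → ℝ => F (yc q)) _ p :=
    hF.comp_hasFDerivAt p hasFDerivAt_yc
  have h2 : HasFDerivAt (fun q : Idx N → ℝ => H (xc q)) _ p :=
    hH.hasFDerivAt.comp p hasFDerivAt_xc
  exact h1.mul h2

theorem pd_inl_mul (u : Unit) (hF : HasDerivAt F F' (yc p)) (hH : DifferentiableAt ℝ H (xc p)) :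
    pd (Sum.inl u) (fun q : Idx N → ℝ => F (yc q) * H (xc q)) p = F' * H (xc p) := by
  have h0 : xcL N (Pi.single (Sum.inl u) 1) = 0 := by ext i; simp [xcL]
  unfold pd
  rw [(hasFDerivAt_mul_yc_xc hF hH).fderiv]
  simp [h0, mul_comm]

theorem pd_inr_mul (i : Fin (N - 1)) (hF : HasDerivAt F F' (yc p))
    (hH : DifferentiableAt ℝ H (xc p)) :
    pd (Sum.inr i) (fun q : Idx N → ℝ => F (yc q) * H (xc q)) p =
      F (yc p) * pd i H (xc p) := by
  have h0 : xcL N (Pi.single (Sum.inr i) 1) = Pi.single i 1 := by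
    ext j; simp [xcL, Pi.single_apply]
  unfold pd
  rw [(hasFDerivAt_mul_yc_xc hF hH).fderiv]
  simp [h0]

theorem pd_inl_yc (u : Unit) (hF : HasDerivAt F F' (yc p)) :
    pd (Sum.inl u) (fun q : Idx N → ℝ => F (yc q)) p = F' := by
  simpa using pd_inl_mul (H := fun _ => (1 : ℝ)) u hF (differentiableAt_const _)

theorem pd_inr_xc (i : Fin (N - 1)) (hH : DifferentiableAt ℝ H (xc p)) :
    pd (Sum.inr i) (fun q : Idx N → ℝ => H (xc q)) p = pd i H (xc p) := by
  simpa using pd_inr_mul (F := fun _ => (1 : ℝ)) i (hasDerivAt_const _ _) hH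

theorem pd_inl_xc (u : Unit) (hH : DifferentiableAt ℝ H (xc p)) :
    pd (Sum.inl u) (fun q : Idx N → ℝ => H (xc q)) p = 0 := by
  simpa using pd_inl_mul (F := fun _ => (1 : ℝ)) u (hasDerivAt_const _ _) hH

theorem pd_inr_yc (i : Fin (N - 1)) (hF : DifferentiableAt ℝ F (yc p)) :
    pd (Sum.inr i) (fun q : Idx N → ℝ => F (yc q)) p = 0 := by
  simpa [pd_const] using
    pd_inr_mul (H := fun _ => (1 : ℝ)) i hF.hasDerivAt (differentiableAt_const _)

end Slab

/-! ### Christoffel symbols of warped metrics. -/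

section Warped

variable {N : ℕ} {ε : ℝ} {D : Set ℝ} {P Q m q q' : ℝ → ℝ} {U : Set (Fin (N - 1) → ℝ)}
  {L : (Fin (N - 1) → ℝ) → ℝ} {k : (Fin (N - 1) → ℝ) → Matrix (Fin (N - 1)) (Fin (N - 1)) ℝ}
  {p : Idx N → ℝ}

/-- The metric `ε P(y) L(x)² dy² + Q(y) kᵢⱼ(x) dxⁱ dxʲ`. -/
noncomputable def warped (ε : ℝ) (P Q : ℝ → ℝ) (L : (Fin (N - 1) → ℝ) → ℝ)
    (k : (Fin (N - 1) → ℝ) → Matrix (Fin (N - 1)) (Fin (N - 1)) ℝ) :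
    (Idx N → ℝ) → Matrix (Idx N) (Idx N) ℝ :=
  splitMetric (fun p => ε * (P (yc p) * L (xc p) ^ 2)) (fun p => Q (yc p) • k (xc p))

/-- Smooth nowhere vanishing functions `P`, `Q` with logarithmic derivatives `2m`, `2q`, and the
derivative `q'` of `q`. -/
structure IsWarp (D : Set ℝ) (P Q m q q' : ℝ → ℝ) : Prop where
  isOpen : IsOpen D
  smooth_left : ContDiffOn ℝ ∞ P D
  smooth_right : ContDiffOn ℝ ∞ Q D
  left_ne_zero : ∀ y ∈ D, P y ≠ 0
  right_ne_zero : ∀ y ∈ D, Q y ≠ 0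
  hasDerivAt_left : ∀ y ∈ D, HasDerivAt P (2 * m y * P y) y
  hasDerivAt_right : ∀ y ∈ D, HasDerivAt Q (2 * q y * Q y) y
  differentiableAt_left : ∀ y ∈ D, DifferentiableAt ℝ m y
  hasDerivAt_log : ∀ y ∈ D, HasDerivAt q (q' y) y

/-- A nowhere vanishing lapse function `L` and a metric `k` on `U`. -/
structure IsSpatial (U : Set (Fin (N - 1) → ℝ)) (L : (Fin (N - 1) → ℝ) → ℝ)
    (k : (Fin (N - 1) → ℝ) → Matrix (Fin (N - 1)) (Fin (N - 1)) ℝ) : Prop where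
  isOpen : IsOpen U
  smooth : ContDiffOn ℝ ∞ L U
  ne_zero : ∀ x ∈ U, L x ≠ 0
  metric : IsMetricOn k U

theorem isMetricOn_warped (hε : ε * ε = 1) (hw : IsWarp D P Q m q q') (hk : IsSpatial U L k) :
    IsMetricOn (warped ε P Q L k) (slab (N := N) D U) where
  smooth i j := by
    rcases i with i | i <;> rcases j with j | j
    · exact contDiffOn_const.mul ((contDiffOn_comp_yc hw.smooth_left).mul
        ((contDiffOn_comp_xc hk.smooth).pow 2))
    · exact contDiffOn_const
    · exact contDiffOn_const
    · exact (contDiffOn_comp_yc hw.smooth_right).mul (contDiffOn_comp_xc (hk.metric.smooth i j))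
  symm p hp := by
    unfold warped splitMetric
    rw [Matrix.isSymm_fromBlocks_iff]
    refine ⟨by ext; rfl, by simp, by simp, ?_⟩
    unfold Matrix.IsSymm
    rw [Matrix.transpose_smul, hk.metric.symm _ hp.2]
  nondegenerate p hp := by
    unfold warped splitMetric
    rw [Matrix.det_fromBlocks_zero₂₁, Matrix.det_smul, Matrix.det_unique]
    refine mul_ne_zero (mul_ne_zero ?_ (mul_ne_zero (hw.left_ne_zero _ hp.1)
      (pow_ne_zero _ (hk.ne_zero _ hp.2)))) (mul_ne_zero (pow_ne_zero _ (hw.right_ne_zero _ hp.1))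
      (hk.metric.nondegenerate _ hp.2))
    rintro rfl; simp at hε

/-- The inverse is taken block by block; ε is its own inverse because ε² = 1. -/
theorem warped_inv (hε : ε * ε = 1) (hw : IsWarp D P Q m q q') (hk : IsSpatial U L k)
    (hp : p ∈ slab D U) : (warped ε P Q L k p)⁻¹ =
      Matrix.fromBlocks (Matrix.of fun _ _ => ε * ((P (yc p))⁻¹ * ((L (xc p)) ^ 2)⁻¹)) 0 0
        ((Q (yc p))⁻¹ • (k (xc p))⁻¹) := by
  have h1 := hw.left_ne_zero _ hp.1
  have h2 := hk.ne_zero _ hp.2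
  have h3 := hw.right_ne_zero _ hp.1
  refine Matrix.inv_eq_right_inv ?_
  unfold warped splitMetric
  rw [Matrix.fromBlocks_multiply]
  simp only [Matrix.zero_mul, Matrix.mul_zero, add_zero, zero_add, Matrix.smul_mul,
    Matrix.mul_smul, smul_smul, Matrix.mul_nonsing_inv _ (hk.metric.isUnit_det hp.2), smul_zero,
    inv_mul_cancel₀ h3, one_smul]
  rw [← Matrix.fromBlocks_one]
  congr 1
  ext i j
  simp only [Matrix.mul_apply, Matrix.of_apply, Finset.univ_unique, Finset.sum_singleton]
  rw [Matrix.one_apply, if_pos (Subsingleton.elim _ _)]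
  field_simp
  linear_combination hε


theorem pd_inl_warped_inl (hw : IsWarp D P Q m q q') (hk : IsSpatial U L k) (hp : p ∈ slab D U)
    (u v w : Unit) :
    pd (Sum.inl u) (fun x => warped ε P Q L k x (Sum.inl v) (Sum.inl w)) p =
      ε * (2 * m (yc p) * P (yc p) * L (xc p) ^ 2) := by
  have hL := differentiableAt_of_contDiffOn hk.isOpen hk.smooth hp.2
  have h := pd_inl_mul (H := fun x => L x ^ 2) u
    ((hw.hasDerivAt_left _ hp.1).const_mul ε) (hL.pow 2)
  have e : (fun x => warped ε P Q L k x (Sum.inl v) (Sum.inl w)) =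
      fun x : Idx N → ℝ => ε * P (yc x) * L (xc x) ^ 2 := by
    ext x; simp [warped, splitMetric, mul_assoc]
  rw [e, h]; ring

theorem pd_inr_warped_inl (hw : IsWarp D P Q m q q') (hk : IsSpatial U L k) (hp : p ∈ slab D U)
    (i : Fin (N - 1)) (v w : Unit) :
    pd (Sum.inr i) (fun x => warped ε P Q L k x (Sum.inl v) (Sum.inl w)) p =
      ε * P (yc p) * (2 * L (xc p) * pd i L (xc p)) := by
  have hL := differentiableAt_of_contDiffOn hk.isOpen hk.smooth hp.2
  have h := pd_inr_mul (H := fun x => L x ^ 2) i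
    ((hw.hasDerivAt_left _ hp.1).const_mul ε) (hL.pow 2)
  have e : (fun x => warped ε P Q L k x (Sum.inl v) (Sum.inl w)) =
      fun x : Idx N → ℝ => ε * P (yc x) * L (xc x) ^ 2 := by
    ext x; simp [warped, splitMetric, mul_assoc]
  rw [e, h, pd_comp (F := fun t => t ^ 2) (hasDerivAt_pow 2 _) hL]; simp

theorem pd_inl_warped_inr (hw : IsWarp D P Q m q q') (hk : IsSpatial U L k) (hp : p ∈ slab D U)
    (u : Unit) (i j : Fin (N - 1)) :
    pd (Sum.inl u) (fun x => warped ε P Q L k x (Sum.inr i) (Sum.inr j)) p =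
      2 * q (yc p) * Q (yc p) * k (xc p) i j :=
  pd_inl_mul (H := fun x => k x i j) u (hw.hasDerivAt_right _ hp.1)
    (differentiableAt_of_contDiffOn hk.isOpen (hk.metric.smooth i j) hp.2)

theorem pd_inr_warped_inr (hw : IsWarp D P Q m q q') (hk : IsSpatial U L k) (hp : p ∈ slab D U)
    (l i j : Fin (N - 1)) :
    pd (Sum.inr l) (fun x => warped ε P Q L k x (Sum.inr i) (Sum.inr j)) p =
      Q (yc p) * pd l (fun x => k x i j) (xc p) :=
  pd_inr_mul (H := fun x => k x i j) l (hw.hasDerivAt_right _ hp.1)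
    (differentiableAt_of_contDiffOn hk.isOpen (hk.metric.smooth i j) hp.2)

theorem pd_warped_inl_inr (a : Idx N) (u : Unit) (i : Fin (N - 1)) :
    pd a (fun x => warped ε P Q L k x (Sum.inl u) (Sum.inr i)) p = 0 :=
  pd_const 0

theorem pd_warped_inr_inl (a : Idx N) (u : Unit) (i : Fin (N - 1)) :
    pd a (fun x => warped ε P Q L k x (Sum.inr i) (Sum.inl u)) p = 0 :=
  pd_const 0

/-- The inverse metric is block diagonal, so only its yy entry survives in the sum. -/
theorem christoffel_warped_inl (hε : ε * ε = 1) (hw : IsWarp D P Q m q q') (hk : IsSpatial U L k)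
    (hp : p ∈ slab D U)
    (u : Unit) (a b : Idx N) :
    christoffel (warped ε P Q L k) (Sum.inl u) a b p =
      1 / 2 * (ε * ((P (yc p))⁻¹ * ((L (xc p)) ^ 2)⁻¹) *
        (pd a (fun x => warped ε P Q L k x b (Sum.inl u)) p +
          pd b (fun x => warped ε P Q L k x a (Sum.inl u)) p -
          pd (Sum.inl u) (fun x => warped ε P Q L k x a b) p)) := by
  unfold christoffel
  rw [warped_inv hε hw hk hp, Fintype.sum_sum_type, Fintype.sum_unique]
  simp only [Matrix.fromBlocks_apply₁₁, Matrix.fromBlocks_apply₁₂, Matrix.of_apply,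
    Matrix.zero_apply, zero_mul, Finset.sum_const_zero, add_zero]

theorem christoffel_warped_inr (hε : ε * ε = 1) (hw : IsWarp D P Q m q q') (hk : IsSpatial U L k)
    (hp : p ∈ slab D U)
    (l : Fin (N - 1)) (a b : Idx N) :
    christoffel (warped ε P Q L k) (Sum.inr l) a b p =
      1 / 2 * ∑ j, (Q (yc p))⁻¹ * (k (xc p))⁻¹ l j *
        (pd a (fun x => warped ε P Q L k x b (Sum.inr j)) p +
          pd b (fun x => warped ε P Q L k x a (Sum.inr j)) p -
          pd (Sum.inr j) (fun x => warped ε P Q L k x a b) p) := by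
  unfold christoffel
  rw [warped_inv hε hw hk hp, Fintype.sum_sum_type, Fintype.sum_unique]
  simp only [Matrix.fromBlocks_apply₂₁, Matrix.fromBlocks_apply₂₂, Matrix.smul_apply, smul_eq_mul,
    Matrix.zero_apply, zero_mul, zero_add]

theorem christoffel_warped_inl_inl_inl (hε : ε * ε = 1) (hw : IsWarp D P Q m q q') (hk : IsSpatial U L k)
    (hp : p ∈ slab D U)
    (u v w : Unit) :
    christoffel (warped ε P Q L k) (Sum.inl u) (Sum.inl v) (Sum.inl w) p =
      m (yc p) := by
  have h1 := hw.left_ne_zero _ hp.1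
  have h2 := hk.ne_zero _ hp.2
  have h3 := hw.right_ne_zero _ hp.1
  simp only [christoffel_warped_inl hε hw hk hp,
    pd_inl_warped_inl hw hk hp, pd_inr_warped_inl hw hk hp, pd_inl_warped_inr hw hk hp,
    pd_inr_warped_inr hw hk hp, pd_warped_inl_inr, pd_warped_inr_inl, add_zero, zero_add,
    sub_zero, zero_sub, sub_self]
  field_simp
  linear_combination m (yc p) * hε

theorem christoffel_warped_inl_inl_inr (hε : ε * ε = 1) (hw : IsWarp D P Q m q q') (hk : IsSpatial U L k)
    (hp : p ∈ slab D U)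
    (u v : Unit) (i : Fin (N - 1)) :
    christoffel (warped ε P Q L k) (Sum.inl u) (Sum.inl v) (Sum.inr i) p =
      pd i L (xc p) / L (xc p) := by
  have h1 := hw.left_ne_zero _ hp.1
  have h2 := hk.ne_zero _ hp.2
  have h3 := hw.right_ne_zero _ hp.1
  simp only [christoffel_warped_inl hε hw hk hp,
    pd_inl_warped_inl hw hk hp, pd_inr_warped_inl hw hk hp, pd_inl_warped_inr hw hk hp,
    pd_inr_warped_inr hw hk hp, pd_warped_inl_inr, pd_warped_inr_inl, add_zero, zero_add,
    sub_zero, zero_sub, sub_self]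
  field_simp
  linear_combination pd i L (xc p) * hε

theorem christoffel_warped_inl_inr_inl (hε : ε * ε = 1) (hw : IsWarp D P Q m q q') (hk : IsSpatial U L k)
    (hp : p ∈ slab D U)
    (u v : Unit) (i : Fin (N - 1)) :
    christoffel (warped ε P Q L k) (Sum.inl u) (Sum.inr i) (Sum.inl v) p =
      pd i L (xc p) / L (xc p) := by
  have h1 := hw.left_ne_zero _ hp.1
  have h2 := hk.ne_zero _ hp.2
  have h3 := hw.right_ne_zero _ hp.1
  simp only [christoffel_warped_inl hε hw hk hp,
    pd_inl_warped_inl hw hk hp, pd_inr_warped_inl hw hk hp, pd_inl_warped_inr hw hk hp,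
    pd_inr_warped_inr hw hk hp, pd_warped_inl_inr, pd_warped_inr_inl, add_zero, zero_add,
    sub_zero, zero_sub, sub_self]
  field_simp
  linear_combination pd i L (xc p) * hε

theorem christoffel_warped_inl_inr_inr (hε : ε * ε = 1) (hw : IsWarp D P Q m q q') (hk : IsSpatial U L k)
    (hp : p ∈ slab D U)
    (u : Unit) (i j : Fin (N - 1)) :
    christoffel (warped ε P Q L k) (Sum.inl u) (Sum.inr i) (Sum.inr j) p =
      -ε * (Q (yc p) * q (yc p) / P (yc p)) * (k (xc p) i j / L (xc p) ^ 2) := by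
  have h1 := hw.left_ne_zero _ hp.1
  have h2 := hk.ne_zero _ hp.2
  have h3 := hw.right_ne_zero _ hp.1
  simp only [christoffel_warped_inl hε hw hk hp,
    pd_inl_warped_inl hw hk hp, pd_inr_warped_inl hw hk hp, pd_inl_warped_inr hw hk hp,
    pd_inr_warped_inr hw hk hp, pd_warped_inl_inr, pd_warped_inr_inl, add_zero, zero_add,
    sub_zero, zero_sub, sub_self]
  field_simp

theorem christoffel_warped_inr_inl_inl (hε : ε * ε = 1) (hw : IsWarp D P Q m q q') (hk : IsSpatial U L k)
    (hp : p ∈ slab D U)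
    (l : Fin (N - 1)) (v w : Unit) :
    christoffel (warped ε P Q L k) (Sum.inr l) (Sum.inl v) (Sum.inl w) p =
      -ε * (P (yc p) / Q (yc p)) * (L (xc p) * grad k L l (xc p)) := by
  have h1 := hw.left_ne_zero _ hp.1
  have h2 := hk.ne_zero _ hp.2
  have h3 := hw.right_ne_zero _ hp.1
  simp only [christoffel_warped_inr hε hw hk hp,
    pd_inl_warped_inl hw hk hp, pd_inr_warped_inl hw hk hp, pd_inl_warped_inr hw hk hp,
    pd_inr_warped_inr hw hk hp, pd_warped_inl_inr, pd_warped_inr_inl, add_zero, zero_add,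
    sub_zero, zero_sub, sub_self]
  simp only [grad, Finset.mul_sum]
  refine Finset.sum_congr rfl fun a _ => ?_
  field_simp

theorem christoffel_warped_inr_inl_inr (hε : ε * ε = 1) (hw : IsWarp D P Q m q q') (hk : IsSpatial U L k)
    (hp : p ∈ slab D U)
    (l : Fin (N - 1)) (v : Unit) (j : Fin (N - 1)) :
    christoffel (warped ε P Q L k) (Sum.inr l) (Sum.inl v) (Sum.inr j) p =
      q (yc p) * if l = j then 1 else 0 := by
  have h1 := hw.left_ne_zero _ hp.1
  have h2 := hk.ne_zero _ hp.2
  have h3 := hw.right_ne_zero _ hp.1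
  simp only [christoffel_warped_inr hε hw hk hp,
    pd_inl_warped_inl hw hk hp, pd_inr_warped_inl hw hk hp, pd_inl_warped_inr hw hk hp,
    pd_inr_warped_inr hw hk hp, pd_warped_inl_inr, pd_warped_inr_inl, add_zero, zero_add,
    sub_zero, zero_sub, sub_self]
  have h4 : ∀ i j, ∑ x, (Q (yc p))⁻¹ * (k (xc p))⁻¹ i x *
      (2 * q (yc p) * Q (yc p) * k (xc p) j x) = 2 * q (yc p) * if i = j then 1 else 0 := by
    intro i j
    rw [← hk.metric.sum_inv_mul hp.2, Finset.mul_sum]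
    refine Finset.sum_congr rfl fun a _ => ?_
    rw [hk.metric.apply_comm hp.2 j a]
    field_simp
  rw [h4]; ring

theorem christoffel_warped_inr_inr_inl (hε : ε * ε = 1) (hw : IsWarp D P Q m q q') (hk : IsSpatial U L k)
    (hp : p ∈ slab D U)
    (l j : Fin (N - 1)) (v : Unit) :
    christoffel (warped ε P Q L k) (Sum.inr l) (Sum.inr j) (Sum.inl v) p =
      q (yc p) * if l = j then 1 else 0 := by
  have h1 := hw.left_ne_zero _ hp.1
  have h2 := hk.ne_zero _ hp.2
  have h3 := hw.right_ne_zero _ hp.1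
  simp only [christoffel_warped_inr hε hw hk hp,
    pd_inl_warped_inl hw hk hp, pd_inr_warped_inl hw hk hp, pd_inl_warped_inr hw hk hp,
    pd_inr_warped_inr hw hk hp, pd_warped_inl_inr, pd_warped_inr_inl, add_zero, zero_add,
    sub_zero, zero_sub, sub_self]
  have h4 : ∀ i j, ∑ x, (Q (yc p))⁻¹ * (k (xc p))⁻¹ i x *
      (2 * q (yc p) * Q (yc p) * k (xc p) j x) = 2 * q (yc p) * if i = j then 1 else 0 := by
    intro i j
    rw [← hk.metric.sum_inv_mul hp.2, Finset.mul_sum]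
    refine Finset.sum_congr rfl fun a _ => ?_
    rw [hk.metric.apply_comm hp.2 j a]
    field_simp
  rw [h4]; ring

theorem christoffel_warped_inr_inr_inr (hε : ε * ε = 1) (hw : IsWarp D P Q m q q') (hk : IsSpatial U L k)
    (hp : p ∈ slab D U)
    (l i j : Fin (N - 1)) :
    christoffel (warped ε P Q L k) (Sum.inr l) (Sum.inr i) (Sum.inr j) p =
      christoffel k l i j (xc p) := by
  have h1 := hw.left_ne_zero _ hp.1
  have h2 := hk.ne_zero _ hp.2
  have h3 := hw.right_ne_zero _ hp.1
  simp only [christoffel_warped_inr hε hw hk hp,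
    pd_inl_warped_inl hw hk hp, pd_inr_warped_inl hw hk hp, pd_inl_warped_inr hw hk hp,
    pd_inr_warped_inr hw hk hp, pd_warped_inl_inr, pd_warped_inr_inl, add_zero, zero_add,
    sub_zero, zero_sub, sub_self]
  simp only [christoffel, Finset.mul_sum]
  refine Finset.sum_congr rfl fun a _ => ?_
  field_simp

end Warped

/-! ### Ricci tensor and Laplacian of warped metrics. -/

section WarpedRicci

variable {N : ℕ} {ε : ℝ} {D : Set ℝ} {P Q m q q' : ℝ → ℝ} {U : Set (Fin (N - 1) → ℝ)}
  {L : (Fin (N - 1) → ℝ) → ℝ} {k : (Fin (N - 1) → ℝ) → Matrix (Fin (N - 1)) (Fin (N - 1)) ℝ}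
  {p : Idx N → ℝ}

/-- The N-1 spatial directions contribute equally to the y-part. In the x-part the |∇L|² terms
cancel between the divergence and the quadratic terms, so that only L □L is left. -/
theorem ricci_warped_inl_inl (hε : ε * ε = 1) (hw : IsWarp D P Q m q q') (hk : IsSpatial U L k)
    (hp : p ∈ slab D U) (u v : Unit) :
    ricci (warped ε P Q L k) p (Sum.inl u) (Sum.inl v) =
      -((N - 1 : ℕ) : ℝ) * (q' (yc p) + q (yc p) ^ 2 - m (yc p) * q (yc p)) -
        ε * (P (yc p) / Q (yc p)) * (L (xc p) * box k L (xc p)) := by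
  obtain rfl : u = v := rfl
  have hs := isOpen_slab hw.isOpen hk.isOpen
  have hL := differentiableAt_of_contDiffOn hk.isOpen hk.smooth hp.2
  have h2 := hk.ne_zero _ hp.2
  have hX := fun l => differentiableAt_of_contDiffOn hk.isOpen
    (hk.metric.contDiffOn_grad hk.isOpen hk.smooth l) hp.2
  have hPQ : HasDerivAt (fun y => -ε * (P y / Q y)) _ (yc p) :=
    (((hw.hasDerivAt_left _ hp.1).div (hw.hasDerivAt_right _ hp.1)
      (hw.right_ne_zero _ hp.1)).const_mul (-ε))
  have hd1 : ∀ l, pd (Sum.inr l)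
      (christoffel (warped ε P Q L k) (Sum.inr l) (Sum.inl u) (Sum.inl u)) p =
      -ε * (P (yc p) / Q (yc p)) * (pd l L (xc p) * grad k L l (xc p) +
        L (xc p) * pd l (grad k L l) (xc p)) := fun l => by
    rw [pd_congr_on hs hp fun x hx => christoffel_warped_inr_inl_inl hε hw hk hx l u u,
      ← pd_mul hL (hX l)]
    exact pd_inr_mul (H := fun x => L x * grad k L l x) l hPQ (hL.mul (hX l))
  have hd2 : ∀ l, pd (Sum.inl u)
      (christoffel (warped ε P Q L k) (Sum.inr l) (Sum.inl u) (Sum.inr l)) p = q' (yc p) :=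
    fun l => by
    rw [pd_congr_on (g := fun x => q (yc x)) hs hp fun x hx => by
      rw [christoffel_warped_inr_inl_inr hε hw hk hx]; simp]
    exact pd_inl_yc u (hw.hasDerivAt_log _ hp.1)
  have hdiv := hk.metric.divergence_grad hk.isOpen hk.smooth hp.2
  have e1 : ∀ c : ℝ, ∑ l, c * (pd l L (xc p) * grad k L l (xc p) +
      L (xc p) * pd l (grad k L l) (xc p)) =
      c * (gradSq k L (xc p) + L (xc p) * ∑ l, pd l (grad k L l) (xc p)) := fun c => by
    simp only [gradSq, Finset.mul_sum, ← Finset.sum_add_distrib]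
    exact Finset.sum_congr rfl fun l _ => by ring
  have e2 : ∀ c : ℝ, ∑ l, c * (L (xc p) * grad k L l (xc p)) * (pd l L (xc p) / L (xc p)) =
      c * gradSq k L (xc p) := fun c => by
    simp only [gradSq, Finset.mul_sum]
    exact Finset.sum_congr rfl fun l _ => by field_simp
  have e3 : ∀ c : ℝ, ∑ a, ∑ l, christoffel k a a l (xc p) * (c * (L (xc p) * grad k L l (xc p))) =
      c * (L (xc p) * ∑ a, ∑ l, christoffel k a a l (xc p) * grad k L l (xc p)) := fun c => by
    simp only [Finset.mul_sum]
    exact Finset.sum_congr rfl fun a _ => Finset.sum_congr rfl fun l _ => by ring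
  unfold ricci
  simp only [Fintype.sum_sum_type, Fintype.sum_unique, PUnit.default_eq_unit, hd1, hd2,
    christoffel_warped_inl_inl_inl hε hw hk hp,
    christoffel_warped_inl_inl_inr hε hw hk hp, christoffel_warped_inl_inr_inl hε hw hk hp,
    christoffel_warped_inl_inr_inr hε hw hk hp, christoffel_warped_inr_inl_inl hε hw hk hp,
    christoffel_warped_inr_inl_inr hε hw hk hp, christoffel_warped_inr_inr_inl hε hw hk hp,
    christoffel_warped_inr_inr_inr hε hw hk hp]
  simp only [mul_ite, ite_mul, mul_one, mul_zero, zero_mul, Finset.sum_add_distrib,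
    Finset.sum_sub_distrib, Finset.sum_ite_eq, Finset.sum_ite_eq', Finset.mem_univ, if_true,
    Finset.sum_const, Finset.card_univ, Fintype.card_fin, nsmul_eq_mul, sub_self, zero_add]
  rw [e1, e2, e3, hdiv]
  ring

theorem ricci_warped_inl_inr (hε : ε * ε = 1) (hw : IsWarp D P Q m q q') (hk : IsSpatial U L k)
    (hp : p ∈ slab D U) (u : Unit) (i : Fin (N - 1)) :
    ricci (warped ε P Q L k) p (Sum.inl u) (Sum.inr i) =
      (((N - 1 : ℕ) : ℝ) - 1) * (q (yc p) * (pd i L (xc p) / L (xc p))) := by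
  have hs := isOpen_slab hw.isOpen hk.isOpen
  have hL := differentiableAt_of_contDiffOn hk.isOpen hk.smooth hp.2
  have h2 := hk.ne_zero _ hp.2
  have hF := fun l => differentiableAt_of_contDiffOn hk.isOpen
    (contDiffOn_pd hk.isOpen hk.smooth l) hp.2
  have hd1 : pd (Sum.inl u)
      (christoffel (warped ε P Q L k) (Sum.inl u) (Sum.inl u) (Sum.inr i)) p = 0 := by
    rw [pd_congr_on (g := fun x => pd i L (xc x) / L (xc x)) hs hp fun x hx => by
      rw [christoffel_warped_inl_inl_inr hε hw hk hx]]
    exact pd_inl_xc (H := fun x => pd i L x / L x) u (by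
      simpa only [div_eq_mul_inv] using (hF i).fun_mul (hL.fun_inv h2))
  have hd2 : pd (Sum.inr i)
      (christoffel (warped ε P Q L k) (Sum.inl u) (Sum.inl u) (Sum.inl u)) p = 0 := by
    rw [pd_congr_on (g := fun x => m (yc x)) hs hp fun x hx => by
      rw [christoffel_warped_inl_inl_inl hε hw hk hx]]
    exact pd_inr_yc i (hw.differentiableAt_left _ hp.1)
  have hd3 : ∀ a l j : Fin (N - 1), pd (Sum.inr a)
      (christoffel (warped ε P Q L k) (Sum.inr l) (Sum.inl u) (Sum.inr j)) p = 0 := by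
    intro a l j
    rw [pd_congr_on (g := fun x => (fun y => q y * if l = j then 1 else 0) (yc x)) hs hp
      fun x hx => by rw [christoffel_warped_inr_inl_inr hε hw hk hx]]
    exact pd_inr_yc (F := fun y => q y * if l = j then 1 else 0) a
      ((hw.hasDerivAt_log _ hp.1).differentiableAt.mul_const _)
  have h3 := hw.right_ne_zero _ hp.1
  have h1 := hw.left_ne_zero _ hp.1
  have e1 : ∑ l, (-ε * (Q (yc p) * q (yc p) / P (yc p)) * (k (xc p) i l / L (xc p) ^ 2)) *
      (-ε * (P (yc p) / Q (yc p)) * (L (xc p) * grad k L l (xc p))) =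
      q (yc p) * (pd i L (xc p) / L (xc p)) := by
    rw [← hk.metric.sum_mul_grad hp.2, Finset.sum_div, Finset.mul_sum]
    refine Finset.sum_congr rfl fun l _ => ?_
    field_simp
    linear_combination q (yc p) * k (xc p) i l * grad k L l (xc p) * hε
  have hc : ∑ x, christoffel k x i x (xc p) = ∑ x, christoffel k x x i (xc p) :=
    Finset.sum_congr rfl fun x _ => hk.metric.christoffel_comm hk.isOpen hp.2 x i x
  unfold ricci
  simp only [Fintype.sum_sum_type, Fintype.sum_unique, PUnit.default_eq_unit, hd1, hd2, hd3,
    christoffel_warped_inl_inl_inl hε hw hk hp,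
    christoffel_warped_inl_inl_inr hε hw hk hp, christoffel_warped_inl_inr_inl hε hw hk hp,
    christoffel_warped_inl_inr_inr hε hw hk hp, christoffel_warped_inr_inl_inl hε hw hk hp,
    christoffel_warped_inr_inl_inr hε hw hk hp, christoffel_warped_inr_inr_inl hε hw hk hp,
    christoffel_warped_inr_inr_inr hε hw hk hp]
  simp only [mul_ite, ite_mul, mul_one, mul_zero, zero_mul, Finset.sum_add_distrib,
    Finset.sum_sub_distrib, Finset.sum_ite_eq, Finset.sum_ite_eq', Finset.mem_univ, if_true,
    Finset.sum_const, Finset.card_univ, Fintype.card_fin, nsmul_eq_mul, sub_self, zero_add]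
  rw [e1]
  simp only [← Finset.sum_mul, ← Finset.mul_sum, hc]
  ring

/-- The defining expression of `ricci` is not visibly symmetric, so the transposed component has its
own computation. -/
theorem ricci_warped_inr_inl (hε : ε * ε = 1) (hw : IsWarp D P Q m q q') (hk : IsSpatial U L k)
    (hp : p ∈ slab D U) (u : Unit) (i : Fin (N - 1)) :
    ricci (warped ε P Q L k) p (Sum.inr i) (Sum.inl u) =
      (((N - 1 : ℕ) : ℝ) - 1) * (q (yc p) * (pd i L (xc p) / L (xc p))) := by
  have hs := isOpen_slab hw.isOpen hk.isOpen
  have h2 := hk.ne_zero _ hp.2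
  have hΓ := fun a b c => differentiableAt_of_contDiffOn hk.isOpen
    (hk.metric.contDiffOn_christoffel hk.isOpen a b c) hp.2
  have hd3 : ∀ a l j : Fin (N - 1), pd (Sum.inr a)
      (christoffel (warped ε P Q L k) (Sum.inr l) (Sum.inr j) (Sum.inl u)) p = 0 := by
    intro a l j
    rw [pd_congr_on (g := fun x => (fun y => q y * if l = j then 1 else 0) (yc x)) hs hp
      fun x hx => by rw [christoffel_warped_inr_inr_inl hε hw hk hx]]
    exact pd_inr_yc (F := fun y => q y * if l = j then 1 else 0) a
      ((hw.hasDerivAt_log _ hp.1).differentiableAt.mul_const _)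
  have hd4 : ∀ l, pd (Sum.inl u)
      (christoffel (warped ε P Q L k) (Sum.inr l) (Sum.inr i) (Sum.inr l)) p = 0 := by
    intro l
    rw [pd_congr_on (g := fun x => christoffel k l i l (xc x)) hs hp fun x hx => by
      rw [christoffel_warped_inr_inr_inr hε hw hk hx]]
    exact pd_inl_xc u (hΓ l i l)
  have h3 := hw.right_ne_zero _ hp.1
  have h1 := hw.left_ne_zero _ hp.1
  have e1 : ∑ l, (-ε * (P (yc p) / Q (yc p)) * (L (xc p) * grad k L l (xc p))) *
      (-ε * (Q (yc p) * q (yc p) / P (yc p)) * (k (xc p) i l / L (xc p) ^ 2)) =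
      q (yc p) * (pd i L (xc p) / L (xc p)) := by
    rw [← hk.metric.sum_mul_grad hp.2, Finset.sum_div, Finset.mul_sum]
    refine Finset.sum_congr rfl fun l _ => ?_
    field_simp
    linear_combination q (yc p) * k (xc p) i l * grad k L l (xc p) * hε
  have hc : ∑ x, christoffel k x i x (xc p) = ∑ x, christoffel k x x i (xc p) :=
    Finset.sum_congr rfl fun x _ => hk.metric.christoffel_comm hk.isOpen hp.2 x i x
  unfold ricci
  simp only [Fintype.sum_sum_type, Fintype.sum_unique, PUnit.default_eq_unit, hd3, hd4,
    christoffel_warped_inl_inl_inl hε hw hk hp,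
    christoffel_warped_inl_inl_inr hε hw hk hp, christoffel_warped_inl_inr_inl hε hw hk hp,
    christoffel_warped_inl_inr_inr hε hw hk hp, christoffel_warped_inr_inl_inl hε hw hk hp,
    christoffel_warped_inr_inl_inr hε hw hk hp, christoffel_warped_inr_inr_inl hε hw hk hp,
    christoffel_warped_inr_inr_inr hε hw hk hp]
  simp only [mul_ite, ite_mul, mul_one, mul_zero, zero_mul, Finset.sum_add_distrib,
    Finset.sum_sub_distrib, Finset.sum_ite_eq, Finset.sum_ite_eq', Finset.mem_univ, if_true,
    Finset.sum_const, Finset.card_univ, Fintype.card_fin, nsmul_eq_mul, sub_self, zero_add]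
  rw [e1]
  simp only [← Finset.sum_mul, ← Finset.mul_sum, hc]
  ring

/-- The y-derivative of Γʸᵢⱼ gives the warp term. The x-derivative of ∂L/L gives the Hessian of L,
and its ∂L∂L/L² part is cancelled by a quadratic term. -/
theorem ricci_warped_inr_inr (hε : ε * ε = 1) (hw : IsWarp D P Q m q q') (hk : IsSpatial U L k)
    (hp : p ∈ slab D U) (i j : Fin (N - 1)) :
    ricci (warped ε P Q L k) p (Sum.inr i) (Sum.inr j) =
      ricci k (xc p) i j - hessian k L (xc p) i j / L (xc p) -
        ε * (Q (yc p) / P (yc p)) * (k (xc p) i j / L (xc p) ^ 2) *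
          (q' (yc p) + ((N - 1 : ℕ) : ℝ) * q (yc p) ^ 2 - m (yc p) * q (yc p)) := by
  have hs := isOpen_slab hw.isOpen hk.isOpen
  have hL := differentiableAt_of_contDiffOn hk.isOpen hk.smooth hp.2
  have h2 := hk.ne_zero _ hp.2
  have hF := fun l => differentiableAt_of_contDiffOn hk.isOpen
    (contDiffOn_pd hk.isOpen hk.smooth l) hp.2
  have h3 := hw.right_ne_zero _ hp.1
  have h1 := hw.left_ne_zero _ hp.1
  have hΓ := fun a b c => differentiableAt_of_contDiffOn hk.isOpen
    (hk.metric.contDiffOn_christoffel hk.isOpen a b c) hp.2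
  have hk2 : DifferentiableAt ℝ (fun x => k x i j / L x ^ 2) (xc p) := by
    simpa only [div_eq_mul_inv] using
      (differentiableAt_of_contDiffOn hk.isOpen (hk.metric.smooth i j) hp.2).fun_mul
        ((hL.fun_pow 2).fun_inv (pow_ne_zero 2 h2))
  have hQP : HasDerivAt (fun y => -ε * (Q y * q y / P y)) _ (yc p) :=
    ((((hw.hasDerivAt_right _ hp.1).mul (hw.hasDerivAt_log _ hp.1)).div
      (hw.hasDerivAt_left _ hp.1) (hw.left_ne_zero _ hp.1)).const_mul (-ε))
  have hd1 : pd (Sum.inl ())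
      (christoffel (warped ε P Q L k) (Sum.inl ()) (Sum.inr i) (Sum.inr j)) p =
      -ε * (Q (yc p) / P (yc p)) * (k (xc p) i j / L (xc p) ^ 2) *
        (2 * q (yc p) ^ 2 + q' (yc p) - 2 * m (yc p) * q (yc p)) := by
    rw [pd_congr_on (g := fun x => -ε * (Q (yc x) * q (yc x) / P (yc x)) *
      (k (xc x) i j / L (xc x) ^ 2)) hs hp fun x hx => by
        rw [christoffel_warped_inl_inr_inr hε hw hk hx]]
    refine (pd_inl_mul (H := fun x => k x i j / L x ^ 2) () hQP hk2).trans ?_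
    simp only [Pi.mul_apply]
    field_simp
  have hd2 : pd (Sum.inr j)
      (christoffel (warped ε P Q L k) (Sum.inl ()) (Sum.inr i) (Sum.inl ())) p =
      pd i (pd j L) (xc p) / L (xc p) - pd i L (xc p) * pd j L (xc p) / L (xc p) ^ 2 := by
    rw [pd_congr_on (g := fun x => pd i L (xc x) * (L (xc x))⁻¹) hs hp fun x hx => by
      rw [christoffel_warped_inl_inr_inl hε hw hk hx, div_eq_mul_inv]]
    refine (pd_inr_xc (H := fun x => pd i L x * (L x)⁻¹) j ((hF i).mul (hL.inv h2))).trans ?_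
    rw [pd_mul (hF i) (hL.fun_inv h2), pd_comp (F := fun t => t⁻¹) (hasDerivAt_inv h2) hL,
      pd_comm hk.isOpen hk.smooth hp.2 j i]
    field_simp
    ring
  have hd3 : ∀ a b c d, pd (Sum.inr a)
      (christoffel (warped ε P Q L k) (Sum.inr b) (Sum.inr c) (Sum.inr d)) p =
      pd a (christoffel k b c d) (xc p) := by
    intro a b c d
    rw [pd_congr_on (g := fun x => christoffel k b c d (xc x)) hs hp fun x hx => by
      rw [christoffel_warped_inr_inr_inr hε hw hk hx]]
    exact pd_inr_xc a (hΓ b c d)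
  have e1 : ∑ l, pd l L (xc p) / L (xc p) * christoffel k l i j (xc p) =
      (∑ l, christoffel k l i j (xc p) * pd l L (xc p)) / L (xc p) := by
    rw [Finset.sum_div]
    exact Finset.sum_congr rfl fun l _ => by ring
  unfold ricci
  simp only [Fintype.sum_sum_type, Fintype.sum_unique, PUnit.default_eq_unit, hd1, hd2, hd3,
    christoffel_warped_inl_inl_inl hε hw hk hp,
    christoffel_warped_inl_inl_inr hε hw hk hp, christoffel_warped_inl_inr_inl hε hw hk hp,
    christoffel_warped_inl_inr_inr hε hw hk hp, christoffel_warped_inr_inl_inl hε hw hk hp,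
    christoffel_warped_inr_inl_inr hε hw hk hp, christoffel_warped_inr_inr_inl hε hw hk hp,
    christoffel_warped_inr_inr_inr hε hw hk hp]
  simp only [mul_ite, ite_mul, mul_one, mul_zero, zero_mul, Finset.sum_add_distrib,
    Finset.sum_sub_distrib, Finset.sum_ite_eq, Finset.sum_ite_eq', Finset.mem_univ, if_true,
    Finset.sum_const, Finset.card_univ, Fintype.card_fin, nsmul_eq_mul, sub_self, zero_add]
  rw [e1, hk.metric.apply_comm hp.2 j i]
  unfold hessian
  ring

/-- The Laplace operator of a warped metric on a sum of functions of `x` and of `y`. -/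
theorem box_warped (hε : ε * ε = 1) (hw : IsWarp D P Q m q q') (hk : IsSpatial U L k)
    (hp : p ∈ slab D U) {H : (Fin (N - 1) → ℝ) → ℝ} (hH : ContDiffOn ℝ ∞ H U)
    {f f' : ℝ → ℝ} {f'' : ℝ} (hf : ∀ y ∈ D, HasDerivAt f (f' y) y)
    (hf' : HasDerivAt f' f'' (yc p)) :
    box (warped ε P Q L k) (fun x => H (xc x) + f (yc x)) p =
      ε / (P (yc p) * L (xc p) ^ 2) *
        (f'' + (((N - 1 : ℕ) : ℝ) * q (yc p) - m (yc p)) * f' (yc p)) +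
      1 / Q (yc p) * (box k H (xc p) + (∑ l, grad k L l (xc p) * pd l H (xc p)) / L (xc p)) := by
  have hs := isOpen_slab hw.isOpen hk.isOpen
  have h1 := hw.left_ne_zero _ hp.1
  have h2 := hk.ne_zero _ hp.2
  have h3 := hw.right_ne_zero _ hp.1
  have hHd := fun x hx => differentiableAt_of_contDiffOn (p := x) hk.isOpen hH hx
  have hH2 := fun i => differentiableAt_of_contDiffOn hk.isOpen (contDiffOn_pd hk.isOpen hH i) hp.2
  have hHc : ∀ x ∈ slab (N := N) D U, DifferentiableAt ℝ (fun x : Idx N → ℝ => H (xc x)) x :=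
    fun x hx => (hHd _ hx.2).fun_comp' x hasFDerivAt_xc.differentiableAt
  have hfc : ∀ x ∈ slab (N := N) D U, DifferentiableAt ℝ (fun x : Idx N → ℝ => f (yc x)) x :=
    fun x hx => (hf _ hx.1).differentiableAt.fun_comp' x hasFDerivAt_yc.differentiableAt
  have p1 : ∀ x ∈ slab (N := N) D U,
      pd (Sum.inl ()) (fun x : Idx N → ℝ => H (xc x) + f (yc x)) x = f' (yc x) := fun x hx => by
    rw [pd_add (hHc x hx) (hfc x hx), pd_inl_xc _ (hHd _ hx.2), pd_inl_yc _ (hf _ hx.1), zero_add]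
  have p2 : ∀ i, ∀ x ∈ slab (N := N) D U,
      pd (Sum.inr i) (fun x : Idx N → ℝ => H (xc x) + f (yc x)) x = pd i H (xc x) :=
    fun i x hx => by
    rw [pd_add (hHc x hx) (hfc x hx), pd_inr_xc _ (hHd _ hx.2),
      pd_inr_yc _ (hf _ hx.1).differentiableAt, add_zero]
  have q1 : pd (Sum.inl ()) (pd (Sum.inl ()) (fun x : Idx N → ℝ => H (xc x) + f (yc x))) p =
      f'' := by
    rw [pd_congr_on hs hp p1, pd_inl_yc _ hf']
  have q2 : ∀ i j, pd (Sum.inr i) (pd (Sum.inr j) (fun x : Idx N → ℝ => H (xc x) + f (yc x))) p =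
      pd i (pd j H) (xc p) := fun i j => by
    rw [pd_congr_on hs hp (p2 j), pd_inr_xc _ (hH2 j)]
  have e0 : ∀ i j, (Q (yc p))⁻¹ * (k (xc p))⁻¹ i j * (pd i (pd j H) (xc p) -
      (-ε * (Q (yc p) * q (yc p) / P (yc p)) * (k (xc p) i j / L (xc p) ^ 2) * f' (yc p) +
      ∑ l, christoffel k l i j (xc p) * pd l H (xc p))) =
      1 / Q (yc p) * ((k (xc p))⁻¹ i j * hessian k H (xc p) i j) +
      ε / (P (yc p) * L (xc p) ^ 2) * (q (yc p) * f' (yc p)) *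
        ((k (xc p))⁻¹ i j * k (xc p) i j) := fun i j => by
    unfold hessian
    field_simp
    ring
  have e1 : ∀ c : ℝ, ∑ l, c * (L (xc p) * grad k L l (xc p)) * pd l H (xc p) =
      c * L (xc p) * ∑ l, grad k L l (xc p) * pd l H (xc p) := fun c => by
    rw [Finset.mul_sum]
    exact Finset.sum_congr rfl fun l _ => by ring
  have hc := hk.metric.sum_inv_mul_self hp.2
  rw [Fintype.card_fin] at hc
  unfold box
  rw [warped_inv hε hw hk hp]
  simp only [Fintype.sum_sum_type, Fintype.sum_unique, PUnit.default_eq_unit,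
    Matrix.fromBlocks_apply₁₁, Matrix.fromBlocks_apply₁₂, Matrix.fromBlocks_apply₂₁,
    Matrix.fromBlocks_apply₂₂, Matrix.of_apply, Matrix.zero_apply, zero_mul,
    Finset.sum_const_zero, add_zero, zero_add, Matrix.smul_apply, smul_eq_mul]
  unfold hessian
  simp only [Fintype.sum_sum_type, Fintype.sum_unique, PUnit.default_eq_unit, q1, q2, p1 p hp,
    p2 _ p hp, christoffel_warped_inl_inl_inl hε hw hk hp,
    christoffel_warped_inl_inr_inr hε hw hk hp, christoffel_warped_inr_inl_inl hε hw hk hp,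
    christoffel_warped_inr_inr_inr hε hw hk hp]
  simp only [e0, e1, Finset.sum_add_distrib, ← Finset.mul_sum, hc]
  have e2 : ∀ S : ℝ, ε * ((P (yc p))⁻¹ * (L (xc p) ^ 2)⁻¹) *
      (ε * (P (yc p) / Q (yc p)) * L (xc p) * S) = 1 / Q (yc p) * (S / L (xc p)) := fun S => by
    field_simp
    linear_combination S * hε
  simp only [hessian]
  generalize ∑ l, grad k L l (xc p) * pd l H (xc p) = S
  rw [mul_add (1 / Q (yc p)), ← e2 S]
  simp only [div_eq_mul_inv, mul_inv]
  ring

end WarpedRicci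

/-! ### Lapse e^{aV} and conformal factor e^{2βV}. -/

section Exponential

variable {ι : Type} [Fintype ι] [DecidableEq ι] {g : (ι → ℝ) → Matrix ι ι ℝ}
  {V H : (ι → ℝ) → ℝ} {x : ι → ℝ} {U : Set (ι → ℝ)}

theorem pd_exp_mul (hV : DifferentiableAt ℝ V x) (a : ℝ) (i : ι) :
    pd i (fun x => Real.exp (a * V x)) x = a * pd i V x * Real.exp (a * V x) := by
  rw [pd_comp (F := Real.exp) (Real.hasDerivAt_exp _) (hV.const_mul a), pd_const_mul _ hV]
  ring

theorem hessian_exp_mul (hU : IsOpen U) (hV : ContDiffOn ℝ ∞ V U) (hx : x ∈ U) (a : ℝ) (i j : ι) :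
    hessian g (fun x => Real.exp (a * V x)) x i j =
      Real.exp (a * V x) * (a * hessian g V x i j + a ^ 2 * (pd i V x * pd j V x)) := by
  have hd := fun y hy => differentiableAt_of_contDiffOn (p := y) hU hV hy
  have hd2 := differentiableAt_of_contDiffOn hU (contDiffOn_pd hU hV j) hx
  have h1 : pd i (pd j (fun x => Real.exp (a * V x))) x =
      a * pd i (pd j V) x * Real.exp (a * V x) +
        a * pd j V x * (a * pd i V x * Real.exp (a * V x)) := by
    rw [pd_congr_on hU hx fun y hy => pd_exp_mul (hd y hy) a j,
      pd_mul (hd2.const_mul a) ((hd x hx).const_mul a).exp, pd_const_mul _ hd2,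
      pd_exp_mul (hd x hx)]
  unfold hessian
  simp only [h1, pd_exp_mul (hd x hx), mul_sub, mul_add, Finset.mul_sum]
  have : ∑ k, christoffel g k i j x * (a * pd k V x * Real.exp (a * V x)) =
      ∑ k, Real.exp (a * V x) * (a * (christoffel g k i j x * pd k V x)) :=
    Finset.sum_congr rfl fun _ _ => by ring
  rw [this]; ring

theorem hessian_const_mul (hU : IsOpen U) (hV : ContDiffOn ℝ ∞ V U) (hx : x ∈ U) (a : ℝ)
    (i j : ι) : hessian g (fun x => a * V x) x i j = a * hessian g V x i j := by
  have hd := fun y hy => differentiableAt_of_contDiffOn (p := y) hU hV hy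
  have hd2 := differentiableAt_of_contDiffOn hU (contDiffOn_pd hU hV j) hx
  unfold hessian
  rw [pd_congr_on hU hx fun y hy => pd_const_mul a (hd y hy), pd_const_mul _ hd2, mul_sub,
    Finset.mul_sum]
  congr 1
  exact Finset.sum_congr rfl fun _ _ => by rw [pd_const_mul _ (hd x hx)]; ring

theorem box_const_mul (hU : IsOpen U) (hV : ContDiffOn ℝ ∞ V U) (hx : x ∈ U) (a : ℝ) :
    box g (fun x => a * V x) x = a * box g V x := by
  unfold box
  simp only [hessian_const_mul hU hV hx, Finset.mul_sum]
  exact Finset.sum_congr rfl fun _ _ => Finset.sum_congr rfl fun _ _ => by ring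

theorem grad_const_mul (hV : DifferentiableAt ℝ V x) (a : ℝ) (l : ι) :
    grad g (fun x => a * V x) l x = a * grad g V l x := by
  unfold grad
  simp only [pd_const_mul _ hV, Finset.mul_sum]
  exact Finset.sum_congr rfl fun _ _ => by ring

theorem gradSq_const_mul (hV : DifferentiableAt ℝ V x) (a : ℝ) :
    gradSq g (fun x => a * V x) x = a ^ 2 * gradSq g V x := by
  unfold gradSq
  simp only [grad_const_mul hV, pd_const_mul _ hV, Finset.mul_sum]
  exact Finset.sum_congr rfl fun _ _ => by ring

theorem box_exp_mul (hU : IsOpen U) (hV : ContDiffOn ℝ ∞ V U) (hx : x ∈ U) (a : ℝ) :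
    box g (fun x => Real.exp (a * V x)) x =
      Real.exp (a * V x) * (a * box g V x + a ^ 2 * gradSq g V x) := by
  rw [gradSq_eq]
  unfold box
  simp only [hessian_exp_mul hU hV hx, Finset.mul_sum, ← Finset.sum_add_distrib]
  exact Finset.sum_congr rfl fun _ _ => Finset.sum_congr rfl fun _ _ => by ring

theorem IsMetricOn.ricci_conformal_mul (hg : IsMetricOn g U) (hU : IsOpen U)
    (hV : ContDiffOn ℝ ∞ V U) (hx : x ∈ U) (β : ℝ) (i j : ι) :
    ricci (EinsteinScalar.conformal (fun x => β * V x) g) x i j = ricci g x i j -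
      ((Fintype.card ι : ℝ) - 2) * (β * hessian g V x i j - β ^ 2 * (pd i V x * pd j V x)) -
      β * (box g V x + ((Fintype.card ι : ℝ) - 2) * β * gradSq g V x) * g x i j := by
  have hd := differentiableAt_of_contDiffOn hU hV hx
  rw [hg.ricci_conformal hU (contDiffOn_const.mul hV) hx, hessian_const_mul hU hV hx,
    box_const_mul hU hV hx, gradSq_const_mul hd, pd_const_mul _ hd, pd_const_mul _ hd]
  ring

theorem IsMetricOn.hessian_conformal_exp (hg : IsMetricOn g U) (hU : IsOpen U)
    (hV : ContDiffOn ℝ ∞ V U) (hx : x ∈ U) (a β : ℝ) (i j : ι) :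
    hessian (EinsteinScalar.conformal (fun x => β * V x) g) (fun x => Real.exp (a * V x)) x i j =
      Real.exp (a * V x) * (a * hessian g V x i j +
        (a ^ 2 - 2 * a * β) * (pd i V x * pd j V x) + a * β * gradSq g V x * g x i j) := by
  have hd := differentiableAt_of_contDiffOn hU hV hx
  rw [hg.hessian_conformal hU (contDiffOn_const.mul hV) hx, hessian_exp_mul hU hV hx]
  have : ∑ k, grad g (fun x => β * V x) k x * pd k (fun x => Real.exp (a * V x)) x =
      a * β * Real.exp (a * V x) * gradSq g V x := by
    unfold gradSq
    rw [Finset.mul_sum]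
    exact Finset.sum_congr rfl fun _ _ => by
      rw [grad_const_mul hd, pd_exp_mul hd]; ring
  rw [this, pd_const_mul _ hd, pd_const_mul _ hd, pd_exp_mul hd, pd_exp_mul hd]
  ring

theorem IsMetricOn.box_conformal_exp (hg : IsMetricOn g U) (hU : IsOpen U)
    (hV : ContDiffOn ℝ ∞ V U) (hx : x ∈ U) (a β : ℝ) :
    box (EinsteinScalar.conformal (fun x => β * V x) g) (fun x => Real.exp (a * V x)) x =
      Real.exp (-2 * (β * V x)) * Real.exp (a * V x) * (a * (box g V x +
        (a + ((Fintype.card ι : ℝ) - 2) * β) * gradSq g V x)) := by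
  have hd := differentiableAt_of_contDiffOn hU hV hx
  rw [hg.box_conformal hU (contDiffOn_const.mul hV) hx, box_exp_mul hU hV hx]
  have : ∑ k, grad g (fun x => β * V x) k x * pd k (fun x => Real.exp (a * V x)) x =
      a * β * Real.exp (a * V x) * gradSq g V x := by
    unfold gradSq
    rw [Finset.mul_sum]
    exact Finset.sum_congr rfl fun _ _ => by
      rw [grad_const_mul hd, pd_exp_mul hd]; ring
  rw [this]
  ring

theorem IsMetricOn.box_conformal_mul (hg : IsMetricOn g U) (hU : IsOpen U)
    (hV : ContDiffOn ℝ ∞ V U) (hx : x ∈ U) (σ β : ℝ) :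
    box (EinsteinScalar.conformal (fun x => β * V x) g) (fun x => σ * V x) x =
      Real.exp (-2 * (β * V x)) * (σ * (box g V x +
        ((Fintype.card ι : ℝ) - 2) * β * gradSq g V x)) := by
  have hd := differentiableAt_of_contDiffOn hU hV hx
  rw [hg.box_conformal hU (contDiffOn_const.mul hV) hx, box_const_mul hU hV hx]
  have : ∑ k, grad g (fun x => β * V x) k x * pd k (fun x => σ * V x) x =
      σ * β * gradSq g V x := by
    unfold gradSq
    rw [Finset.mul_sum]
    exact Finset.sum_congr rfl fun _ _ => by
      rw [grad_const_mul hd, pd_const_mul _ hd]; ring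
  rw [this]
  ring

theorem IsMetricOn.sum_grad_conformal_exp (hg : IsMetricOn g U) (hU : IsOpen U)
    (hV : ContDiffOn ℝ ∞ V U) (hx : x ∈ U) (a β σ : ℝ) :
    ∑ l, grad (EinsteinScalar.conformal (fun x => β * V x) g) (fun x => Real.exp (a * V x)) l x *
        pd l (fun x => σ * V x) x =
      Real.exp (-2 * (β * V x)) * Real.exp (a * V x) * (a * σ * gradSq g V x) := by
  have hd := differentiableAt_of_contDiffOn hU hV hx
  simp only [gradSq, grad, hg.conformal_inv_apply hx, pd_const_mul _ hd, pd_exp_mul hd,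
    Finset.sum_mul, Finset.mul_sum]
  exact Finset.sum_congr rfl fun _ _ => Finset.sum_congr rfl fun _ _ => by ring

end Exponential

/-! ### Curvature of the exponential warped metrics. -/

section ExpWarped

variable {N : ℕ} {ε Λ a β σ : ℝ} {D : Set ℝ} {P Q m q q' : ℝ → ℝ} {U : Set (Fin (N - 1) → ℝ)}
  {V : (Fin (N - 1) → ℝ) → ℝ} {h : (Fin (N - 1) → ℝ) → Matrix (Fin (N - 1)) (Fin (N - 1)) ℝ}
  {p : Idx N → ℝ}

/-- The metric `ε P(y) e^{2aV} dy² + Q(y) e^{2βV} hᵢⱼ dxⁱ dxʲ`. -/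
noncomputable def expWarped (ε : ℝ) (P Q : ℝ → ℝ) (a β : ℝ) (V : (Fin (N - 1) → ℝ) → ℝ)
    (h : (Fin (N - 1) → ℝ) → Matrix (Fin (N - 1)) (Fin (N - 1)) ℝ) :
    (Idx N → ℝ) → Matrix (Idx N) (Idx N) ℝ :=
  warped ε P Q (fun x => Real.exp (a * V x)) (conformal (fun x => β * V x) h)

theorem isSpatial_exp (hU : IsOpen U) (hV : ContDiffOn ℝ ∞ V U) (hh : IsMetricOn h U) (a β : ℝ) :
    IsSpatial U (fun x => Real.exp (a * V x)) (conformal (fun x => β * V x) h) where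
  isOpen := hU
  smooth := (contDiffOn_const.mul hV).exp
  ne_zero _ _ := (Real.exp_pos _).ne'
  metric := hh.conformal (contDiffOn_const.mul hV)

/-- The lapse factors and the conformal weight e^{-2βV} of the Laplacian combine into the single
exponential e^{2(a-β)V}. -/
theorem ricci_expWarped_inl_inl (hε : ε * ε = 1) (hw : IsWarp D P Q m q q') (hU : IsOpen U)
    (hV : ContDiffOn ℝ ∞ V U) (hh : IsMetricOn h U) (hp : p ∈ slab D U) (u v : Unit) :
    ricci (expWarped ε P Q a β V h) p (Sum.inl u) (Sum.inl v) =
      -((N - 1 : ℕ) : ℝ) * (q' (yc p) + q (yc p) ^ 2 - m (yc p) * q (yc p)) -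
        ε * (P (yc p) / Q (yc p)) * Real.exp (2 * (a - β) * V (xc p)) * (a * (box h V (xc p) +
          (a + (((N - 1 : ℕ) : ℝ) - 2) * β) * gradSq h V (xc p))) := by
  rw [expWarped, ricci_warped_inl_inl hε hw (isSpatial_exp hU hV hh a β) hp,
    hh.box_conformal_exp hU hV hp.2, Fintype.card_fin]
  have : Real.exp (2 * (a - β) * V (xc p)) = Real.exp (a * V (xc p)) *
      (Real.exp (-2 * (β * V (xc p))) * Real.exp (a * V (xc p))) := by
    rw [← Real.exp_add, ← Real.exp_add]; ring_nf
  rw [this]; ring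

theorem ricci_expWarped_inl_inr (hε : ε * ε = 1) (hw : IsWarp D P Q m q q') (hU : IsOpen U)
    (hV : ContDiffOn ℝ ∞ V U) (hh : IsMetricOn h U) (hp : p ∈ slab D U) (u : Unit)
    (i : Fin (N - 1)) :
    ricci (expWarped ε P Q a β V h) p (Sum.inl u) (Sum.inr i) =
      (((N - 1 : ℕ) : ℝ) - 1) * (q (yc p) * (a * pd i V (xc p))) := by
  rw [expWarped, ricci_warped_inl_inr hε hw (isSpatial_exp hU hV hh a β) hp,
    pd_exp_mul (differentiableAt_of_contDiffOn hU hV hp.2),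
    mul_div_cancel_right₀ _ (Real.exp_pos _).ne']

theorem ricci_expWarped_inr_inl (hε : ε * ε = 1) (hw : IsWarp D P Q m q q') (hU : IsOpen U)
    (hV : ContDiffOn ℝ ∞ V U) (hh : IsMetricOn h U) (hp : p ∈ slab D U) (u : Unit)
    (i : Fin (N - 1)) :
    ricci (expWarped ε P Q a β V h) p (Sum.inr i) (Sum.inl u) =
      (((N - 1 : ℕ) : ℝ) - 1) * (q (yc p) * (a * pd i V (xc p))) := by
  rw [expWarped, ricci_warped_inr_inl hε hw (isSpatial_exp hU hV hh a β) hp,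
    pd_exp_mul (differentiableAt_of_contDiffOn hU hV hp.2),
    mul_div_cancel_right₀ _ (Real.exp_pos _).ne']

theorem ricci_expWarped_inr_inr (hε : ε * ε = 1) (hw : IsWarp D P Q m q q') (hU : IsOpen U)
    (hV : ContDiffOn ℝ ∞ V U) (hh : IsMetricOn h U) (hp : p ∈ slab D U) (i j : Fin (N - 1)) :
    ricci (expWarped ε P Q a β V h) p (Sum.inr i) (Sum.inr j) =
      ricci h (xc p) i j -
        ((((N - 1 : ℕ) : ℝ) - 2) * β + a) * hessian h V (xc p) i j +
        ((((N - 1 : ℕ) : ℝ) - 2) * β ^ 2 - a ^ 2 + 2 * a * β) *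
          (pd i V (xc p) * pd j V (xc p)) -
        (β * (box h V (xc p) + (a + (((N - 1 : ℕ) : ℝ) - 2) * β) * gradSq h V (xc p)) +
          ε * (Q (yc p) / P (yc p)) * Real.exp (2 * (β - a) * V (xc p)) *
            (q' (yc p) + ((N - 1 : ℕ) : ℝ) * q (yc p) ^ 2 - m (yc p) * q (yc p))) *
          h (xc p) i j := by
  have e : Real.exp (2 * (β - a) * V (xc p)) =
      Real.exp (2 * (β * V (xc p))) / Real.exp (a * V (xc p)) ^ 2 := by
    rw [← Real.exp_nat_mul, ← Real.exp_sub]; push_cast; ring_nf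
  have e' : conformal (fun x => β * V x) h (xc p) i j =
      Real.exp (2 * (β * V (xc p))) * h (xc p) i j := rfl
  rw [expWarped, ricci_warped_inr_inr hε hw (isSpatial_exp hU hV hh a β) hp,
    hh.ricci_conformal_mul hU hV hp.2, hh.hessian_conformal_exp hU hV hp.2,
    mul_div_cancel_left₀ _ (Real.exp_pos _).ne', Fintype.card_fin, e, e']
  ring

theorem box_expWarped (hε : ε * ε = 1) (hw : IsWarp D P Q m q q') (hU : IsOpen U)
    (hV : ContDiffOn ℝ ∞ V U) (hh : IsMetricOn h U) (hp : p ∈ slab D U)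
    {f f' : ℝ → ℝ} {f'' : ℝ} (hf : ∀ y ∈ D, HasDerivAt f (f' y) y)
    (hf' : HasDerivAt f' f'' (yc p)) :
    box (expWarped ε P Q a β V h) (fun x => σ * V (xc x) + f (yc x)) p =
      ε / P (yc p) * Real.exp (-2 * a * V (xc p)) *
        (f'' + (((N - 1 : ℕ) : ℝ) * q (yc p) - m (yc p)) * f' (yc p)) +
      1 / Q (yc p) * Real.exp (-2 * β * V (xc p)) * (σ * (box h V (xc p) +
        (a + (((N - 1 : ℕ) : ℝ) - 2) * β) * gradSq h V (xc p))) := by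
  have e : Real.exp (-2 * a * V (xc p)) = (Real.exp (a * V (xc p)) ^ 2)⁻¹ := by
    rw [← Real.exp_nat_mul, ← Real.exp_neg]; push_cast; ring_nf
  have e2 : Real.exp (-2 * β * V (xc p)) = Real.exp (-2 * (β * V (xc p))) := by ring_nf
  have := box_warped hε hw (isSpatial_exp hU hV hh a β) hp
    (contDiffOn_const.mul hV : ContDiffOn ℝ ∞ (fun x => σ * V x) U) hf hf'
  rw [expWarped, this, hh.box_conformal_mul hU hV hp.2, hh.sum_grad_conformal_exp hU hV hp.2,
    Fintype.card_fin, e, e2]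
  field_simp
  ring

end ExpWarped

/-! ### Consequences of the seed equations. -/

section Seed

variable {N : ℕ} {ε Λ a β σ : ℝ} {D : Set ℝ} {P Q m q q' : ℝ → ℝ} {U : Set (Fin (N - 1) → ℝ)}
  {V : (Fin (N - 1) → ℝ) → ℝ} {h : (Fin (N - 1) → ℝ) → Matrix (Fin (N - 1)) (Fin (N - 1)) ℝ}
  {p : Idx N → ℝ} {x : Fin (N - 1) → ℝ}

theorem expWarped_eq_splitMetric (ε : ℝ) (P Q : ℝ → ℝ) (a β : ℝ) (V : (Fin (N - 1) → ℝ) → ℝ)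
    (h : (Fin (N - 1) → ℝ) → Matrix (Fin (N - 1)) (Fin (N - 1)) ℝ) :
    expWarped ε P Q a β V h = splitMetric
      (fun p => ε * (P (yc p) * Real.exp (2 * a * V (xc p))))
      (fun p => (Q (yc p) * Real.exp (2 * β * V (xc p))) • h (xc p)) := by
  unfold expWarped warped conformal
  congr 1
  · funext p
    rw [← Real.exp_nat_mul]; push_cast; ring_nf
  · funext p
    rw [smul_smul]; ring_nf

/-- This puts the seed in the same class as the solutions, so that one set of curvature formulas
serves both the vacuum and the scalar field equations. -/
theorem orthMetric_eq_expWarped (ε : ℝ) (V : (Fin (N - 1) → ℝ) → ℝ)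
    (h : (Fin (N - 1) → ℝ) → Matrix (Fin (N - 1)) (Fin (N - 1)) ℝ) :
    orthMetric (N := N) ε V h = expWarped ε (fun _ => 1) (fun _ => 1) 1 (-1) V h := by
  rw [expWarped_eq_splitMetric]
  unfold orthMetric
  simp

theorem isWarp_one : IsWarp Set.univ (fun _ => 1) (fun _ => 1) (fun _ => 0) (fun _ => 0)
    (fun _ => 0) where
  isOpen := isOpen_univ
  smooth_left := contDiffOn_const
  smooth_right := contDiffOn_const
  left_ne_zero _ _ := one_ne_zero
  right_ne_zero _ _ := one_ne_zero
  hasDerivAt_left y _ := by simpa using hasDerivAt_const y (1 : ℝ)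
  hasDerivAt_right y _ := by simpa using hasDerivAt_const y (1 : ℝ)
  differentiableAt_left _ _ := differentiableAt_const _
  hasDerivAt_log y _ := hasDerivAt_const y (0 : ℝ)

theorem cast_pred (hN : 3 ≤ N) : ((N - 1 : ℕ) : ℝ) = (N : ℝ) - 1 := by
  rw [Nat.cast_sub (by omega)]; simp

/-- This is the yy vacuum equation: without warping its left side contains only □V and |∇V|². -/
theorem IsVacuumSeed.box_eq (hS : IsVacuumSeed N ε Λ U V h) (hN : 3 ≤ N) (hε : ε * ε = 1)
    (hx : x ∈ U) : box h V x = ((N : ℝ) - 4) * gradSq h V x -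
      2 * Λ / ((N : ℝ) - 2) * Real.exp (-2 * V x) := by
  -- The seed does not depend on y, so any value of y would do; 0 is chosen.
  have hp : (Sum.elim (fun _ => 0) x : Idx N → ℝ) ∈ slab (N := N) Set.univ U := ⟨trivial, hx⟩
  have h1 := hS.vacuum _ hp (Sum.inl ()) (Sum.inl ())
  rw [orthMetric_eq_expWarped, ricci_expWarped_inl_inl hε isWarp_one hS.isOpen hS.smooth hS.metric
    hp, cast_pred hN, expWarped_eq_splitMetric] at h1
  have hxc : xc (Sum.elim (fun _ => 0) x : Idx N → ℝ) = x := rfl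
  simp only [splitMetric, Matrix.fromBlocks_apply₁₁, Matrix.of_apply, hxc] at h1
  have e1 : Real.exp (2 * (1 - -1) * V x) = Real.exp (2 * V x) * Real.exp (2 * V x) := by
    rw [← Real.exp_add]; ring_nf
  have e2 : Real.exp (2 * 1 * V x) = Real.exp (2 * V x) := by ring_nf
  have e3 : Real.exp (2 * V x) * Real.exp (-2 * V x) = 1 := by rw [← Real.exp_add]; simp
  have hε0 : ε ≠ 0 := by rintro rfl; simp at hε
  rw [e1, e2] at h1
  have hN2 : (N : ℝ) - 2 ≠ 0 := by
    have : (3 : ℝ) ≤ N := by exact_mod_cast hN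
    linarith
  have hE := (Real.exp_pos (2 * V x)).ne'
  have h2 : Real.exp (2 * V x) * (box h V x - ((N : ℝ) - 4) * gradSq h V x) =
      -(2 / ((N : ℝ) - 2) * Λ) := by
    apply mul_left_cancel₀ (mul_ne_zero hε0 hE)
    linear_combination -h1
  have h3 : Real.exp (2 * V x) * (box h V x - (((N : ℝ) - 4) * gradSq h V x -
      2 * Λ / ((N : ℝ) - 2) * Real.exp (-2 * V x))) = 0 := by
    linear_combination h2 + (2 * Λ / ((N : ℝ) - 2)) * e3
  exact sub_eq_zero.1 ((mul_eq_zero.1 h3).resolve_left hE)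

/-- This is the spatial vacuum equation after eliminating □V by `box_eq`; the |∇V|² terms cancel. -/
theorem IsVacuumSeed.ricci_eq (hS : IsVacuumSeed N ε Λ U V h) (hN : 3 ≤ N) (hε : ε * ε = 1)
    (hx : x ∈ U) (i j : Fin (N - 1)) : ricci h x i j =
      -((N : ℝ) - 4) * hessian h V x i j - ((N : ℝ) - 6) * (pd i V x * pd j V x) +
        4 * Λ / ((N : ℝ) - 2) * Real.exp (-2 * V x) * h x i j := by
  have hp : (Sum.elim (fun _ => 0) x : Idx N → ℝ) ∈ slab (N := N) Set.univ U := ⟨trivial, hx⟩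
  have h1 := hS.vacuum _ hp (Sum.inr i) (Sum.inr j)
  rw [orthMetric_eq_expWarped, ricci_expWarped_inr_inr hε isWarp_one hS.isOpen hS.smooth hS.metric
    hp, cast_pred hN, expWarped_eq_splitMetric] at h1
  have hxc : xc (Sum.elim (fun _ => 0) x : Idx N → ℝ) = x := rfl
  simp only [splitMetric, Matrix.fromBlocks_apply₂₂, Matrix.smul_apply, smul_eq_mul, hxc,
    hS.box_eq hN hε hx] at h1
  have e2 : Real.exp (2 * -1 * V x) = Real.exp (-2 * V x) := by ring_nf
  rw [e2] at h1
  linear_combination h1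

theorem IsVacuumSeed.ricci_inl_inl (hS : IsVacuumSeed N ε Λ U V h) (hN : 3 ≤ N) (hε : ε * ε = 1)
    (hw : IsWarp D P Q m q q') (hp : p ∈ slab D U) (u v : Unit) :
    ricci (expWarped ε P Q a β V h) p (Sum.inl u) (Sum.inl v) =
      -((N : ℝ) - 1) * (q' (yc p) + q (yc p) ^ 2 - m (yc p) * q (yc p)) -
        ε * (P (yc p) / Q (yc p)) * Real.exp (2 * (a - β) * V (xc p)) *
          (a * (((N : ℝ) - 4 + a + ((N : ℝ) - 3) * β) * gradSq h V (xc p) -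
            2 * Λ / ((N : ℝ) - 2) * Real.exp (-2 * V (xc p)))) := by
  rw [ricci_expWarped_inl_inl hε hw hS.isOpen hS.smooth hS.metric hp, hS.box_eq hN hε hp.2,
    cast_pred hN]
  ring

/-- The number N-4 + a + (N-3)β multiplies the Hessian here, and |∇V|² here, in the yy component and
in the Laplacian. For a = α and β = -(α+δ) its vanishing is the condition (N-3)δ = (N-4)(1-α). -/
theorem IsVacuumSeed.ricci_inr_inr (hS : IsVacuumSeed N ε Λ U V h) (hN : 3 ≤ N) (hε : ε * ε = 1)
    (hw : IsWarp D P Q m q q') (hp : p ∈ slab D U) (i j : Fin (N - 1)) :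
    ricci (expWarped ε P Q a β V h) p (Sum.inr i) (Sum.inr j) =
      -((N : ℝ) - 4 + a + ((N : ℝ) - 3) * β) * hessian h V (xc p) i j +
        (((N : ℝ) - 3) * β ^ 2 - a ^ 2 + 2 * a * β - ((N : ℝ) - 6)) *
          (pd i V (xc p) * pd j V (xc p)) +
        (4 * Λ / ((N : ℝ) - 2) * Real.exp (-2 * V (xc p)) -
          β * (((N : ℝ) - 4 + a + ((N : ℝ) - 3) * β) * gradSq h V (xc p) -
            2 * Λ / ((N : ℝ) - 2) * Real.exp (-2 * V (xc p))) -
          ε * (Q (yc p) / P (yc p)) * Real.exp (2 * (β - a) * V (xc p)) *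
            (q' (yc p) + ((N : ℝ) - 1) * q (yc p) ^ 2 - m (yc p) * q (yc p))) *
          h (xc p) i j := by
  rw [ricci_expWarped_inr_inr hε hw hS.isOpen hS.smooth hS.metric hp, hS.box_eq hN hε hp.2,
    hS.ricci_eq hN hε hp.2, cast_pred hN]
  ring

theorem IsVacuumSeed.box_expWarped (hS : IsVacuumSeed N ε Λ U V h) (hN : 3 ≤ N) (hε : ε * ε = 1)
    (hw : IsWarp D P Q m q q') (hp : p ∈ slab D U)
    {f f' : ℝ → ℝ} {f'' : ℝ} (hf : ∀ y ∈ D, HasDerivAt f (f' y) y)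
    (hf' : HasDerivAt f' f'' (yc p)) :
    box (expWarped ε P Q a β V h) (fun x => σ * V (xc x) + f (yc x)) p =
      ε / P (yc p) * Real.exp (-2 * a * V (xc p)) *
        (f'' + (((N : ℝ) - 1) * q (yc p) - m (yc p)) * f' (yc p)) +
      1 / Q (yc p) * Real.exp (-2 * β * V (xc p)) *
        (σ * (((N : ℝ) - 4 + a + ((N : ℝ) - 3) * β) * gradSq h V (xc p) -
            2 * Λ / ((N : ℝ) - 2) * Real.exp (-2 * V (xc p)))) := by
  rw [EinsteinScalar.box_expWarped hε hw hS.isOpen hS.smooth hS.metric hp hf hf',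
    hS.box_eq hN hε hp.2, cast_pred hN]
  ring

theorem isMetricOn_expWarped (hS : IsVacuumSeed N ε Λ U V h) (hε : ε * ε = 1)
    (hw : IsWarp D P Q m q q') : IsMetricOn (expWarped ε P Q a β V h) (slab (N := N) D U) :=
  isMetricOn_warped hε hw (isSpatial_exp hS.isOpen hS.smooth hS.metric a β)

theorem pd_inl_field (hU : IsOpen U) (hV : ContDiffOn ℝ ∞ V U) {f : ℝ → ℝ} {f' : ℝ}
    (hp : xc p ∈ U) (hf : HasDerivAt f f' (yc p)) (u : Unit) :
    pd (Sum.inl u) (fun x : Idx N → ℝ => σ * V (xc x) + f (yc x)) p = f' := by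
  have hd : DifferentiableAt ℝ (fun x => σ * V x) (xc p) :=
    (differentiableAt_of_contDiffOn hU hV hp).const_mul σ
  rw [pd_add (f := fun x : Idx N → ℝ => σ * V (xc x)) (hd.fun_comp' p
    hasFDerivAt_xc.differentiableAt)
    (hf.differentiableAt.fun_comp' p hasFDerivAt_yc.differentiableAt),
    pd_inl_yc _ hf, pd_inl_xc (H := fun x => σ * V x) _ hd, zero_add]

theorem pd_inr_field (hU : IsOpen U) (hV : ContDiffOn ℝ ∞ V U) {f : ℝ → ℝ}
    (hp : xc p ∈ U) (hf : DifferentiableAt ℝ f (yc p)) (i : Fin (N - 1)) :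
    pd (Sum.inr i) (fun x : Idx N → ℝ => σ * V (xc x) + f (yc x)) p = σ * pd i V (xc p) := by
  have hV1 := differentiableAt_of_contDiffOn hU hV hp
  have hd : DifferentiableAt ℝ (fun x => σ * V x) (xc p) := hV1.const_mul σ
  rw [pd_add (f := fun x : Idx N → ℝ => σ * V (xc x)) (hd.fun_comp' p
    hasFDerivAt_xc.differentiableAt) (hf.fun_comp' p hasFDerivAt_yc.differentiableAt),
    pd_inr_yc _ hf, pd_inr_xc (H := fun x => σ * V x) _ hd, add_zero, pd_const_mul _ hV1]

/-- With `a = 1 / (N-2)`, `β = -(N-3) / (N-2)` and a potential of the form `w(y) e^{-2aV}`, the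
field equations reduce to equations in the single variable `y`. -/
theorem IsVacuumSeed.solvesEinsteinScalar (hS : IsVacuumSeed N ε Λ U V h) (hN : 3 ≤ N)
    (hε : ε * ε = 1) (hw : IsWarp D P Q m q q') (ha : a = 1 / ((N : ℝ) - 2))
    (hβ : β = -(((N : ℝ) - 3) / ((N : ℝ) - 2))) {κ k : ℝ} {W f f' f'' w : ℝ → ℝ}
    (hf : ContDiffOn ℝ ∞ f D) (hf1 : ∀ y ∈ D, HasDerivAt f (f' y) y)
    (hf2 : ∀ y ∈ D, HasDerivAt f' (f'' y) y)
    (hσ : κ * σ ^ 2 = ((N : ℝ) - 1) / ((N : ℝ) - 2))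
    (hW : ∀ x ∈ U, ∀ y ∈ D, W (σ * V x + f y) = w y * Real.exp (-2 * a * V x))
    (hW' : ∀ φ, HasDerivAt W (-2 * k * W φ) φ)
    (hq : ∀ y ∈ D, q y = κ * σ * f' y)
    (h00 : ∀ y ∈ D, -((N : ℝ) - 1) * (q' y + q y ^ 2 - m y * q y) +
      ε * (P y / Q y) * (2 * Λ / ((N : ℝ) - 2) / ((N : ℝ) - 2)) =
        κ * (f' y ^ 2 + 2 / ((N : ℝ) - 2) * (ε * P y * w y)))
    (hij : ∀ y ∈ D, 4 * Λ / ((N : ℝ) - 2) - 2 * Λ / ((N : ℝ) - 2) * (((N : ℝ) - 3) / ((N : ℝ) - 2)) -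
      ε * (Q y / P y) * (q' y + ((N : ℝ) - 1) * q y ^ 2 - m y * q y) =
        κ * (2 / ((N : ℝ) - 2) * (Q y * w y)))
    (hbox : ∀ y ∈ D, ε / P y * (f'' y + (((N : ℝ) - 1) * q y - m y) * f' y) -
      1 / Q y * (σ * (2 * Λ / ((N : ℝ) - 2))) = -2 * k * w y) :
    SolvesEinsteinScalar κ W (expWarped ε P Q a β V h) (fun x => σ * V (xc x) + f (yc x))
      (slab D U) := by
  have hN2 : (N : ℝ) - 2 ≠ 0 := by
    have : (3 : ℝ) ≤ N := by exact_mod_cast hN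
    linarith
  -- These identities make the separation work: `c0` removes the Hessian and |∇V|², `c1` matches the
  -- ∂V∂V term to κσ², and `c2`, `c3` give all terms of each equation the same power of e^V.
  have c0 : (N : ℝ) - 4 + a + ((N : ℝ) - 3) * β = 0 := by
    rw [ha, hβ]; field_simp; ring
  have c1 : ((N : ℝ) - 3) * β ^ 2 - a ^ 2 + 2 * a * β - ((N : ℝ) - 6) =
      ((N : ℝ) - 1) / ((N : ℝ) - 2) := by
    rw [ha, hβ]; field_simp; ring
  have c2 : a - β = 1 := by rw [ha, hβ]; field_simp; ring
  have c3 : -2 * β + -2 = -2 * a := by rw [ha, hβ]; field_simp; ring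
  have exp_cancel : ∀ t : ℝ, Real.exp (2 * (a - β) * t) * Real.exp (-2 * t) = 1 := fun t => by
    rw [c2, ← Real.exp_add]; simp
  have exp_a : ∀ t : ℝ, Real.exp (2 * a * t) * Real.exp (-2 * a * t) = 1 := fun t => by
    rw [← Real.exp_add]; simp
  have exp_β : ∀ t : ℝ, Real.exp (2 * β * t) * Real.exp (-2 * a * t) = Real.exp (-2 * t) :=
    fun t => by
      rw [← Real.exp_add, ← c3]; ring_nf
  have exp_βa : ∀ t : ℝ, Real.exp (2 * (β - a) * t) = Real.exp (-2 * t) := fun t => by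
      rw [show β - a = -1 by linarith]; ring_nf
  have exp_β' : ∀ t : ℝ, Real.exp (-2 * β * t) * Real.exp (-2 * t) = Real.exp (-2 * a * t) :=
    fun t => by
      rw [← Real.exp_add, ← c3]; ring_nf
  have hcard : (Fintype.card (Idx N) : ℝ) = N := by
    simp [Nat.cast_sub (show 1 ≤ N by omega)]
  refine ⟨isMetricOn_expWarped hS hε hw, ?_, ?_, ?_⟩
  · exact (contDiffOn_const.mul (contDiffOn_comp_xc hS.smooth)).add (contDiffOn_comp_yc hf)
  · intro p hp i j
    have d1 := pd_inl_field (σ := σ) hS.isOpen hS.smooth hp.2 (hf1 _ hp.1) ()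
    have d2 := pd_inr_field (σ := σ) hS.isOpen hS.smooth hp.2 (hf1 _ hp.1).differentiableAt
    rw [hcard, hW _ hp.2 _ hp.1]
    rcases i with ⟨⟩ | i <;> rcases j with ⟨⟩ | j
    · rw [hS.ricci_inl_inl hN hε hw hp, d1, c0, expWarped_eq_splitMetric]
      simp only [splitMetric, Matrix.fromBlocks_apply₁₁, Matrix.of_apply]
      linear_combination h00 _ hp.1 + ε * (P (yc p) / Q (yc p)) * a * (2 * Λ / ((N : ℝ) - 2)) *
        exp_cancel (V (xc p)) - κ * (2 / ((N : ℝ) - 2)) * ε * P (yc p) * w (yc p) *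
        exp_a (V (xc p)) + ε * (P (yc p) / Q (yc p)) * (2 * Λ / ((N : ℝ) - 2)) * ha
    · rw [ricci_expWarped_inl_inr hε hw hS.isOpen hS.smooth hS.metric hp, d1, d2, cast_pred hN,
        expWarped_eq_splitMetric]
      simp only [splitMetric, Matrix.fromBlocks_apply₁₂, Matrix.zero_apply]
      rw [hq _ hp.1, ha]
      field_simp
      ring
    · rw [ricci_expWarped_inr_inl hε hw hS.isOpen hS.smooth hS.metric hp, d1, d2, cast_pred hN,
        expWarped_eq_splitMetric]
      simp only [splitMetric, Matrix.fromBlocks_apply₂₁, Matrix.zero_apply]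
      rw [hq _ hp.1, ha]
      field_simp
      ring
    · rw [hS.ricci_inr_inr hN hε hw hp, d2, d2, c0, c1, expWarped_eq_splitMetric, exp_βa]
      simp only [splitMetric, Matrix.fromBlocks_apply₂₂, Matrix.smul_apply, smul_eq_mul]
      linear_combination Real.exp (-2 * V (xc p)) * h (xc p) i j * hij _ hp.1 -
        pd i V (xc p) * pd j V (xc p) * hσ - κ * (2 / ((N : ℝ) - 2)) * Q (yc p) * w (yc p) *
        h (xc p) i j * exp_β (V (xc p)) +
        2 * Λ / ((N : ℝ) - 2) * Real.exp (-2 * V (xc p)) * h (xc p) i j * hβ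
  · intro p hp
    have : box (expWarped ε P Q a β V h) (fun x => σ * V (xc x) + f (yc x)) p =
        -2 * k * W (σ * V (xc p) + f (yc p)) := by
      rw [hS.box_expWarped hN hε hw hp hf1 (hf2 _ hp.1), hW _ hp.2 _ hp.1, c0]
      linear_combination Real.exp (-2 * a * V (xc p)) * hbox _ hp.1 -
        1 / Q (yc p) * σ * (2 * Λ / ((N : ℝ) - 2)) * exp_β' (V (xc p))
    rw [this]
    exact hW' _

end Seed

/-! ### Inverting a primitive to change the coordinate. -/

section Reparametrization

/-- A function with positive smooth derivative on an open interval has a smooth inverse. -/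
theorem exists_smooth_inverse {D : Set ℝ} (hD : IsOpen D) (hc : D.OrdConnected)
    {Y F : ℝ → ℝ} (hF : ContDiffOn ℝ ∞ F D) (hpos : ∀ t ∈ D, 0 < F t)
    (hY : ∀ t ∈ D, HasDerivAt Y (F t) t) :
    ∃ (I : Set ℝ) (T : ℝ → ℝ), IsOpen I ∧ I.OrdConnected ∧ ContDiffOn ℝ ∞ T I ∧
      Set.BijOn T I D ∧ ∀ y ∈ I, HasDerivAt T (F (T y))⁻¹ y := by
  have hYc : ContinuousOn Y D := fun t ht => (hY t ht).continuousAt.continuousWithinAt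
  have hmono : StrictMonoOn Y D := by
    refine strictMonoOn_of_deriv_pos hc.convex hYc fun t ht => ?_
    rw [hD.interior_eq] at ht
    rw [(hY t ht).deriv]; exact hpos t ht
  have hYs : ContDiffOn ℝ ∞ Y D := by
    rw [contDiffOn_infty_iff_deriv_of_isOpen hD]
    exact ⟨fun t ht => (hY t ht).differentiableAt.differentiableWithinAt,
      hF.congr fun t ht => (hY t ht).deriv⟩
  have hbij : Set.BijOn Y D (Y '' D) := hmono.injOn.bijOn_image
  have hinv : Set.InvOn (Function.invFunOn Y D) Y D (Y '' D) := hbij.invOn_invFunOn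
  have hT : Set.BijOn (Function.invFunOn Y D) (Y '' D) D := Set.BijOn.symm hinv.symm hbij
  have key : ∀ y ∈ Y '' D, ContDiffAt ℝ ∞ (Function.invFunOn Y D) y ∧ Y '' D ∈ 𝓝 y := by
    rintro _ ⟨t, ht, rfl⟩
    have hct := hYs.contDiffAt (hD.mem_nhds ht)
    have hne : F t ≠ 0 := (hpos t ht).ne'
    have hd : HasFDerivAt Y (ContinuousLinearEquiv.unitsEquivAut ℝ (Units.mk0 (F t) hne) :
        ℝ →L[ℝ] ℝ) t := (hY t ht)
    have hs := hct.hasStrictFDerivAt' hd (by simp)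
    have hmap : map Y (𝓝 t) = 𝓝 (Y t) := hs.map_nhds_eq_of_equiv
    refine ⟨?_, ?_⟩
    -- Y is injective on D, so near Y t its global inverse agrees with the local inverse given by
    -- the inverse function theorem, and inherits smoothness from it.
    · refine (hct.to_localInverse hd (by simp)).congr_of_eventuallyEq ?_
      have h1 : ∀ᶠ y in 𝓝 (Y t), Y (hct.localInverse hd (by simp) y) = y :=
        hs.eventually_right_inverse
      have h2 : Tendsto (hct.localInverse hd (by simp)) (𝓝 (Y t)) (𝓝 t) :=
        hs.localInverse_tendsto
      filter_upwards [h1, h2 (hD.mem_nhds ht)] with y hy1 hy2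
      have : Function.invFunOn Y D (Y (hct.localInverse hd (by simp) y)) =
          hct.localInverse hd (by simp) y := hinv.1 hy2
      rwa [hy1] at this
    · rw [← hmap]
      exact image_mem_map (hD.mem_nhds ht)
  refine ⟨Y '' D, Function.invFunOn Y D, ?_, ?_, fun y hy => (key y hy).1.contDiffWithinAt, hT, ?_⟩
  · rw [isOpen_iff_mem_nhds]
    exact fun y hy => (key y hy).2
  · exact (hc.isPreconnected.image Y hYc).ordConnected
  · intro y hy
    have hTy := hT.mapsTo hy
    exact HasDerivAt.of_local_left_inverse (key y hy).1.continuousAt (hY _ hTy) (hpos _ hTy).ne'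
      (by filter_upwards [(key y hy).2] with z hz using hinv.2 hz)

/-- An autonomous equation `T' = 1 / F(T)` with `F > 0` has a solution running through the whole
interval. -/
theorem exists_reparametrization {D : Set ℝ} (hD : IsOpen D) (hc : D.OrdConnected)
    (hne : D.Nonempty) {F : ℝ → ℝ} (hF : ContDiffOn ℝ ∞ F D) (hpos : ∀ t ∈ D, 0 < F t) :
    ∃ (I : Set ℝ) (T : ℝ → ℝ), IsOpen I ∧ I.OrdConnected ∧ ContDiffOn ℝ ∞ T I ∧
      Set.BijOn T I D ∧ ∀ y ∈ I, HasDerivAt T (F (T y))⁻¹ y := by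
  obtain ⟨t₀, ht₀⟩ := hne
  -- Separation of variables: y = ∫ F dτ. Inverting this primitive on all of D, instead of solving
  -- the equation locally, makes T a bijection onto D.
  refine exists_smooth_inverse hD hc (Y := fun t => ∫ u in t₀..t, F u) hF hpos fun t ht => ?_
  have hsub : Set.uIcc t₀ t ⊆ D := hc.uIcc_subset ht₀ ht
  have hcont := hF.continuousOn
  refine intervalIntegral.integral_hasDerivAt_right
    (ContinuousOn.intervalIntegrable (hcont.mono hsub)) ?_ (hcont.continuousAt (hD.mem_nhds ht))
  exact hcont.stronglyMeasurableAtFilter hD t ht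

end Reparametrization

/-! ### The range of τ. -/

section TauDomain

variable {N : ℕ} {η χ : ℝ}

theorem contDiffOn_lapseFactor (N : ℕ) (η χ : ℝ) :
    ContDiffOn ℝ ∞ (lapseFactor N η χ) (Set.Ioi 0) :=
  contDiffOn_const.sub (contDiffOn_const.mul ((contDiffOn_id.pow _).inv fun _ ht =>
    pow_ne_zero _ (ne_of_gt ht)))

theorem isOpen_tauDomain (N : ℕ) (η χ : ℝ) : IsOpen (tauDomain N η χ) :=
  (contDiffOn_lapseFactor N η χ).continuousOn.isOpen_inter_preimage isOpen_Ioi isOpen_Ioi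

/-- The function τ^{-2(N-2)} is antitone, so the lapse factor is monotone, in a direction set by the
sign of χ. Positivity at one endpoint therefore passes to the points between. -/
theorem ordConnected_tauDomain (N : ℕ) (η χ : ℝ) : (tauDomain N η χ).OrdConnected := by
  refine ⟨fun a ha b hb t ht => ?_⟩
  have ht0 : 0 < t := ha.1.trans_le ht.1
  refine ⟨ht0, ?_⟩
  have h1 : (t ^ (2 * (N - 2)))⁻¹ ≤ (a ^ (2 * (N - 2)))⁻¹ :=
    inv_anti₀ (pow_pos ha.1 _) (pow_le_pow_left₀ ha.1.le ht.1 _)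
  have h2 : (b ^ (2 * (N - 2)))⁻¹ ≤ (t ^ (2 * (N - 2)))⁻¹ :=
    inv_anti₀ (pow_pos ht0 _) (pow_le_pow_left₀ ht0.le ht.2 _)
  have ha' := ha.2
  have hb' := hb.2
  unfold lapseFactor at *
  rcases le_total 0 χ with hχ | hχ
  · nlinarith [mul_le_mul_of_nonneg_left h1 hχ]
  · nlinarith [mul_le_mul_of_nonpos_left h2 hχ]

/-- If η > 0, the lapse factor tends to η as τ → ∞; if χ < 0, it tends to +∞ as τ → 0⁺. Both limits
need the exponent 2(N-2) to be nonzero. -/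
theorem nonempty_tauDomain (hN : 3 ≤ N) (h : 0 < η ∨ χ < 0) : (tauDomain N η χ).Nonempty := by
  have hne : 2 * (N - 2) ≠ 0 := by omega
  rcases h with h | h
  · have h1 : Tendsto (fun t : ℝ => η - χ * (t ^ (2 * (N - 2)))⁻¹) atTop (𝓝 (η - χ * 0)) :=
      tendsto_const_nhds.sub (tendsto_const_nhds.mul
        (tendsto_inv_atTop_zero.comp (tendsto_pow_atTop hne)))
    rw [mul_zero, sub_zero] at h1
    obtain ⟨t, ht1, ht2⟩ := ((h1.eventually (lt_mem_nhds h)).and (eventually_gt_atTop 0)).exists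
    exact ⟨t, ht2, ht1⟩
  · have h0 : Tendsto (fun t : ℝ => (t ^ (2 * (N - 2)))⁻¹) (𝓝[>] 0) atTop := by
      refine tendsto_inv_nhdsGT_zero.comp ?_
      refine tendsto_nhdsWithin_iff.2 ⟨?_, ?_⟩
      · have : Tendsto (fun t : ℝ => t ^ (2 * (N - 2))) (𝓝 0) (𝓝 (0 ^ (2 * (N - 2)))) :=
          (continuous_pow _).tendsto 0
        rw [zero_pow hne] at this
        exact this.mono_left nhdsWithin_le_nhds
      · filter_upwards [self_mem_nhdsWithin] with t ht using pow_pos (Set.mem_Ioi.1 ht) _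
    have h1 : Tendsto (fun t : ℝ => η + -χ * (t ^ (2 * (N - 2)))⁻¹) (𝓝[>] 0) atTop :=
      tendsto_atTop_add_const_left _ _ (h0.const_mul_atTop (by linarith))
    obtain ⟨t, ht1, ht2⟩ := ((h1.eventually (eventually_gt_atTop 0)).and
      (self_mem_nhdsWithin : Set.Ioi (0 : ℝ) ∈ 𝓝[>] 0)).exists
    refine ⟨t, ht2, ?_⟩
    unfold lapseFactor; linarith

theorem hasDerivAt_lapseFactor (hN : 3 ≤ N) (η χ : ℝ) {t : ℝ} (ht : t ≠ 0) :
    HasDerivAt (lapseFactor N η χ)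
      (2 * ((N : ℝ) - 2) * χ / (t ^ (2 * (N - 2)) * t)) t := by
  have h1 := (((hasDerivAt_pow (2 * (N - 2)) t).inv (pow_ne_zero _ ht)).const_mul χ).const_sub η
  refine h1.congr_deriv ?_
  have e : t ^ (2 * (N - 2)) = t ^ (2 * (N - 2) - 1) * t := by
    rw [← pow_succ]; congr 1; omega
  have hc : ((2 * (N - 2) : ℕ) : ℝ) = 2 * ((N : ℝ) - 2) := by
    rw [Nat.cast_mul, Nat.cast_sub (by omega)]; norm_num
  rw [hc, e]
  field_simp

end TauDomain

/-! ### Pullback under a change of the distinguished coordinate. -/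

section Pullback

variable {N : ℕ} {p : Idx N → ℝ}

/-- The Jacobian is diagonal, with entry T' in the y direction and 1 in the others. -/
theorem pullbackMetric_changeTime {T : ℝ → ℝ} {T' : ℝ} (hT : HasDerivAt T T' (yc p))
    (a : (Idx N → ℝ) → ℝ) (b : (Idx N → ℝ) → Matrix (Fin (N - 1)) (Fin (N - 1)) ℝ) :
    pullbackMetric (changeTime T) (splitMetric a b) p =
      Matrix.fromBlocks (Matrix.of fun _ _ => T' ^ 2 * a (changeTime T p)) 0 0
        (b (changeTime T p)) := by
  have d1 : ∀ u v, pd (Sum.inl u) (fun q : Idx N → ℝ => changeTime T q (Sum.inl v)) p = T' :=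
    fun u v => pd_inl_yc u hT
  have d2 : ∀ i v, pd (Sum.inr i) (fun q : Idx N → ℝ => changeTime T q (Sum.inl v)) p = 0 :=
    fun i v => pd_inr_yc i hT.differentiableAt
  have hd : ∀ j, DifferentiableAt ℝ (fun x : Fin (N - 1) → ℝ => x j) (xc p) :=
    fun j => (differentiableAt_apply (𝕜 := ℝ) j _)
  have d3 : ∀ u j, pd (Sum.inl u) (fun q : Idx N → ℝ => changeTime T q (Sum.inr j)) p = 0 :=
    fun u j => pd_inl_xc (H := fun x => x j) u (hd j)
  have d4 : ∀ i j, pd (Sum.inr i) (fun q : Idx N → ℝ => changeTime T q (Sum.inr j)) p =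
      if j = i then 1 else 0 := fun i j => by
    refine (pd_inr_xc (H := fun x => x j) i (hd j)).trans ?_
    unfold pd
    rw [(hasFDerivAt_apply (𝕜 := ℝ) j (xc p)).fderiv]
    simp [Pi.single_apply]
  ext i j
  unfold pullbackMetric splitMetric
  rcases i with u | i <;> rcases j with v | j
  · simp [Fintype.sum_sum_type, d1, d3, sq]
  · simp [Fintype.sum_sum_type, d1, d2, d3, d4]
  · simp [Fintype.sum_sum_type, d1, d2, d3, d4]
  · simp [Fintype.sum_sum_type, d2, d4]

end Pullback

/-! ### Algebra of the constants σ, ρ, k and W₀. -/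

section Constants

variable {N : ℕ} {κ ε s η : ℝ}

theorem three_le_cast (hN : 3 ≤ N) : (3 : ℝ) ≤ N := by exact_mod_cast hN

theorem sq_sign (hs : s = 1 ∨ s = -1) : s * s = 1 := by rcases hs with rfl | rfl <;> norm_num

theorem familySigma_sq (hN : 3 ≤ N) (hκ : 0 < κ) (hs : s = 1 ∨ s = -1) :
    κ * familySigma N κ s ^ 2 = ((N : ℝ) - 1) / ((N : ℝ) - 2) := by
  have h3 := three_le_cast hN
  have h2 : (N : ℝ) - 2 ≠ 0 := by linarith
  unfold familySigma
  rw [mul_pow, sq s, sq_sign hs, Real.sq_sqrt (div_nonneg (by linarith)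
    (mul_nonneg hκ.le (by linarith)))]
  field_simp

/-- Like k in `familyExponent_eq`, ρ is a rational multiple of σ. Later computations therefore meet
square roots only through κσ² = (N-1)/(N-2). -/
theorem familyRho_eq (hN : 3 ≤ N) (hκ : 0 < κ) (s : ℝ) :
    familyRho N κ s = familySigma N κ s * (((N : ℝ) - 2) / ((N : ℝ) - 1)) := by
  have h3 := three_le_cast hN
  have h2 : (N : ℝ) - 2 ≠ 0 := by linarith
  have h1 : (N : ℝ) - 1 ≠ 0 := by linarith
  have hc : 0 ≤ ((N : ℝ) - 2) / ((N : ℝ) - 1) := div_nonneg (by linarith) (by linarith)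
  have e : ((N : ℝ) - 2) / (κ * ((N : ℝ) - 1)) =
      (((N : ℝ) - 1) / (κ * ((N : ℝ) - 2))) * (((N : ℝ) - 2) / ((N : ℝ) - 1)) ^ 2 := by
    field_simp
  unfold familyRho familySigma
  rw [e, Real.sqrt_mul (div_nonneg (by linarith) (mul_nonneg hκ.le (by linarith))),
    Real.sqrt_sq hc]
  ring

theorem familyExponent_eq (hN : 3 ≤ N) (hκ : 0 < κ) (s : ℝ) :
    s * Real.sqrt (κ / (((N : ℝ) - 1) * ((N : ℝ) - 2))) =
      κ * familySigma N κ s / ((N : ℝ) - 1) := by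
  have h3 := three_le_cast hN
  have h2 : (N : ℝ) - 2 ≠ 0 := by linarith
  have h1 : (N : ℝ) - 1 ≠ 0 := by linarith
  have hc : 0 ≤ κ / ((N : ℝ) - 1) := div_nonneg hκ.le (by linarith)
  have e : κ / (((N : ℝ) - 1) * ((N : ℝ) - 2)) =
      (((N : ℝ) - 1) / (κ * ((N : ℝ) - 2))) * (κ / ((N : ℝ) - 1)) ^ 2 := by
    field_simp
  unfold familySigma
  rw [e, Real.sqrt_mul (div_nonneg (by linarith) (mul_nonneg hκ.le (by linarith))),
    Real.sqrt_sq hc]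
  ring

/-- As λ² = 1/(N-1), the factor N-1-λ² equals N(N-2)/(N-1). -/
theorem familyW₀_eq (hN : 3 ≤ N) (hs : s = 1 ∨ s = -1) : familyW₀ N κ ε s η =
    -ε * (((N : ℝ) - 2) ^ 2 * N / (2 * κ * ((N : ℝ) - 1))) * η := by
  have h3 := three_le_cast hN
  have h1 : (N : ℝ) - 1 ≠ 0 := by linarith
  unfold familyW₀ familyLambda
  rw [div_pow, sq s, sq_sign hs, Real.sq_sqrt (by linarith)]
  -- For κ = 0 both sides are 0 by the convention for division by zero.
  by_cases hκ : κ = 0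
  · simp [hκ]
  · field_simp; ring

theorem familyW₀_ne_zero_iff (hN : 3 ≤ N) (hκ : 0 < κ) (hε : ε * ε = 1) (hs : s = 1 ∨ s = -1) :
    familyW₀ N κ ε s η ≠ 0 ↔ η ≠ 0 := by
  have h3 := three_le_cast hN
  have h1 : (N : ℝ) - 1 ≠ 0 := by linarith
  have h2 : (N : ℝ) - 2 ≠ 0 := by linarith
  have h0 : (N : ℝ) ≠ 0 := by linarith
  have hε0 : ε ≠ 0 := by rintro rfl; simp at hε
  rw [familyW₀_eq hN hs, mul_ne_zero_iff]
  refine and_iff_right (mul_ne_zero (neg_ne_zero.2 hε0) (div_ne_zero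
    (mul_ne_zero (pow_ne_zero _ h2) h0) (mul_ne_zero (mul_ne_zero two_ne_zero hκ.ne') h1)))

/-- Since kσ = 1/(N-2), the exponent -2kφ is -2V/(N-2) - 2 ln τ. So W has the separated form w(y)
e^{-2aV} required by `solvesEinsteinScalar`. -/
theorem familyPotential_apply (hN : 3 ≤ N) (hκ : 0 < κ) (hs : s = 1 ∨ s = -1) (v : ℝ) {τ : ℝ}
    (hτ : 0 < τ) :
    familyPotential N κ ε s η
        (familySigma N κ s * v + familySigma N κ s * (((N : ℝ) - 2) * Real.log τ)) =
      familyW₀ N κ ε s η / τ ^ 2 * Real.exp (-2 * (1 / ((N : ℝ) - 2)) * v) := by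
  have h3 := three_le_cast hN
  have h2 : (N : ℝ) - 2 ≠ 0 := by linarith
  have h1 : (N : ℝ) - 1 ≠ 0 := by linarith
  unfold familyPotential
  rw [familyExponent_eq hN hκ]
  have e : -2 * (κ * familySigma N κ s / ((N : ℝ) - 1)) *
      (familySigma N κ s * v + familySigma N κ s * (((N : ℝ) - 2) * Real.log τ)) =
      -2 * (1 / ((N : ℝ) - 2)) * v - Real.log (τ ^ 2) := by
    rw [Real.log_pow]
    have hS := familySigma_sq hN hκ hs
    have : κ * familySigma N κ s * familySigma N κ s / ((N : ℝ) - 1) = 1 / ((N : ℝ) - 2) := by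
      rw [mul_assoc, ← sq, hS]; field_simp
    rw [show -2 * (κ * familySigma N κ s / ((N : ℝ) - 1)) *
      (familySigma N κ s * v + familySigma N κ s * (((N : ℝ) - 2) * Real.log τ)) =
      -2 * (κ * familySigma N κ s * familySigma N κ s / ((N : ℝ) - 1)) *
        (v + ((N : ℝ) - 2) * Real.log τ) by ring, this]
    push_cast
    field_simp
    ring
  rw [e, Real.exp_sub, Real.exp_log (pow_pos hτ 2)]
  ring

theorem hasDerivAt_familyPotential (N : ℕ) (κ ε s η φ : ℝ) :
    HasDerivAt (familyPotential N κ ε s η)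
      (-2 * (s * Real.sqrt (κ / (((N : ℝ) - 1) * ((N : ℝ) - 2)))) *
        familyPotential N κ ε s η φ) φ := by
  unfold familyPotential
  have := (((hasDerivAt_id φ).const_mul
    (-2 * (s * Real.sqrt (κ / (((N : ℝ) - 1) * ((N : ℝ) - 2)))))).exp).const_mul
    (familyW₀ N κ ε s η)
  refine this.congr_deriv ?_
  simp only [id]; ring

end Constants

/-! ### The family solves the field equations in any parametrization. -/

section Family

variable {N : ℕ} {κ ε η χ s Λ : ℝ} {D : Set ℝ} {T P Q m q q' : ℝ → ℝ}
  {U : Set (Fin (N - 1) → ℝ)} {V : (Fin (N - 1) → ℝ) → ℝ}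
  {h : (Fin (N - 1) → ℝ) → Matrix (Fin (N - 1)) (Fin (N - 1)) ℝ}

theorem IsWarp.congr {P' Q' : ℝ → ℝ} (hw : IsWarp D P Q m q q') (hP : ∀ y ∈ D, P' y = P y)
    (hQ : ∀ y ∈ D, Q' y = Q y) : IsWarp D P' Q' m q q' where
  isOpen := hw.isOpen
  smooth_left := hw.smooth_left.congr hP
  smooth_right := hw.smooth_right.congr hQ
  left_ne_zero y hy := by rw [hP y hy]; exact hw.left_ne_zero y hy
  right_ne_zero y hy := by rw [hQ y hy]; exact hw.right_ne_zero y hy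
  hasDerivAt_left y hy := by
    rw [hP y hy]
    exact (hw.hasDerivAt_left y hy).congr_of_eventuallyEq
      (by filter_upwards [hw.isOpen.mem_nhds hy] with z hz using hP z hz)
  hasDerivAt_right y hy := by
    rw [hQ y hy]
    exact (hw.hasDerivAt_right y hy).congr_of_eventuallyEq
      (by filter_upwards [hw.isOpen.mem_nhds hy] with z hz using hQ z hz)
  differentiableAt_left := hw.differentiableAt_left
  hasDerivAt_log := hw.hasDerivAt_log

theorem deriv_smooth (hD : IsOpen D) (hT : ContDiffOn ℝ ∞ T D) : ContDiffOn ℝ ∞ (deriv T) D :=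
  ((contDiffOn_infty_iff_deriv_of_isOpen hD).1 hT).2

/-- The family in an arbitrary parametrization `τ = T(y)`. -/
theorem isWarp_family (hN : 3 ≤ N) (hD : IsOpen D) (hT : ContDiffOn ℝ ∞ T D)
    (hmem : ∀ y ∈ D, T y ∈ tauDomain N η χ) (hT' : ∀ y ∈ D, deriv T y ≠ 0) :
    IsWarp D (fun y => ((N : ℝ) - 1) ^ 2 * deriv T y ^ 2 / lapseFactor N η χ (T y))
      (fun y => T y ^ (2 * (N - 1)))
      (fun y => deriv (deriv T) y / deriv T y - ((N : ℝ) - 2) * χ /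
        (T y ^ (2 * (N - 2)) * T y) * deriv T y / lapseFactor N η χ (T y))
      (fun y => ((N : ℝ) - 1) * (deriv T y / T y))
      (fun y => ((N : ℝ) - 1) * (deriv (deriv T) y / T y - (deriv T y / T y) ^ 2)) := by
  have h3 := three_le_cast hN
  have hT1 := deriv_smooth hD hT
  have hT2 := deriv_smooth hD hT1
  have d0 := fun y hy => (differentiableAt_of_contDiffOn (p := y) hD hT hy).hasDerivAt
  have d1 := fun y hy => (differentiableAt_of_contDiffOn (p := y) hD hT1 hy).hasDerivAt
  have d2 := fun y hy => (differentiableAt_of_contDiffOn (p := y) hD hT2 hy)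
  have hell : ContDiffOn ℝ ∞ (fun y => lapseFactor N η χ (T y)) D :=
    (contDiffOn_lapseFactor N η χ).comp hT fun y hy => (hmem y hy).1
  have dl : ∀ y ∈ D, HasDerivAt (fun y => lapseFactor N η χ (T y)) _ y := fun y hy =>
    (hasDerivAt_lapseFactor hN η χ (hmem y hy).1.ne').comp y (d0 y hy)
  refine ⟨hD, ?_, hT.pow _, ?_, ?_, ?_, ?_, ?_, ?_⟩
  · exact (contDiffOn_const.mul (hT1.pow 2)).div hell fun y hy => (hmem y hy).2.ne'
  · intro y hy
    exact div_ne_zero (mul_ne_zero (pow_ne_zero _ (by linarith)) (pow_ne_zero _ (hT' y hy)))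
      (hmem y hy).2.ne'
  · intro y hy
    exact pow_ne_zero _ (hmem y hy).1.ne'
  · intro y hy
    refine ((((d1 y hy).fun_pow 2).const_mul (((N : ℝ) - 1) ^ 2)).fun_div (dl y hy)
      (hmem y hy).2.ne').congr_deriv ?_
    have e1 := (hmem y hy).2.ne'
    have e2 := hT' y hy
    have e3 := (hmem y hy).1.ne'
    have e4 := pow_ne_zero (2 * (N - 2)) e3
    generalize T y ^ (2 * (N - 2)) = z at *
    generalize lapseFactor N η χ (T y) = l at *
    field_simp
    ring
  · intro y hy
    refine ((d0 y hy).fun_pow (2 * (N - 1))).congr_deriv ?_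
    have e3 := (hmem y hy).1.ne'
    have e : T y ^ (2 * (N - 1)) = T y ^ (2 * (N - 1) - 1) * T y := by
      rw [← pow_succ]; congr 1; omega
    have hc : ((2 * (N - 1) : ℕ) : ℝ) = 2 * ((N : ℝ) - 1) := by
      rw [Nat.cast_mul, cast_pred hN]; norm_num
    rw [hc, e]
    field_simp
  · intro y hy
    have e1 := (hmem y hy).2.ne'
    have e2 := hT' y hy
    have e3 := (hmem y hy).1.ne'
    have e4 := pow_ne_zero (2 * (N - 2)) e3
    have a1 := (d0 y hy).differentiableAt
    have a2 := (d1 y hy).differentiableAt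
    have a3 := (dl y hy).differentiableAt
    have a4 : DifferentiableAt ℝ (fun y => T y ^ (2 * (N - 2)) * T y) y := (a1.fun_pow _).fun_mul a1
    exact ((d2 y hy).fun_div a2 e2).fun_sub (((((differentiableAt_const _).fun_div a4
      (mul_ne_zero e4 e3))).fun_mul a2).fun_div a3 e1)
  · intro y hy
    have e3 := (hmem y hy).1.ne'
    refine (((d1 y hy).fun_div (d0 y hy) e3).const_mul ((N : ℝ) - 1)).congr_deriv ?_
    field_simp

/-- An arbitrary T lets the lemma serve twice: T = id is the chart τ, and the T of
`exists_reparametrization` is the inflated chart. P and Q are prescribed only on D, so that they may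
also be written as exponentials of μ. -/
theorem IsVacuumSeed.solves_family (hS : IsVacuumSeed N ε Λ U V h) (hN : 3 ≤ N) (hκ : 0 < κ)
    (hε : ε = 1 ∨ ε = -1) (hs : s = 1 ∨ s = -1)
    (hΛ : Λ = -(ε / 2) * (((N : ℝ) - 2) ^ 3 / ((N : ℝ) - 1)) * χ)
    (hD : IsOpen D) (hT : ContDiffOn ℝ ∞ T D)
    (hmem : ∀ y ∈ D, T y ∈ tauDomain N η χ) (hT' : ∀ y ∈ D, deriv T y ≠ 0)
    (hP : ∀ y ∈ D, P y = ((N : ℝ) - 1) ^ 2 * deriv T y ^ 2 / lapseFactor N η χ (T y))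
    (hQ : ∀ y ∈ D, Q y = T y ^ (2 * (N - 1))) :
    SolvesEinsteinScalar κ (familyPotential N κ ε s η)
      (expWarped ε P Q (1 / ((N : ℝ) - 2)) (-(((N : ℝ) - 3) / ((N : ℝ) - 2))) V h)
      (fun x => familySigma N κ s * V (xc x) +
        familySigma N κ s * (((N : ℝ) - 2) * Real.log (T (yc x)))) (slab D U) := by
  have h3 := three_le_cast hN
  have h2 : (N : ℝ) - 2 ≠ 0 := by linarith
  have h1 : (N : ℝ) - 1 ≠ 0 := by linarith
  have hT1 := deriv_smooth hD hT
  have d0 := fun y hy => (differentiableAt_of_contDiffOn (p := y) hD hT hy).hasDerivAt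
  have d1 := fun y hy => (differentiableAt_of_contDiffOn (p := y) hD hT1 hy).hasDerivAt
  have hσ := familySigma_sq hN hκ hs
  -- Multiplication by κ removes the 1/κ of W₀, so κ enters the remaining identities only through
  -- κσ².
  have hκW : ∀ τ : ℝ, κ * (familyW₀ N κ ε s η / τ ^ 2) =
      -ε * (((N : ℝ) - 2) ^ 2 * N / (2 * ((N : ℝ) - 1))) * η / τ ^ 2 := fun τ => by
    rw [familyW₀_eq hN hs]
    field_simp
  have hk : s * Real.sqrt (κ / (((N : ℝ) - 1) * ((N : ℝ) - 2))) = _ := familyExponent_eq hN hκ s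
  -- Eliminating η in favour of the lapse factor makes each field equation a rational identity in l,
  -- τ^{2(N-2)}, τ and the derivatives of T.
  have hη : ∀ t, η = lapseFactor N η χ t + χ / t ^ (2 * (N - 2)) := fun t => by
    unfold lapseFactor; rw [div_eq_mul_inv]; ring
  have hpow : ∀ t : ℝ, t ^ (2 * (N - 1)) = t ^ (2 * (N - 2)) * t ^ 2 := fun t => by
    rw [← pow_add]; congr 1; omega
  refine hS.solvesEinsteinScalar (f := fun y => familySigma N κ s * (((N : ℝ) - 2) *
      Real.log (T y))) (f' := fun y => familySigma N κ s * (((N : ℝ) - 2) * (deriv T y / T y)))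
    (f'' := fun y => familySigma N κ s * (((N : ℝ) - 2) *
      (deriv (deriv T) y / T y - (deriv T y / T y) ^ 2)))
    (w := fun y => familyW₀ N κ ε s η / T y ^ 2) hN (sq_sign hε)
    ((isWarp_family hN hD hT hmem hT').congr hP hQ) rfl rfl ?_ ?_ ?_ hσ ?_
    (hasDerivAt_familyPotential N κ ε s η) ?_ ?_ ?_ ?_
  · exact contDiffOn_const.mul (contDiffOn_const.mul (hT.log fun y hy => (hmem y hy).1.ne'))
  · intro y hy
    exact (((d0 y hy).log (hmem y hy).1.ne').const_mul _).const_mul _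
  · intro y hy
    have e3 := (hmem y hy).1.ne'
    refine ((((d1 y hy).fun_div (d0 y hy) e3).const_mul ((N : ℝ) - 2)).const_mul
      _).congr_deriv ?_
    field_simp
  · intro x _ y hy
    exact familyPotential_apply hN hκ hs _ (hmem y hy).1
  · intro y _
    have : κ * familySigma N κ s * (familySigma N κ s * (((N : ℝ) - 2) * (deriv T y / T y))) =
      κ * familySigma N κ s ^ 2 * (((N : ℝ) - 2) * (deriv T y / T y)) := by ring
    rw [this, hσ]
    field_simp
  · intro y hy
    have e1 := (hmem y hy).2.ne'
    have e2 := hT' y hy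
    have e3 := (hmem y hy).1.ne'
    have e4 := pow_ne_zero (2 * (N - 2)) e3
    have hη' := hη (T y)
    have e : ∀ A B C : ℝ, κ * ((familySigma N κ s * A) ^ 2 + B * (C * (familyW₀ N κ ε s η /
        T y ^ 2))) = κ * familySigma N κ s ^ 2 * A ^ 2 +
          B * (C * (κ * (familyW₀ N κ ε s η / T y ^ 2))) := fun A B C => by ring
    simp only [e, hκW, hσ, hP y hy, hQ y hy, hΛ, hpow]
    generalize lapseFactor N η χ (T y) = l at *
    generalize T y ^ (2 * (N - 2)) = z at *
    rw [hη']
    rcases hε with rfl | rfl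
    · field_simp
      ring
    · field_simp
      ring
  · intro y hy
    have e1 := (hmem y hy).2.ne'
    have e2 := hT' y hy
    have e3 := (hmem y hy).1.ne'
    have e4 := pow_ne_zero (2 * (N - 2)) e3
    have hη' := hη (T y)
    have e : ∀ B C : ℝ, κ * (B * (C * (familyW₀ N κ ε s η /
        T y ^ 2))) = B * (C * (κ * (familyW₀ N κ ε s η / T y ^ 2))) := fun B C => by ring
    simp only [e, hκW, hP y hy, hQ y hy, hΛ, hpow]
    generalize lapseFactor N η χ (T y) = l at *
    generalize T y ^ (2 * (N - 2)) = z at *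
    rw [hη']
    rcases hε with rfl | rfl
    · field_simp
      ring
    · field_simp
      ring
  · intro y hy
    have e1 := (hmem y hy).2.ne'
    have e2 := hT' y hy
    have e3 := (hmem y hy).1.ne'
    have e4 := pow_ne_zero (2 * (N - 2)) e3
    have hη' := hη (T y)
    have e : -2 * (κ * familySigma N κ s / ((N : ℝ) - 1)) * (familyW₀ N κ ε s η / T y ^ 2) =
        -2 * (familySigma N κ s / ((N : ℝ) - 1)) * (κ * (familyW₀ N κ ε s η / T y ^ 2)) := by
      ring
    simp only [hk]
    rw [e]
    simp only [hκW, hP y hy, hQ y hy, hΛ, hpow]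
    generalize lapseFactor N η χ (T y) = l at *
    generalize T y ^ (2 * (N - 2)) = z at *
    rw [hη']
    rcases hε with rfl | rfl
    · field_simp
      ring
    · field_simp
      ring

end Family

/-! ### The family belongs to the class of inflated solutions. -/

section FamilyMembers

variable {N : ℕ} {κ ε η χ s Λ : ℝ} {U : Set (Fin (N - 1) → ℝ)} {V : (Fin (N - 1) → ℝ) → ℝ}
  {h : (Fin (N - 1) → ℝ) → Matrix (Fin (N - 1)) (Fin (N - 1)) ℝ}

theorem familyMetric_eq_expWarped (ε η χ : ℝ) (V : (Fin (N - 1) → ℝ) → ℝ)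
    (h : (Fin (N - 1) → ℝ) → Matrix (Fin (N - 1)) (Fin (N - 1)) ℝ) :
    familyMetric ε η χ V h = expWarped ε (fun t => ((N : ℝ) - 1) ^ 2 / lapseFactor N η χ t)
      (fun t => t ^ (2 * (N - 1))) (1 / ((N : ℝ) - 2)) (-(((N : ℝ) - 3) / ((N : ℝ) - 2))) V h := by
  rw [expWarped_eq_splitMetric]
  unfold familyMetric
  congr 1
  · funext p; ring
  · funext p
    rw [show 2 * -(((N : ℝ) - 3) / ((N : ℝ) - 2)) = -2 * (((N : ℝ) - 3) / ((N : ℝ) - 2)) by ring]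

theorem inflatedMetric_eq_expWarped (ε α δ : ℝ) (μ : ℝ → ℝ) (V : (Fin (N - 1) → ℝ) → ℝ)
    (h : (Fin (N - 1) → ℝ) → Matrix (Fin (N - 1)) (Fin (N - 1)) ℝ) :
    inflatedMetric ε α δ μ V h = expWarped ε (fun y => Real.exp (2 * μ y))
      (fun y => Real.exp (2 * μ y)) α (-(α + δ)) V h := by
  rw [expWarped_eq_splitMetric]
  unfold inflatedMetric
  congr 1
  · funext p; ring
  · funext p
    rw [← Real.exp_add (-2 * α * V (xc p))]
    ring_nf

theorem familyField_eq (κ s : ℝ) (V : (Fin (N - 1) → ℝ) → ℝ) :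
    familyField κ s V = fun x : Idx N → ℝ => familySigma N κ s * V (xc x) +
      familySigma N κ s * (((N : ℝ) - 2) * Real.log (yc x)) := by
  funext x
  unfold familyField familySigma
  ring

theorem inflatedField_eq (hN : 3 ≤ N) (hκ : 0 < κ) (s : ℝ) (τ : ℝ → ℝ)
    (V : (Fin (N - 1) → ℝ) → ℝ) :
    inflatedField (familySigma N κ s) (familyRho N κ s) (fun y => ((N : ℝ) - 1) * Real.log (τ y))
        V = fun x : Idx N → ℝ => familySigma N κ s * V (xc x) +
      familySigma N κ s * (((N : ℝ) - 2) * Real.log (τ (yc x))) := by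
  have h3 := three_le_cast hN
  have h1 : (N : ℝ) - 1 ≠ 0 := by linarith
  funext x
  unfold inflatedField
  rw [familyRho_eq hN hκ]
  field_simp

theorem exp_two_mul_log (hN : 3 ≤ N) {t : ℝ} (ht : 0 < t) :
    Real.exp (2 * (((N : ℝ) - 1) * Real.log t)) = t ^ (2 * (N - 1)) := by
  rw [← cast_pred hN, ← mul_assoc]
  have : (2 : ℝ) * ((N - 1 : ℕ) : ℝ) = ((2 * (N - 1) : ℕ) : ℝ) := by push_cast; ring
  rw [this, ← Real.log_pow, Real.exp_log (pow_pos ht _)]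

theorem neg_alpha_add_delta (N : ℕ) :
    -(1 / ((N : ℝ) - 2) + ((N : ℝ) - 4) / ((N : ℝ) - 2)) = -(((N : ℝ) - 3) / ((N : ℝ) - 2)) := by
  rw [← add_div]; ring_nf

/-- The family metric, in a coordinate `τ = T(y)` with `(N-1)² T'² = (η - χ T^{-2(N-2)}) T^{2(N-1)}`,
is conformally inflated. -/
theorem pullback_familyMetric (hN : 3 ≤ N) {T : ℝ → ℝ} {T' : ℝ} {p : Idx N → ℝ} {μ : ℝ → ℝ}
    (hT : HasDerivAt T T' (yc p)) (hmem : T (yc p) ∈ tauDomain N η χ)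
    (hμ : μ (yc p) = ((N : ℝ) - 1) * Real.log (T (yc p)))
    (hT' : ((N : ℝ) - 1) ^ 2 * T' ^ 2 =
      lapseFactor N η χ (T (yc p)) * T (yc p) ^ (2 * (N - 1))) :
    pullbackMetric (changeTime T) (familyMetric ε η χ V h) p =
      inflatedMetric ε (1 / ((N : ℝ) - 2)) (((N : ℝ) - 4) / ((N : ℝ) - 2)) μ V h p := by
  rw [familyMetric_eq_expWarped, inflatedMetric_eq_expWarped, expWarped_eq_splitMetric,
    expWarped_eq_splitMetric, pullbackMetric_changeTime hT, neg_alpha_add_delta]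
  have hy : yc (changeTime T p) = T (yc p) := rfl
  have hx : xc (changeTime T p) = xc p := rfl
  have hl := hmem.2.ne'
  unfold splitMetric
  simp only [hμ, exp_two_mul_log hN hmem.1, hy, hx]
  congr 1
  ext i j
  simp only [Matrix.of_apply]
  have : T' ^ 2 * (((N : ℝ) - 1) ^ 2 / lapseFactor N η χ (T (yc p))) =
      T (yc p) ^ (2 * (N - 1)) := by
    rw [mul_div_assoc', mul_comm, hT', mul_div_cancel_left₀ _ hl]
  rw [← this]; ring

theorem IsVacuumSeed.family_isClassT (hS : IsVacuumSeed N ε Λ U V h) (hN : 3 ≤ N) (hκ : 0 < κ)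
    (hε : ε = 1 ∨ ε = -1) (hs : s = 1 ∨ s = -1) (hχ : χ ≠ 0) (hηχ : 0 < η ∨ χ < 0)
    (hΛ : Λ = -(ε / 2) * (((N : ℝ) - 2) ^ 3 / ((N : ℝ) - 1)) * χ) :
    (tauDomain N η χ).Nonempty ∧
      SolvesEinsteinScalar κ (familyPotential N κ ε s η) (familyMetric ε η χ V h)
        (familyField κ s V) (slab (tauDomain N η χ) U) ∧
      (familyW₀ N κ ε s η ≠ 0 ↔ η ≠ 0) ∧
      ∃ (I : Set ℝ) (T : ℝ → ℝ), ContDiffOn ℝ ∞ T I ∧ (∀ y ∈ I, 0 < deriv T y) ∧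
        Set.BijOn T I (tauDomain N η χ) ∧
        IsClassT N κ ε Λ U V h I (fun y => ((N : ℝ) - 1) * Real.log (T y))
          (1 / ((N : ℝ) - 2)) (((N : ℝ) - 4) / ((N : ℝ) - 2))
          (familySigma N κ s) (familyRho N κ s) (familyPotential N κ ε s η) ∧
        ∀ p ∈ slab (N := N) I U,
          pullbackMetric (changeTime T) (familyMetric ε η χ V h) p =
            inflatedMetric ε (1 / ((N : ℝ) - 2)) (((N : ℝ) - 4) / ((N : ℝ) - 2))
              (fun y => ((N : ℝ) - 1) * Real.log (T y)) V h p ∧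
          familyField κ s V (changeTime T p) =
            inflatedField (familySigma N κ s) (familyRho N κ s)
              (fun y => ((N : ℝ) - 1) * Real.log (T y)) V p := by
  have h3 := three_le_cast hN
  have h2 : (N : ℝ) - 2 ≠ 0 := by linarith
  have h1 : (0 : ℝ) < (N : ℝ) - 1 := by linarith
  have hD := isOpen_tauDomain N η χ
  have hne := nonempty_tauDomain hN hηχ
  -- This function is dy/dτ: with e^μ = τ^{N-1}, the relation e^{2μ}dy² = (N-1)² dτ²/ℓ gives dy/dτ =
  -- (N-1)/(√ℓ τ^{N-1}).
  have hF : ContDiffOn ℝ ∞ (fun t => ((N : ℝ) - 1) /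
      (Real.sqrt (lapseFactor N η χ t) * t ^ (N - 1))) (tauDomain N η χ) := by
    refine contDiffOn_const.div (ContDiffOn.mul (ContDiffOn.sqrt ((contDiffOn_lapseFactor N η χ).mono
      fun t ht => ht.1) fun t ht => ht.2.ne') (contDiffOn_id.pow _)) fun t ht => ?_
    exact mul_ne_zero (Real.sqrt_pos.2 ht.2).ne' (pow_ne_zero _ ht.1.ne')
  have hFpos : ∀ t ∈ tauDomain N η χ, 0 < ((N : ℝ) - 1) /
      (Real.sqrt (lapseFactor N η χ t) * t ^ (N - 1)) := fun t ht =>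
    div_pos h1 (mul_pos (Real.sqrt_pos.2 ht.2) (pow_pos ht.1 _))
  obtain ⟨I, T, hI, hIc, hTs, hbij, hTd⟩ :=
    exists_reparametrization hD (ordConnected_tauDomain N η χ) hne hF hFpos
  have hmem : ∀ y ∈ I, T y ∈ tauDomain N η χ := hbij.mapsTo
  have hpos : ∀ y ∈ I, 0 < deriv T y := fun y hy => by
    rw [(hTd y hy).deriv]; exact inv_pos.2 (hFpos _ (hmem y hy))
  have hsq : ∀ y ∈ I, ((N : ℝ) - 1) ^ 2 * deriv T y ^ 2 =
      lapseFactor N η χ (T y) * T y ^ (2 * (N - 1)) := fun y hy => by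
    rw [(hTd y hy).deriv, inv_div, div_pow, mul_pow, Real.sq_sqrt (hmem y hy).2.le, ← pow_mul,
      mul_comm (N - 1) 2]
    field_simp
  refine ⟨hne, ?_, familyW₀_ne_zero_iff hN hκ (sq_sign hε) hs, I, T, hTs, hpos, hbij, ?_, ?_⟩
  · rw [familyMetric_eq_expWarped, familyField_eq]
    exact hS.solves_family hN hκ hε hs hΛ hD contDiffOn_id (T := id) (fun y hy => hy) (by simp)
      (by simp) (by simp)
  · refine ⟨hS, ?_, hI, hIc, ?_, ?_, ?_⟩
    · rw [hΛ]
      refine mul_ne_zero (mul_ne_zero ?_ (div_ne_zero (pow_ne_zero _ h2) h1.ne')) hχ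
      rcases hε with rfl | rfl <;> norm_num
    · exact contDiffOn_const.mul (hTs.log fun y hy => (hmem y hy).1.ne')
    · obtain ⟨t, ht⟩ := hne
      -- A non-empty open set of reals has two points. T attains both, so ln T is not constant.
      obtain ⟨t', ht', htt⟩ : ∃ t' ∈ tauDomain N η χ, t' ≠ t := by
        obtain ⟨r, hr, hsub⟩ := Metric.isOpen_iff.1 hD t ht
        refine ⟨t + r / 2, hsub ?_, by linarith⟩
        rw [Metric.mem_ball, Real.dist_eq, add_sub_cancel_left, abs_of_pos (by linarith)]
        linarith
      obtain ⟨y, hy, rfl⟩ := hbij.surjOn ht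
      obtain ⟨y', hy', rfl⟩ := hbij.surjOn ht'
      refine ⟨y', hy', y, hy, fun e => htt ?_⟩
      exact Real.log_injOn_pos (hmem y' hy').1 (hmem y hy).1 (mul_left_cancel₀ h1.ne' e)
    · rw [inflatedMetric_eq_expWarped, inflatedField_eq hN hκ, neg_alpha_add_delta]
      refine hS.solves_family hN hκ hε hs hΛ hI hTs hmem (fun y hy => (hpos y hy).ne') ?_ ?_
      · intro y hy
        rw [exp_two_mul_log hN (hmem y hy).1, hsq y hy,
          mul_div_cancel_left₀ _ (hmem y hy).2.ne']
      · intro y hy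
        exact exp_two_mul_log hN (hmem y hy).1
  · intro p hp
    refine ⟨pullback_familyMetric hN (hTd _ hp.1).differentiableAt.hasDerivAt (hmem _ hp.1) rfl
      (hsq _ hp.1), ?_⟩
    rw [inflatedField_eq hN hκ, familyField_eq]
    rfl

end FamilyMembers

/-! ### Determination of the parameters of an inflated solution. -/

section Converse

variable {N : ℕ} {κ ε α δ σ ρ Λ : ℝ} {U : Set (Fin (N - 1) → ℝ)} {V : (Fin (N - 1) → ℝ) → ℝ}
  {h : (Fin (N - 1) → ℝ) → Matrix (Fin (N - 1)) (Fin (N - 1)) ℝ} {I : Set ℝ} {μ W : ℝ → ℝ}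

/-- If dV vanished throughout U, so would □V and |∇V|², and `box_eq` would force Λ e^{-2V} = 0. -/
theorem IsVacuumSeed.exists_pd_ne_zero (hS : IsVacuumSeed N ε Λ U V h) (hN : 3 ≤ N)
    (hε : ε * ε = 1) (hΛ : Λ ≠ 0) : ∃ x ∈ U, ∃ i, pd i V x ≠ 0 := by
  by_contra! hcon
  obtain ⟨x, hx⟩ := hS.nonempty
  have h3 := three_le_cast hN
  have h2 : (N : ℝ) - 2 ≠ 0 := by linarith
  have hh : ∀ i j, hessian h V x i j = 0 := fun i j => by
    unfold hessian
    rw [pd_congr_on hS.isOpen hx fun y hy => hcon y hy j, pd_const]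
    simp [hcon x hx]
  have hb := hS.box_eq hN hε hx
  have hG : gradSq h V x = 0 := by
    unfold gradSq; simp [hcon x hx]
  rw [hG] at hb
  unfold box at hb
  simp only [hh, mul_zero, Finset.sum_const_zero, zero_sub] at hb
  have : 2 * Λ / ((N : ℝ) - 2) * Real.exp (-2 * V x) ≠ 0 :=
    mul_ne_zero (div_ne_zero (mul_ne_zero two_ne_zero hΛ) h2) (Real.exp_pos _).ne'
  exact this (by linarith)

theorem IsMetricOn.eq_zero_of_smul_eq (hh : IsMetricOn h U) {x : Fin (N - 1) → ℝ} (hx : x ∈ U)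
    {A : ℝ} (hN : 3 ≤ N) (hA : ∀ i j, A * h x i j = 0) : A = 0 := by
  by_contra hne
  have : Nonempty (Fin (N - 1)) := ⟨⟨0, by omega⟩⟩
  refine hh.nondegenerate x hx ?_
  have : h x = 0 := by
    ext i j; exact (mul_eq_zero.1 (hA i j)).resolve_left hne
  rw [this, Matrix.det_zero]

/-- A metric in dimension at least two is not proportional to a tensor of rank one. -/
theorem IsMetricOn.eq_zero_of_rank_one (hh : IsMetricOn h U) {x : Fin (N - 1) → ℝ} (hx : x ∈ U)
    (hN : 3 ≤ N) {v : Fin (N - 1) → ℝ} {i₀ : Fin (N - 1)} (hv : v i₀ ≠ 0) {A B : ℝ}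
    (hAB : ∀ i j, B * (v i * v j) = A * h x i j) : B = 0 := by
  have hA : A = 0 := by
    by_contra hA
    obtain ⟨j, hj⟩ : ∃ j : Fin (N - 1), j ≠ i₀ := by
      have : Nontrivial (Fin (N - 1)) := Fin.nontrivial_iff_two_le.2 (by omega)
      exact exists_ne i₀
    -- The vector v_j e_{i₀} - v_{i₀} e_j is annihilated by v ⊗ v, hence by h if h were a multiple
    -- of v ⊗ v.
    refine hh.nondegenerate x hx (Matrix.exists_mulVec_eq_zero_iff.1
      ⟨(fun l => v j * (if l = i₀ then 1 else 0) - v i₀ * (if l = j then 1 else 0)), ?_, ?_⟩)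
    · intro h0
      have := congrFun h0 j
      simp [hj, hv] at this
    · ext i
      have e : ∀ l, h x i l = B / A * (v i * v l) := fun l => by
        rw [div_mul_eq_mul_div, hAB, mul_div_cancel_left₀ _ hA]
      simp only [Matrix.mulVec, dotProduct, e, mul_sub, mul_ite, mul_one, mul_zero,
        Finset.sum_sub_distrib, Finset.sum_ite_eq', Finset.mem_univ, if_true, Pi.zero_apply]
      ring
  have := hAB i₀ i₀
  rw [hA, zero_mul] at this
  exact (mul_eq_zero.1 this).resolve_right (mul_ne_zero hv hv)

theorem isWarp_inflated (hI : IsOpen I) (hμ : ContDiffOn ℝ ∞ μ I) :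
    IsWarp I (fun y => Real.exp (2 * μ y)) (fun y => Real.exp (2 * μ y)) (deriv μ) (deriv μ)
      (deriv (deriv μ)) := by
  have hμ1 := deriv_smooth hI hμ
  have d0 := fun y hy => (differentiableAt_of_contDiffOn (p := y) hI hμ hy).hasDerivAt
  have d1 := fun y hy => (differentiableAt_of_contDiffOn (p := y) hI hμ1 hy)
  have hs : ContDiffOn ℝ ∞ (fun y => Real.exp (2 * μ y)) I := (contDiffOn_const.mul hμ).exp
  have he : ∀ y ∈ I, HasDerivAt (fun y => Real.exp (2 * μ y))
      (2 * deriv μ y * Real.exp (2 * μ y)) y := fun y hy =>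
    (((d0 y hy).const_mul 2).exp).congr_deriv (by ring)
  exact ⟨hI, hs, hs, fun _ _ => (Real.exp_pos _).ne', fun _ _ => (Real.exp_pos _).ne', he, he, d1,
    fun y hy => (d1 y hy).hasDerivAt⟩

theorem IsClassT.exists_deriv_ne_zero (hT : IsClassT N κ ε Λ U V h I μ α δ σ ρ W) :
    ∃ y ∈ I, deriv μ y ≠ 0 := by
  by_contra! hcon
  obtain ⟨y₁, h₁, y₂, h₂, hne⟩ := hT.inflated
  exact hne (hT.isOpen.is_const_of_deriv_eq_zero hT.interval.isPreconnected
    (hT.smooth.differentiableOn (by simp)) hcon h₁ h₂)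

theorem card_idx (hN : 3 ≤ N) : (Fintype.card (Idx N) : ℝ) = N := by
  simp [Nat.cast_sub (show 1 ≤ N by omega)]

/-! ### The components of the Einstein equations of an inflated solution. -/

section Equations

variable {x : Fin (N - 1) → ℝ} {y : ℝ}

/-- Both warp functions are e^{2μ}, so m = q = μ' and the quadratic terms cancel in q' + q² - mq;
only μ'' remains. -/
theorem IsClassT.einstein_inl_inl (hT : IsClassT N κ ε Λ U V h I μ α δ σ ρ W) (hN : 3 ≤ N)
    (hε : ε * ε = 1) (hy : y ∈ I) (hx : x ∈ U) :
    -((N : ℝ) - 1) * deriv (deriv μ) y - ε * Real.exp (2 * (α + (α + δ)) * V x) *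
        (α * (((N : ℝ) - 4 + α - ((N : ℝ) - 3) * (α + δ)) * gradSq h V x -
          2 * Λ / ((N : ℝ) - 2) * Real.exp (-2 * V x))) =
      κ * (ρ ^ 2 * deriv μ y ^ 2 + 2 / ((N : ℝ) - 2) *
        (ε * (Real.exp (2 * μ y) * Real.exp (2 * α * V x)) * W (σ * V x + ρ * μ y))) := by
  have hp : (Sum.elim (fun _ => y) x : Idx N → ℝ) ∈ slab (N := N) I U := ⟨hy, hx⟩
  have hyc : yc (Sum.elim (fun _ => y) x : Idx N → ℝ) = y := rfl
  have hxc : xc (Sum.elim (fun _ => y) x : Idx N → ℝ) = x := rfl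
  have hd := (differentiableAt_of_contDiffOn hT.isOpen hT.smooth hy).hasDerivAt
  have h1 := hT.solves.einstein _ hp (Sum.inl ()) (Sum.inl ())
  have h2 : pd (Sum.inl ()) (inflatedField σ ρ μ V) (Sum.elim (fun _ => y) x : Idx N → ℝ) =
      ρ * deriv μ y :=
    pd_inl_field (f := fun y => ρ * μ y) hT.seed.isOpen hT.seed.smooth hp.2 (hd.const_mul ρ) ()
  rw [inflatedMetric_eq_expWarped, hT.seed.ricci_inl_inl hN hε
    (isWarp_inflated hT.isOpen hT.smooth) hp, h2, card_idx hN, expWarped_eq_splitMetric] at h1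
  simp only [splitMetric, Matrix.fromBlocks_apply₁₁, Matrix.of_apply, hyc, hxc, inflatedField,
    div_self (Real.exp_pos (2 * μ y)).ne', sub_neg_eq_add] at h1
  linear_combination h1

theorem IsClassT.einstein_inl_inr (hT : IsClassT N κ ε Λ U V h I μ α δ σ ρ W) (hN : 3 ≤ N)
    (hε : ε * ε = 1) (hy : y ∈ I) (hx : x ∈ U) (i : Fin (N - 1)) :
    ((N : ℝ) - 2) * (deriv μ y * (α * pd i V x)) = κ * (ρ * deriv μ y * (σ * pd i V x)) := by
  have hp : (Sum.elim (fun _ => y) x : Idx N → ℝ) ∈ slab (N := N) I U := ⟨hy, hx⟩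
  have hyc : yc (Sum.elim (fun _ => y) x : Idx N → ℝ) = y := rfl
  have hxc : xc (Sum.elim (fun _ => y) x : Idx N → ℝ) = x := rfl
  have hd := (differentiableAt_of_contDiffOn hT.isOpen hT.smooth hy).hasDerivAt
  have h1 := hT.solves.einstein _ hp (Sum.inl ()) (Sum.inr i)
  have h2 : pd (Sum.inl ()) (inflatedField σ ρ μ V) (Sum.elim (fun _ => y) x : Idx N → ℝ) =
      ρ * deriv μ y :=
    pd_inl_field (f := fun y => ρ * μ y) hT.seed.isOpen hT.seed.smooth hp.2 (hd.const_mul ρ) ()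
  have h3 : pd (Sum.inr i) (inflatedField σ ρ μ V) (Sum.elim (fun _ => y) x : Idx N → ℝ) =
      σ * pd i V x :=
    pd_inr_field (f := fun y => ρ * μ y) hT.seed.isOpen hT.seed.smooth hp.2
      (hd.const_mul ρ).differentiableAt i
  rw [inflatedMetric_eq_expWarped, ricci_expWarped_inl_inr hε
    (isWarp_inflated hT.isOpen hT.smooth) hT.seed.isOpen hT.seed.smooth hT.seed.metric hp, h2, h3,
    card_idx hN, cast_pred hN, expWarped_eq_splitMetric] at h1
  simp only [splitMetric, Matrix.fromBlocks_apply₁₂, Matrix.zero_apply, hyc, hxc] at h1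
  linear_combination h1

theorem IsClassT.einstein_inr_inr (hT : IsClassT N κ ε Λ U V h I μ α δ σ ρ W) (hN : 3 ≤ N)
    (hε : ε * ε = 1) (hy : y ∈ I) (hx : x ∈ U) (i j : Fin (N - 1)) :
    -((N : ℝ) - 4 + α - ((N : ℝ) - 3) * (α + δ)) * hessian h V x i j +
        (((N : ℝ) - 3) * (α + δ) ^ 2 - α ^ 2 - 2 * α * (α + δ) - ((N : ℝ) - 6) - κ * σ ^ 2) *
          (pd i V x * pd j V x) +
        (4 * Λ / ((N : ℝ) - 2) * Real.exp (-2 * V x) +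
          (α + δ) * (((N : ℝ) - 4 + α - ((N : ℝ) - 3) * (α + δ)) * gradSq h V x -
            2 * Λ / ((N : ℝ) - 2) * Real.exp (-2 * V x)) -
          ε * Real.exp (-2 * (α + (α + δ)) * V x) *
            (deriv (deriv μ) y + ((N : ℝ) - 2) * deriv μ y ^ 2) -
          κ * (2 / ((N : ℝ) - 2) * (Real.exp (2 * μ y) * Real.exp (-2 * (α + δ) * V x)) *
            W (σ * V x + ρ * μ y))) * h x i j = 0 := by
  have hp : (Sum.elim (fun _ => y) x : Idx N → ℝ) ∈ slab (N := N) I U := ⟨hy, hx⟩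
  have hyc : yc (Sum.elim (fun _ => y) x : Idx N → ℝ) = y := rfl
  have hxc : xc (Sum.elim (fun _ => y) x : Idx N → ℝ) = x := rfl
  have hd := (differentiableAt_of_contDiffOn hT.isOpen hT.smooth hy).hasDerivAt
  have h1 := hT.solves.einstein _ hp (Sum.inr i) (Sum.inr j)
  have h3 : ∀ i, pd (Sum.inr i) (inflatedField σ ρ μ V) (Sum.elim (fun _ => y) x : Idx N → ℝ) =
      σ * pd i V x := fun i =>
    pd_inr_field (f := fun y => ρ * μ y) hT.seed.isOpen hT.seed.smooth hp.2
      (hd.const_mul ρ).differentiableAt i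
  rw [inflatedMetric_eq_expWarped, hT.seed.ricci_inr_inr hN hε
    (isWarp_inflated hT.isOpen hT.smooth) hp, h3, h3, card_idx hN, expWarped_eq_splitMetric] at h1
  simp only [splitMetric, Matrix.fromBlocks_apply₂₂, Matrix.smul_apply, smul_eq_mul, hyc, hxc,
    inflatedField, div_self (Real.exp_pos (2 * μ y)).ne'] at h1
  rw [show 2 * (-(α + δ) - α) * V x = -2 * (α + (α + δ)) * V x by ring,
    show 2 * -(α + δ) * V x = -2 * (α + δ) * V x by ring] at h1
  linear_combination h1

end Equations

/-- The parameters of a solution of the class. -/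
theorem IsClassT.reduced (hT : IsClassT N κ ε Λ U V h I μ α δ σ ρ W) (hN : 3 ≤ N) (hκ : 0 < κ)
    (hε : ε * ε = 1)
    (hdeg : ((N : ℝ) - 3) * δ = ((N : ℝ) - 4) * (1 - α) ∨ ¬ HasDegenerateHessian U V h) :
    α = 1 / ((N : ℝ) - 2) ∧ δ = ((N : ℝ) - 4) / ((N : ℝ) - 2) ∧
      κ * σ ^ 2 = ((N : ℝ) - 1) / ((N : ℝ) - 2) ∧ κ * σ * ρ = 1 ∧
      (∀ y ∈ I, deriv (deriv μ) y = ((N : ℝ) - 2) / ((N : ℝ) - 1) * deriv μ y ^ 2 -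
        2 * ε * Λ / ((N : ℝ) - 2) ^ 2) ∧
      ∀ y ∈ I, ∀ x ∈ U, κ * (2 / ((N : ℝ) - 2) * (Real.exp (2 * μ y) *
          Real.exp (-2 * (((N : ℝ) - 3) / ((N : ℝ) - 2)) * V x)) * W (σ * V x + ρ * μ y)) =
        Real.exp (-2 * V x) * (2 * Λ * ((N : ℝ) - 1) / ((N : ℝ) - 2) ^ 2 -
          ε * (deriv (deriv μ) y + ((N : ℝ) - 2) * deriv μ y ^ 2)) := by
  have h3 := three_le_cast hN
  have h2 : (N : ℝ) - 2 ≠ 0 := by linarith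
  have h1 : (N : ℝ) - 1 ≠ 0 := by linarith
  have hε0 : ε ≠ 0 := by rintro rfl; simp at hε
  obtain ⟨y₀, hy₀, hμ₀⟩ := hT.exists_deriv_ne_zero
  obtain ⟨x₀, hx₀, i₀, hi₀⟩ := hT.seed.exists_pd_ne_zero hN hε hT.cosmological
  -- A collects the coefficient of h in the spatial equation. The name is opaque, so that the
  -- equation reads as a linear relation between the Hessian, ∂V∂V and h.
  obtain ⟨A, hA⟩ : ∃ A : (Fin (N - 1) → ℝ) → ℝ → ℝ, ∀ x y, A x y =
      4 * Λ / ((N : ℝ) - 2) * Real.exp (-2 * V x) +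
          (α + δ) * (((N : ℝ) - 4 + α - ((N : ℝ) - 3) * (α + δ)) * gradSq h V x -
            2 * Λ / ((N : ℝ) - 2) * Real.exp (-2 * V x)) -
          ε * Real.exp (-2 * (α + (α + δ)) * V x) *
            (deriv (deriv μ) y + ((N : ℝ) - 2) * deriv μ y ^ 2) -
          κ * (2 / ((N : ℝ) - 2) * (Real.exp (2 * μ y) * Real.exp (-2 * (α + δ) * V x)) *
            W (σ * V x + ρ * μ y)) := ⟨fun _ _ => _, fun _ _ => rfl⟩
  have hE : ∀ x ∈ U, ∀ y ∈ I, ∀ i j,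
      -((N : ℝ) - 4 + α - ((N : ℝ) - 3) * (α + δ)) * hessian h V x i j +
        (((N : ℝ) - 3) * (α + δ) ^ 2 - α ^ 2 - 2 * α * (α + δ) - ((N : ℝ) - 6) - κ * σ ^ 2) *
          (pd i V x * pd j V x) + A x y * h x i j = 0 := fun x hx y hy i j => by
    rw [hA]; exact hT.einstein_inr_inr hN hε hy hx i j
  -- The first alternative is this equation. Otherwise division by a nonzero value solves for the
  -- Hessian and contradicts non-degeneracy; b is constant since it involves parameters only, and c
  -- is read off at the fixed y₀.
  have c0 : (N : ℝ) - 4 + α - ((N : ℝ) - 3) * (α + δ) = 0 := by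
    rcases hdeg with hdeg | hdeg
    · linear_combination -hdeg
    · by_contra hc
      refine hdeg ⟨(((N : ℝ) - 3) * (α + δ) ^ 2 - α ^ 2 - 2 * α * (α + δ) - ((N : ℝ) - 6) -
        κ * σ ^ 2) / ((N : ℝ) - 4 + α - ((N : ℝ) - 3) * (α + δ)),
        fun x => A x y₀ / ((N : ℝ) - 4 + α - ((N : ℝ) - 3) * (α + δ)), fun x hx i j => ?_⟩
      have := hE x hx y₀ hy₀ i j
      generalize (N : ℝ) - 4 + α - ((N : ℝ) - 3) * (α + δ) = c at *
      field_simp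
      linear_combination -this
  -- With the Hessian gone, a multiple of ∂V∂V is a multiple of h. Where dV ≠ 0 this forces its
  -- coefficient to vanish, because h is nondegenerate in dimension at least two.
  have c1 : ((N : ℝ) - 3) * (α + δ) ^ 2 - α ^ 2 - 2 * α * (α + δ) - ((N : ℝ) - 6) =
      κ * σ ^ 2 := by
    rw [← sub_eq_zero]
    refine hT.seed.metric.eq_zero_of_rank_one hx₀ hN (v := fun i => pd i V x₀) hi₀
      (A := -A x₀ y₀) fun i j => ?_
    have := hE x₀ hx₀ y₀ hy₀ i j
    rw [c0] at this
    linear_combination this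
  have hA0 : ∀ x ∈ U, ∀ y ∈ I, A x y = 0 := fun x hx y hy =>
    hT.seed.metric.eq_zero_of_smul_eq hx hN fun i j => by
      have := hE x hx y hy i j
      rw [c0, c1] at this
      linear_combination this
  have c2 : ((N : ℝ) - 2) * α = κ * σ * ρ := by
    have := hT.einstein_inl_inr hN hε hy₀ hx₀ i₀
    apply mul_left_cancel₀ (mul_ne_zero hμ₀ hi₀)
    linear_combination this
  -- W is eliminated between `A = 0` and the yy equation. The result separates the variables: a
  -- function of y times a power of e^V is constant.
  have key : ∀ x ∈ U, ∀ y ∈ I, (((N : ℝ) - 2) * (deriv (deriv μ) y - deriv μ y ^ 2) +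
      κ * ρ ^ 2 * deriv μ y ^ 2) * Real.exp ((2 - 2 * (α + (α + δ))) * V x) =
      -ε * (4 - 2 * (α + (α + δ))) * Λ / ((N : ℝ) - 2) := fun x hx y hy => by
    have e1 := hA0 x hx y hy
    have e2 := hT.einstein_inl_inl hN hε hy hx
    rw [hA, c0] at e1
    rw [c0] at e2
    have x1 : Real.exp (2 * (α + (α + δ)) * V x) * Real.exp ((2 - 2 * (α + (α + δ))) * V x) *
        Real.exp (-2 * V x) = 1 := by
      rw [← Real.exp_add, ← Real.exp_add]; simp; ring
    have x2 : Real.exp (-2 * (α + (α + δ)) * V x) =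
      Real.exp ((2 - 2 * (α + (α + δ))) * V x) * Real.exp (-2 * V x) := by
      rw [← Real.exp_add]; ring_nf
    have x3 : Real.exp (-2 * (α + δ) * V x) = Real.exp (2 * α * V x) *
        (Real.exp ((2 - 2 * (α + (α + δ))) * V x) * Real.exp (-2 * V x)) := by
      rw [← Real.exp_add, ← Real.exp_add]; ring_nf
    rw [x2, x3] at e1
    generalize Real.exp ((2 - 2 * (α + (α + δ))) * V x) = E at *
    generalize Real.exp (2 * (α + (α + δ)) * V x) = F at *
    have hz : Real.exp (-2 * V x) ≠ 0 := (Real.exp_pos _).ne'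
    generalize Real.exp (-2 * V x) = z at *
    apply mul_left_cancel₀ hz
    rcases mul_self_eq_one_iff.1 hε with rfl | rfl
    · linear_combination e1 - E * z * e2 + α * (2 * Λ / ((N : ℝ) - 2)) * z * x1
    · linear_combination -e1 - E * z * e2 - α * (2 * Λ / ((N : ℝ) - 2)) * z * x1
  -- If the exponent were nonzero, differentiating `key` where dV ≠ 0 would make the y-factor
  -- vanish. Then the constant vanishes too, so 2α+δ = 2; with `c0` this gives α = 1, then `c1`
  -- gives σ = 0, and `c2` fails.
  have c3 : α + (α + δ) = 1 := by
    by_contra hg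
    have hVd := differentiableAt_of_contDiffOn hT.seed.isOpen hT.seed.smooth hx₀
    have hB : ((N : ℝ) - 2) * (deriv (deriv μ) y₀ - deriv μ y₀ ^ 2) +
        κ * ρ ^ 2 * deriv μ y₀ ^ 2 = 0 := by
      have e := pd_congr_on (i := i₀) hT.seed.isOpen hx₀ fun x hx => key x hx y₀ hy₀
      rw [pd_const, pd_const_mul _ (hVd.const_mul _).exp, pd_exp_mul hVd] at e
      refine (mul_eq_zero.1 e).resolve_right
        (mul_ne_zero (mul_ne_zero ?_ hi₀) (Real.exp_pos _).ne')
      exact fun h0 => hg (by linarith)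
    have k0 := key x₀ hx₀ y₀ hy₀
    rw [hB, zero_mul, eq_comm, div_eq_zero_iff] at k0
    have k1 := ((mul_eq_zero.1 (k0.resolve_right h2)).resolve_right hT.cosmological)
    have k2 := (mul_eq_zero.1 k1).resolve_left (neg_ne_zero.2 hε0)
    have g1 : α + δ = 1 := by
      apply mul_left_cancel₀ h2
      linear_combination -c0 - k2 / 2
    have g2 : α = 1 := by linarith
    rw [g1, g2] at c1
    have g3 : σ = 0 := by
      have : κ * σ ^ 2 = 0 := by rw [← c1]; ring
      simpa [hκ.ne'] using this
    rw [g2, g3] at c2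
    exact h2 (by linear_combination c2)
  have hα : α = 1 / ((N : ℝ) - 2) := by
    rw [eq_div_iff h2]; linear_combination c0 + ((N : ℝ) - 3) * c3
  have hδ : δ = ((N : ℝ) - 4) / ((N : ℝ) - 2) := by
    have : δ = 1 - 2 * α := by linarith
    rw [this, hα]; field_simp; ring
  have hσ : κ * σ ^ 2 = ((N : ℝ) - 1) / ((N : ℝ) - 2) := by
    rw [← c1, hα, hδ]; field_simp; ring
  have hσρ : κ * σ * ρ = 1 := by
    rw [← c2, hα]; field_simp
  -- This follows from (κσρ)² = 1 and the value of κσ².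
  have hρ : κ * ρ ^ 2 = ((N : ℝ) - 2) / ((N : ℝ) - 1) := by
    have : κ * σ ^ 2 * (κ * ρ ^ 2) = 1 := by
      linear_combination (κ * σ * ρ + 1) * hσρ
    rw [hσ] at this
    rw [eq_div_iff h1]
    field_simp at this
    linear_combination this
  refine ⟨hα, hδ, hσ, hσρ, fun y hy => ?_, fun y hy x hx => ?_⟩
  · have := key x₀ hx₀ y hy
    rw [c3, hρ] at this
    have ex : Real.exp ((2 - 2 * 1) * V x₀) = 1 := by norm_num
    rw [ex] at this
    field_simp at this ⊢
    linear_combination this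
  · have := hA0 x hx y hy
    rw [hA, c0, c3] at this
    have e : α + δ = ((N : ℝ) - 3) / ((N : ℝ) - 2) := by
      rw [hα, hδ, ← add_div]; ring_nf
    rw [e] at this
    rw [mul_one] at this
    have e2 : 4 * Λ / ((N : ℝ) - 2) - 2 * Λ / ((N : ℝ) - 2) * (((N : ℝ) - 3) / ((N : ℝ) - 2)) =
      2 * Λ * ((N : ℝ) - 1) / ((N : ℝ) - 2) ^ 2 := by field_simp; ring
    rw [← e2]
    linear_combination -this

end Converse

/-! ### Integrating the equation for μ and identifying the family. -/

section ConverseFamily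

variable {N : ℕ} {κ ε α δ σ ρ Λ η χ s : ℝ} {U : Set (Fin (N - 1) → ℝ)}
  {V : (Fin (N - 1) → ℝ) → ℝ} {h : (Fin (N - 1) → ℝ) → Matrix (Fin (N - 1)) (Fin (N - 1)) ℝ}
  {I : Set ℝ} {μ W : ℝ → ℝ}

theorem exists_sign (hN : 3 ≤ N) (hκ : 0 < κ)
    (hσ : κ * σ ^ 2 = ((N : ℝ) - 1) / ((N : ℝ) - 2)) :
    ∃ s : ℝ, (s = 1 ∨ s = -1) ∧ σ = familySigma N κ s := by
  have h3 := three_le_cast hN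
  have h2 : (N : ℝ) - 2 ≠ 0 := by linarith
  have e : σ ^ 2 = Real.sqrt (((N : ℝ) - 1) / (κ * ((N : ℝ) - 2))) ^ 2 := by
    rw [Real.sq_sqrt (div_nonneg (by linarith) (mul_nonneg hκ.le (by linarith)))]
    apply mul_left_cancel₀ hκ.ne'
    rw [hσ]; field_simp
  unfold familySigma
  rcases sq_eq_sq_iff_eq_or_eq_neg.1 e with e | e
  · exact ⟨1, Or.inl rfl, by rw [e, one_mul]⟩
  · exact ⟨-1, Or.inr rfl, by rw [e]; ring⟩

theorem familySigma_injective (hN : 3 ≤ N) (hκ : 0 < κ) {s s' : ℝ}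
    (h : familySigma N κ s = familySigma N κ s') : s = s' := by
  have h3 := three_le_cast hN
  exact mul_right_cancel₀ (Real.sqrt_pos.2 (div_pos (by linarith)
    (mul_pos hκ (by linarith)))).ne' h

theorem familySigma_ne_zero (hN : 3 ≤ N) (hκ : 0 < κ) (hs : s = 1 ∨ s = -1) :
    familySigma N κ s ≠ 0 := by
  have h3 := three_le_cast hN
  intro h0
  have := familySigma_sq hN hκ hs
  rw [h0] at this
  have h4 : 0 < ((N : ℝ) - 1) / ((N : ℝ) - 2) := div_pos (by linarith) (by linarith)
  rw [← this] at h4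
  simp at h4

/-- A first integral of `μ'' = (N-2) / (N-1) (μ'² + χ)`. -/
theorem exists_first_integral (hN : 3 ≤ N) (hI : IsOpen I) (hIc : I.OrdConnected)
    (hμ : ContDiffOn ℝ ∞ μ I)
    (hode : ∀ y ∈ I, deriv (deriv μ) y = ((N : ℝ) - 2) / ((N : ℝ) - 1) * (deriv μ y ^ 2 + χ)) :
    ∃ η : ℝ, ∀ y ∈ I, deriv μ y ^ 2 + χ =
      η * Real.exp (μ y / ((N : ℝ) - 1)) ^ (2 * (N - 2)) := by
  have h3 := three_le_cast hN
  have h1 : (N : ℝ) - 1 ≠ 0 := by linarith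
  have d0 := fun y hy => (differentiableAt_of_contDiffOn (p := y) hI hμ hy).hasDerivAt
  have d1 := fun y hy =>
    (differentiableAt_of_contDiffOn (p := y) hI (deriv_smooth hI hμ) hy).hasDerivAt
  -- The exponential is an integrating factor: the equation gives (μ'² + χ)' = 2(N-2)/(N-1) μ' (μ'²
  -- + χ).
  have hd : ∀ y ∈ I, HasDerivAt (fun y => (deriv μ y ^ 2 + χ) *
      Real.exp (-(2 * ((N : ℝ) - 2) / ((N : ℝ) - 1)) * μ y)) 0 y := fun y hy => by
    refine ((((d1 y hy).fun_pow 2).add_const χ).fun_mul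
      (((d0 y hy).const_mul (-(2 * ((N : ℝ) - 2) / ((N : ℝ) - 1)))).exp)).congr_deriv ?_
    rw [hode y hy]
    push_cast
    ring
  obtain ⟨η, hη⟩ := hI.exists_is_const_of_deriv_eq_zero hIc.isPreconnected
    (fun y hy => (hd y hy).differentiableAt.differentiableWithinAt) fun y hy => (hd y hy).deriv
  refine ⟨η, fun y hy => ?_⟩
  have hc : ((2 * (N - 2) : ℕ) : ℝ) = 2 * ((N : ℝ) - 2) := by
    rw [Nat.cast_mul, Nat.cast_sub (by omega)]; norm_num
  rw [← hη y hy, ← Real.exp_nat_mul, hc, mul_assoc, ← Real.exp_add]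
  rw [show -(2 * ((N : ℝ) - 2) / ((N : ℝ) - 1)) * μ y + 2 * ((N : ℝ) - 2) *
    (μ y / ((N : ℝ) - 1)) = 0 by ring, Real.exp_zero, mul_one]

/-- The derivative of μ' e^{-(N-2)μ/(N-1)} is a nonzero multiple of χ e^{-(N-2)μ/(N-1)}, so it never
vanishes. By Rolle's theorem μ' has at most one zero. -/
theorem subsingleton_critical (hN : 3 ≤ N) (hI : IsOpen I) (hIc : I.OrdConnected)
    (hμ : ContDiffOn ℝ ∞ μ I) (hχ : χ ≠ 0)
    (hode : ∀ y ∈ I, deriv (deriv μ) y = ((N : ℝ) - 2) / ((N : ℝ) - 1) * (deriv μ y ^ 2 + χ)) :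
    {y ∈ I | deriv μ y = 0}.Subsingleton := by
  have h3 := three_le_cast hN
  have h1 : (N : ℝ) - 1 ≠ 0 := by linarith
  have h2 : (N : ℝ) - 2 ≠ 0 := by linarith
  have d0 := fun y hy => (differentiableAt_of_contDiffOn (p := y) hI hμ hy).hasDerivAt
  have d1 := fun y hy =>
    (differentiableAt_of_contDiffOn (p := y) hI (deriv_smooth hI hμ) hy).hasDerivAt
  have hd : ∀ y ∈ I, HasDerivAt (fun y => deriv μ y *
      Real.exp (-(((N : ℝ) - 2) / ((N : ℝ) - 1)) * μ y))
      (((N : ℝ) - 2) / ((N : ℝ) - 1) * χ *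
        Real.exp (-(((N : ℝ) - 2) / ((N : ℝ) - 1)) * μ y)) y := fun y hy => by
    refine ((d1 y hy).fun_mul
      (((d0 y hy).const_mul (-(((N : ℝ) - 2) / ((N : ℝ) - 1)))).exp)).congr_deriv ?_
    rw [hode y hy]
    ring
  have main : ∀ a b, a ∈ I → b ∈ I → deriv μ a = 0 → deriv μ b = 0 → ¬ a < b := by
    intro a b ha hb ha0 hb0 hab
    have hsub : Set.Icc a b ⊆ I := hIc.out ha hb
    obtain ⟨c, hc, hc0⟩ := exists_hasDerivAt_eq_zero hab
      (fun y hy => (hd y (hsub hy)).continuousAt.continuousWithinAt) (by simp [ha0, hb0])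
      fun y hy => hd y (hsub (Set.Ioo_subset_Icc_self hy))
    exact mul_ne_zero (mul_ne_zero (div_ne_zero h2 h1) hχ) (Real.exp_pos _).ne' hc0
  rintro a ⟨ha, ha0⟩ b ⟨hb, hb0⟩
  exact le_antisymm (not_lt.1 (main b a hb ha hb0 ha0)) (not_lt.1 (main a b ha hb ha0 hb0))

/-- A class member whose potential does not vanish identically belongs to the family. -/
theorem IsClassT.existsUnique_family (hT : IsClassT N κ ε Λ U V h I μ α δ σ ρ W) (hN : 3 ≤ N)
    (hκ : 0 < κ) (hε : ε = 1 ∨ ε = -1)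
    (hW : ∃ p ∈ slab (N := N) I U, W (inflatedField σ ρ μ V p) ≠ 0)
    (hdeg : ((N : ℝ) - 3) * δ = ((N : ℝ) - 4) * (1 - α) ∨ ¬ HasDegenerateHessian U V h) :
    ∃! ηχ : ℝ × ℝ, ηχ.1 ≠ 0 ∧ ηχ.2 ≠ 0 ∧ (0 < ηχ.1 ∨ ηχ.2 < 0) ∧
      Λ = -(ε / 2) * (((N : ℝ) - 2) ^ 3 / ((N : ℝ) - 1)) * ηχ.2 ∧
      α = 1 / ((N : ℝ) - 2) ∧ δ = ((N : ℝ) - 4) / ((N : ℝ) - 2) ∧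
      ∃ s : ℝ, (s = 1 ∨ s = -1) ∧ σ = familySigma N κ s ∧ ρ = familyRho N κ s ∧
        {y ∈ I | deriv μ y = 0}.Subsingleton ∧
        (∀ y ∈ I, deriv μ y ≠ 0 →
          Real.exp (μ y / ((N : ℝ) - 1)) ∈ tauDomain N ηχ.1 ηχ.2) ∧
        (∀ p ∈ slab (N := N) {y ∈ I | deriv μ y ≠ 0} U,
          pullbackMetric (changeTime fun y => Real.exp (μ y / ((N : ℝ) - 1)))
            (familyMetric ε ηχ.1 ηχ.2 V h) p = inflatedMetric ε α δ μ V h p) ∧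
        ∀ p ∈ slab (N := N) I U,
          inflatedField σ ρ μ V p =
            familyField κ s V (changeTime (fun y => Real.exp (μ y / ((N : ℝ) - 1))) p) ∧
          W (inflatedField σ ρ μ V p) =
            familyPotential N κ ε s ηχ.1 (inflatedField σ ρ μ V p) := by
  have h3 := three_le_cast hN
  have h2 : (N : ℝ) - 2 ≠ 0 := by linarith
  have h1 : (N : ℝ) - 1 ≠ 0 := by linarith
  have hεε := sq_sign hε
  have hε0 : ε ≠ 0 := by rintro rfl; simp at hεε
  obtain ⟨hα, hδ, hσ, hσρ, hode, hpot⟩ := hT.reduced hN hκ hεε hdeg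
  obtain ⟨s, hs, hσs⟩ := exists_sign hN hκ hσ
  have hρs : ρ = familyRho N κ s := by
    rw [familyRho_eq hN hκ, ← hσs]
    have hσ0 : σ ≠ 0 := hσs ▸ familySigma_ne_zero hN hκ hs
    apply mul_left_cancel₀ (mul_ne_zero hκ.ne' hσ0)
    rw [hσρ, ← mul_assoc, mul_assoc κ, ← sq, hσ]
    field_simp
  -- The relation between Λ and χ is inverted; in terms of χ the equation for μ takes the form
  -- required by `exists_first_integral`.
  obtain ⟨χ, hχ⟩ : ∃ χ : ℝ, Λ = -(ε / 2) * (((N : ℝ) - 2) ^ 3 / ((N : ℝ) - 1)) * χ := by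
    refine ⟨Λ / (-(ε / 2) * (((N : ℝ) - 2) ^ 3 / ((N : ℝ) - 1))), ?_⟩
    rw [mul_div_cancel₀]
    exact mul_ne_zero (neg_ne_zero.2 (div_ne_zero hε0 two_ne_zero))
      (div_ne_zero (pow_ne_zero _ h2) h1)
  have hχ0 : χ ≠ 0 := by
    rintro rfl; exact hT.cosmological (by rw [hχ, mul_zero])
  have hode' : ∀ y ∈ I, deriv (deriv μ) y =
      ((N : ℝ) - 2) / ((N : ℝ) - 1) * (deriv μ y ^ 2 + χ) := fun y hy => by
    rw [hode y hy, hχ]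
    rcases hε with rfl | rfl
    · field_simp; ring
    · field_simp; ring
  obtain ⟨η, hη⟩ := exists_first_integral hN hT.isOpen hT.interval hT.smooth hode'
  have hτ : ∀ y, 0 < Real.exp (μ y / ((N : ℝ) - 1)) := fun y => Real.exp_pos _
  have hlog : ∀ y, μ y = ((N : ℝ) - 1) * Real.log (Real.exp (μ y / ((N : ℝ) - 1))) := fun y => by
    rw [Real.log_exp]; field_simp
  -- The first integral rewritten for τ = e^{μ/(N-1)}. It puts τ in the domain wherever μ' ≠ 0, and
  -- later converts the metric.
  have hlapse : ∀ y ∈ I, lapseFactor N η χ (Real.exp (μ y / ((N : ℝ) - 1))) *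
      Real.exp (μ y / ((N : ℝ) - 1)) ^ (2 * (N - 2)) = deriv μ y ^ 2 := fun y hy => by
    unfold lapseFactor
    rw [sub_mul, mul_assoc, inv_mul_cancel₀ (pow_ne_zero _ (hτ y).ne'), ← hη y hy]
    ring
  have hmem : ∀ y ∈ I, deriv μ y ≠ 0 →
      Real.exp (μ y / ((N : ℝ) - 1)) ∈ tauDomain N η χ := fun y hy hy0 => by
    refine ⟨hτ y, pos_of_mul_pos_left ?_ (pow_pos (hτ y) (2 * (N - 2))).le⟩
    rw [hlapse y hy]; positivity
  have hfield : ∀ p : Idx N → ℝ, inflatedField σ ρ μ V p =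
      familySigma N κ s * V (xc p) + familySigma N κ s *
        (((N : ℝ) - 2) * Real.log (Real.exp (μ (yc p) / ((N : ℝ) - 1)))) := fun p => by
    unfold inflatedField
    rw [hσs, hρs, familyRho_eq hN hκ, Real.log_exp]
    ring
  -- The spatial equation determines W at each point. Inserting μ'² = η τ^{2(N-2)} - χ cancels the Λ
  -- terms and leaves W₀ τ^{-2} e^{-2V/(N-2)}, the value of the family potential.
  have hWf : ∀ p ∈ slab (N := N) I U, W (inflatedField σ ρ μ V p) =
      familyPotential N κ ε s η (inflatedField σ ρ μ V p) := fun p hp => by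
    rw [hfield p, familyPotential_apply hN hκ hs _ (hτ _), ← hfield p]
    have e := hpot _ hp.1 _ hp.2
    rw [hode' _ hp.1] at e
    have e1 : Real.exp (2 * μ (yc p)) = Real.exp (μ (yc p) / ((N : ℝ) - 1)) ^ (2 * (N - 2)) *
        Real.exp (μ (yc p) / ((N : ℝ) - 1)) ^ 2 := by
      rw [← pow_add, show 2 * (N - 2) + 2 = 2 * (N - 1) by omega,
        ← exp_two_mul_log hN (hτ _), ← hlog]
    have e2 : Real.exp (-2 * V (xc p)) = Real.exp (-2 * (((N : ℝ) - 3) / ((N : ℝ) - 2)) *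
        V (xc p)) * Real.exp (-2 * (1 / ((N : ℝ) - 2)) * V (xc p)) := by
      rw [← Real.exp_add]; congr 1; field_simp; ring
    have hη' := hη _ hp.1
    have hz := pow_ne_zero (2 * (N - 2)) (hτ (yc p)).ne'
    have ht := (hτ (yc p)).ne'
    rw [e1, e2] at e
    unfold inflatedField
    generalize Real.exp (μ (yc p) / ((N : ℝ) - 1)) = t at *
    generalize t ^ (2 * (N - 2)) = z at *
    have hE := (Real.exp_pos (-2 * (((N : ℝ) - 3) / ((N : ℝ) - 2)) * V (xc p))).ne'
    generalize Real.exp (-2 * (((N : ℝ) - 3) / ((N : ℝ) - 2)) * V (xc p)) = E at *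
    generalize Real.exp (-2 * (1 / ((N : ℝ) - 2)) * V (xc p)) = F at *
    generalize W (σ * V (xc p) + ρ * μ (yc p)) = w at *
    rw [familyW₀_eq hN hs]
    have hμ2 : deriv μ (yc p) ^ 2 = η * z - χ := by linarith
    rw [hμ2, hχ] at e
    apply mul_left_cancel₀ (mul_ne_zero (mul_ne_zero hκ.ne' hE) (mul_ne_zero hz (pow_ne_zero 2 ht)))
    field_simp at e ⊢
    apply mul_left_cancel₀ hz
    linear_combination e
  obtain ⟨p₀, hp₀, hW₀⟩ := hW
  have hη0 : η ≠ 0 := by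
    rintro rfl
    refine hW₀ ?_
    rw [hWf p₀ hp₀, familyPotential, familyW₀_eq hN hs]
    simp
  refine ⟨(η, χ), ⟨hη0, hχ0, ?_, hχ, hα, hδ, s, hs, hσs, hρs,
    subsingleton_critical hN hT.isOpen hT.interval hT.smooth hχ0 hode', hmem, ?_, ?_⟩, ?_⟩
  -- If χ > 0, then η τ^{2(N-2)} = μ'² + χ is positive, and so is η.
  · obtain ⟨y, hy, hy0⟩ := hT.exists_deriv_ne_zero
    rcases lt_or_gt_of_ne hχ0 with hχn | hχp
    · exact Or.inr hχn
    · refine Or.inl (pos_of_mul_pos_left ?_ (pow_pos (hτ y) (2 * (N - 2))).le)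
      rw [← hη y hy]
      have := sq_nonneg (deriv μ y)
      linarith
  · rintro p ⟨⟨hy, hy0⟩, hx⟩
    rw [hα, hδ]
    have hd := (differentiableAt_of_contDiffOn hT.isOpen hT.smooth hy).hasDerivAt
    refine pullback_familyMetric hN ((hd.div_const ((N : ℝ) - 1)).exp) (hmem _ hy hy0)
      (hlog _) ?_
    -- Since τ' = τ μ'/(N-1), one has (N-1)² τ'² = τ² μ'² = ℓ τ^{2(N-2)} τ².
    rw [show 2 * (N - 1) = 2 * (N - 2) + 2 by omega, pow_add, ← mul_assoc, hlapse _ hy]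
    field_simp
  · intro p hp
    refine ⟨?_, hWf p hp⟩
    rw [hfield, familyField_eq]
    rfl
  -- The sign s is fixed by σ and χ by Λ. Comparing the two expressions for W at p₀ cancels the
  -- common exponential and fixes W₀, which is a nonzero multiple of η.
  · rintro ⟨η', χ'⟩ ⟨-, -, -, hχ', -, -, s', hs', hσs', -, -, -, -, hall⟩
    have hss : s' = s := familySigma_injective hN hκ (hσs'.symm.trans hσs)
    subst hss
    have e1 : χ' = χ := by
      have := hχ'.symm.trans hχ
      refine mul_left_cancel₀ (mul_ne_zero (neg_ne_zero.2 (div_ne_zero hε0 two_ne_zero))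
        (div_ne_zero (pow_ne_zero _ h2) h1)) this
    have e2 : η' = η := by
      have := ((hall p₀ hp₀).2.symm.trans (hWf p₀ hp₀))
      unfold familyPotential at this
      have := mul_right_cancel₀ (Real.exp_pos _).ne' this
      rw [familyW₀_eq hN hs, familyW₀_eq hN hs] at this
      refine mul_left_cancel₀ (mul_ne_zero (neg_ne_zero.2 hε0) (div_ne_zero
        (mul_ne_zero (pow_ne_zero _ h2) (by linarith)) (mul_ne_zero (mul_ne_zero two_ne_zero
        hκ.ne') h1))) this
    rw [e1, e2]

end ConverseFamily

end EinsteinScalar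

theorem corollary6 (N : ℕ) (hN : 3 ≤ N) (κ : ℝ) (hκ : 0 < κ) (ε : ℝ) (hε : ε = 1 ∨ ε = -1)
    (Λ : ℝ) (U : Set (Fin (N - 1) → ℝ)) (V : (Fin (N - 1) → ℝ) → ℝ)
    (h : (Fin (N - 1) → ℝ) → Matrix (Fin (N - 1)) (Fin (N - 1)) ℝ) :
    -- every member of the family is a solution of the class
    (IsVacuumSeed N ε Λ U V h → ∀ η χ s : ℝ, (s = 1 ∨ s = -1) → χ ≠ 0 → (0 < η ∨ χ < 0) →
      Λ = -(ε / 2) * (((N : ℝ) - 2) ^ 3 / ((N : ℝ) - 1)) * χ →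
      (tauDomain N η χ).Nonempty ∧
      SolvesEinsteinScalar κ (familyPotential N κ ε s η) (familyMetric ε η χ V h)
        (familyField κ s V) (slab (tauDomain N η χ) U) ∧
      (familyW₀ N κ ε s η ≠ 0 ↔ η ≠ 0) ∧
      ∃ (I : Set ℝ) (T : ℝ → ℝ), ContDiffOn ℝ ∞ T I ∧ (∀ y ∈ I, 0 < deriv T y) ∧
        Set.BijOn T I (tauDomain N η χ) ∧
        IsClassT N κ ε Λ U V h I (fun y => ((N : ℝ) - 1) * Real.log (T y))
          (1 / ((N : ℝ) - 2)) (((N : ℝ) - 4) / ((N : ℝ) - 2))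
          (familySigma N κ s) (familyRho N κ s) (familyPotential N κ ε s η) ∧
        ∀ p ∈ slab (N := N) I U,
          pullbackMetric (changeTime T) (familyMetric ε η χ V h) p =
            inflatedMetric ε (1 / ((N : ℝ) - 2)) (((N : ℝ) - 4) / ((N : ℝ) - 2))
              (fun y => ((N : ℝ) - 1) * Real.log (T y)) V h p ∧
          familyField κ s V (changeTime T p) =
            inflatedField (familySigma N κ s) (familyRho N κ s)
              (fun y => ((N : ℝ) - 1) * Real.log (T y)) V p) ∧
    -- every solution of the class with non-vanishing potential belongs to the family
    (∀ (I : Set ℝ) (μ : ℝ → ℝ) (α δ σ ρ : ℝ) (W : ℝ → ℝ),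
      IsClassT N κ ε Λ U V h I μ α δ σ ρ W →
      (∃ p ∈ slab (N := N) I U, W (inflatedField σ ρ μ V p) ≠ 0) →
      (((N : ℝ) - 3) * δ = ((N : ℝ) - 4) * (1 - α) ∨ ¬ HasDegenerateHessian U V h) →
      ∃! ηχ : ℝ × ℝ, ηχ.1 ≠ 0 ∧ ηχ.2 ≠ 0 ∧ (0 < ηχ.1 ∨ ηχ.2 < 0) ∧
        Λ = -(ε / 2) * (((N : ℝ) - 2) ^ 3 / ((N : ℝ) - 1)) * ηχ.2 ∧
        α = 1 / ((N : ℝ) - 2) ∧ δ = ((N : ℝ) - 4) / ((N : ℝ) - 2) ∧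
        ∃ s : ℝ, (s = 1 ∨ s = -1) ∧ σ = familySigma N κ s ∧ ρ = familyRho N κ s ∧
          {y ∈ I | deriv μ y = 0}.Subsingleton ∧
          (∀ y ∈ I, deriv μ y ≠ 0 →
            Real.exp (μ y / ((N : ℝ) - 1)) ∈ tauDomain N ηχ.1 ηχ.2) ∧
          (∀ p ∈ slab (N := N) {y ∈ I | deriv μ y ≠ 0} U,
            pullbackMetric (changeTime fun y => Real.exp (μ y / ((N : ℝ) - 1)))
              (familyMetric ε ηχ.1 ηχ.2 V h) p = inflatedMetric ε α δ μ V h p) ∧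
          ∀ p ∈ slab (N := N) I U,
            inflatedField σ ρ μ V p =
              familyField κ s V (changeTime (fun y => Real.exp (μ y / ((N : ℝ) - 1))) p) ∧
            W (inflatedField σ ρ μ V p) =
              familyPotential N κ ε s ηχ.1 (inflatedField σ ρ μ V p)) := by
  exact ⟨fun hS η χ s hs hχ hηχ hΛ => hS.family_isClassT hN hκ hε hs hχ hηχ hΛ,
    fun I μ α δ σ ρ W hT hW hdeg => hT.existsUnique_family hN hκ hε hW hdeg⟩
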